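/- **Caccioppoli estimate.** Let $N\ge 2$, $s\in(0,1)$, $\mathtt L\ge 1$, $q>1$, let $\Omega\subset\mathbb R^N$ be open and bounded, $T>0$, and $\Omega_T=\Omega\times(0,T]$. Let $K:\mathbb R^N\times\mathbb R^N\times(0,T]\to[0,\infty)$ be measurable with $$\frac{\mathtt L^{-1}}{|x-y|^{N+2s}}\le K(x,y,t)=K(y,x,t)\le\frac{\mathtt L}{|x-y|^{N+2s}}\qquad (x\ne y,\ t\in(0,T]).$$ A measurable $u:\mathbb R^N\times(0,T]\to\mathbb R$ with $u\in C_{\rm loc}(0,T;L^{q+1}_{\rm loc}(\Omega))\cap L^2_{\rm loc}(0,T;W^{s,2}_{\rm loc}(\Omega))$ (local in time meaning: on compact sub-intervals of $(0,T]$) is a *local weak sub-solution* of $$\partial_t(|u|^{q-1}u)+2\,\mathrm{P.V.}\!\int_{\mathbb R^N}(u(x,t)-u(y,t))K(x,y,t)\,dy=0\quad\text{in }\Omega_T$$ if for every $[t_1,t_2]\subset(0,T]$ one has $\int_{t_1}^{t_2}\int_{\mathbb R^N}\frac{|u(x,t)|}{1+|x|^{N+2s}}\,dx\,dt<\infty$,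 and, for every open $\tilde\Omega\Subset\Omega$ and every nonnegative $\phi\in L^2_{\rm loc}(0,T;W^{s,2}_0(\tilde\Omega))\cap W^{1,q+1}_{\rm loc}(0,T;L^{q+1}(\tilde\Omega))$, where $W^{s,2}_0(\tilde\Omega)$ denotes the functions of $W^{s,2}(\mathbb R^N)$ that vanish outside $\tilde\Omega$, $$\int_{\tilde\Omega}|u|^{q-1}u\,\phi\,dx\Big|_{t_1}^{t_2}-\int_{t_1}^{t_2}\!\!\int_{\tilde\Omega}|u|^{q-1}u\,\partial_t\phi\,dx\,dt+\int_{t_1}^{t_2}\!\!\iint_{\mathbb R^N\times\mathbb R^N}(u(x,t)-u(y,t))(\phi(x,t)-\phi(y,t))K(x,y,t)\,dx\,dy\,dt\le 0 .$$ Write $a_+=\max\{a,0\}$, $a_-=\max\{-a,0\}$, $\mathfrak g_+(a,k)=q\int_k^a|\tau|^{q-1}(\tau-k)_+\,d\tau$, and $Q_{R,\theta}(x_0,t_0)=B_R(x_0)\times(t_0-\theta,t_0)$. There is a constant $c>0$ depending only on $s,N,\mathtt L$ such that the following holds. Let $u$ be a nonnegative local weak sub-solution, let $0<\sigma_1<\sigma_2<\theta$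 and $0<r<\varrho<\tilde\varrho<R$ with $Q_{R,\theta}(x_0,t_0)\Subset\Omega_T$, let $k>0$, and put $k(t)=k+\ell(t)$ with $$\ell(t)=\Big[2\mathtt L\Big(\frac{R}{R-\tilde\varrho}\Big)^{N+2s}\int_{t_0-\theta}^{t}\int_{\mathbb R^N\setminus B_R(x_0)}\frac{u(x,\tau)}{|x-x_0|^{N+2s}}\,dx\,d\tau\Big]^{1/q}.$$ Then $$\begin{aligned} &\sup_{t\in(t_0-\sigma_1,t_0)}\int_{B_r(x_0)}\mathfrak g_+(u(x,t),k(t))\,dx +\int_{t_0-\sigma_1}^{t_0}\iint_{B_r(x_0)\times B_r(x_0)}\frac{|(u(x,t)-k(t))_+-(u(y,t)-k(t))_+|^2}{|x-y|^{N+2s}}\,dx\,dy\,dt\\ &\quad+\iint_{Q_{r,\sigma_1}(x_0,t_0)}(u(x,t)-k(t))_+\Big(\int_{B_r(x_0)}\frac{(u(y,t)-k(t))_-}{|x-y|^{N+2s}}\,dy\Big)dx\,dt\\ &\le\frac{c}{\sigma_2-\sigma_1}\iint_{Q_{\varrho,\sigma_2}(x_0,t_0)}\mathfrak g_+(u(x,t),k(t))\,dx\,dt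 +c\,\frac{\varrho^{2(1-s)}}{(\varrho-r)^2}\iint_{Q_{\varrho,\sigma_2}(x_0,t_0)}(u(x,t)-k(t))_+^2\,dx\,dt\\ &\quad+cR^N\Big(\frac1{\varrho-r}\Big)^{N+2s}\sup_{t\in[t_0-\theta,t_0]}\frac{1}{|B_R|}\int_{B_R(x_0)}(u(y,t)-k(t))_+\,dy\ \iint_{Q_{\varrho,\sigma_2}(x_0,t_0)}(u(x,t)-k(t))_+\,dx\,dt . \end{aligned}$$ -/

import Mathlib

open MeasureTheory Set Filter
open scoped ENNReal Topology

/-- The Euclidean space `ℝ^N`. -/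
abbrev RN (N : ℕ) : Type := EuclideanSpace ℝ (Fin N)

/-- The backward parabolic cylinder `Q_{R,θ}(x₀,t₀) = B_R(x₀) × (t₀ - θ, t₀)`. -/
def parabolicCylinder {N : ℕ} (R θ : ℝ) (x₀ : RN N) (t₀ : ℝ) : Set (RN N × ℝ) :=
  Metric.ball x₀ R ×ˢ Ioo (t₀ - θ) t₀

/-- `A ⋐ B`: the closure of `A` is compact and contained in `B`. -/
def CompactlyIn {X : Type*} [TopologicalSpace X] (A B : Set X) : Prop :=
  IsCompact (closure A) ∧ closure A ⊆ B

/-- The kernels `K : ℝ^N × ℝ^N × (0,T] → [0,∞)`: (Lebesgue) measurable, symmetric, and comparable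
to `|x-y|^{-(N+2s)}` with constant `L`. Values at times outside `(0,T]` play no role. -/
structure IsKernel {N : ℕ} (s L T : ℝ) (K : RN N → RN N → ℝ → ℝ) : Prop where
  aemeasurable : AEMeasurable (fun p : RN N × RN N × ℝ => K p.1 p.2.1 p.2.2)
    (volume.restrict (univ ×ˢ univ ×ˢ Ioc 0 T))
  nonneg : ∀ t ∈ Ioc 0 T, ∀ x y, 0 ≤ K x y t
  symm : ∀ t ∈ Ioc 0 T, ∀ x y, K x y t = K y x t
  lower : ∀ t ∈ Ioc 0 T, ∀ x y, x ≠ y → L⁻¹ / ‖x - y‖ ^ ((N : ℝ) + 2 * s) ≤ K x y t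
  upper : ∀ t ∈ Ioc 0 T, ∀ x y, x ≠ y → K x y t ≤ L / ‖x - y‖ ^ ((N : ℝ) + 2 * s)

/-- The squared Gagliardo seminorm of `W^{s,2}(A)`, with values in `[0,∞]`. -/
noncomputable def gagliardoSq {N : ℕ} (s : ℝ) (A : Set (RN N)) (v : RN N → ℝ) : ℝ≥0∞ :=
  ∫⁻ x in A, ∫⁻ y in A, ENNReal.ofReal (|v x - v y| ^ 2 / ‖x - y‖ ^ ((N : ℝ) + 2 * s))

/-- `v ∈ L²(t₁,t₂; W^{s,2}(A))`, for a function `v` of `(x,t)`. -/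
def MemL2Sobolev {N : ℕ} (s : ℝ) (A : Set (RN N)) (t₁ t₂ : ℝ) (v : RN N → ℝ → ℝ) : Prop :=
  AEMeasurable (fun z : RN N × ℝ => v z.1 z.2) (volume.restrict (A ×ˢ Icc t₁ t₂)) ∧
  ∫⁻ t in Icc t₁ t₂,
    ((∫⁻ x in A, ENNReal.ofReal (|v x t| ^ 2)) + gagliardoSq s A (fun x => v x t)) < ∞

/-- `v ∈ L^p(t₁,t₂; L^p(A))`, for a function `v` of `(x,t)`. -/
def MemLpCylinder {N : ℕ} (p : ℝ) (A : Set (RN N)) (t₁ t₂ : ℝ) (v : RN N → ℝ → ℝ) : Prop :=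
  MemLp (fun z : RN N × ℝ => v z.1 z.2) (ENNReal.ofReal p) (volume.restrict (A ×ˢ Icc t₁ t₂))

/-- `φ` is a nonnegative test function on `A`, with time derivative `dφ`:
`φ ∈ L²_loc(0,T; W^{s,2}_0(A)) ∩ W^{1,q+1}_loc(0,T; L^{q+1}(A))`. Here `W^{s,2}_0(A)` consists of
the functions of `W^{s,2}(ℝ^N)` that vanish outside `A`; "local in time" means on every compact
sub-interval of `(0,T]`; and `φ` is the representative that is absolutely continuous in time with
values in `L^{q+1}(A)`, so that `φ(t₂) - φ(t₁) = ∫_{t₁}^{t₂} dφ` in `L^{q+1}(A)` for all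
`t₁ ≤ t₂`. -/
structure IsTestFunction {N : ℕ} (s q T : ℝ) (A : Set (RN N)) (φ dφ : RN N → ℝ → ℝ) : Prop where
  nonneg : ∀ t ∈ Ioc 0 T, ∀ x, 0 ≤ φ x t
  eq_zero : ∀ t ∈ Ioc 0 T, ∀ x, x ∉ A → φ x t = 0
  sobolev : ∀ t₁ t₂, 0 < t₁ → t₁ ≤ t₂ → t₂ ≤ T → MemL2Sobolev s univ t₁ t₂ φ
  memLp : ∀ t₁ t₂, 0 < t₁ → t₁ ≤ t₂ → t₂ ≤ T → MemLpCylinder (q + 1) A t₁ t₂ φ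
  memLp_deriv : ∀ t₁ t₂, 0 < t₁ → t₁ ≤ t₂ → t₂ ≤ T → MemLpCylinder (q + 1) A t₁ t₂ dφ
  deriv : ∀ t₁ t₂, 0 < t₁ → t₁ ≤ t₂ → t₂ ≤ T →
    ∀ᵐ x ∂(volume.restrict A), φ x t₂ - φ x t₁ = ∫ τ in t₁..t₂, dφ x τ

/-- Local weak sub-solutions of `∂_t(|u|^{q-1}u) - 𝓛_K^s u = 0` in `Ω × (0,T]`. The function `u`
is defined on `ℝ^N × (0,T]` (its values at other times play no role), "local in time" means on
every compact sub-interval of `(0,T]`, and "local in space" on every set that is compactly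
contained in `Ω`. Under the integrability conditions all integrals in `weak` converge
absolutely. -/
structure IsLocalWeakSubsolution {N : ℕ} (s q T : ℝ) (Ω : Set (RN N))
    (K : RN N → RN N → ℝ → ℝ) (u : RN N → ℝ → ℝ) : Prop where
  aemeasurable : AEMeasurable (fun z : RN N × ℝ => u z.1 z.2)
    (volume.restrict (univ ×ˢ Ioc 0 T))
  /-- `u(·,t) ∈ L^{q+1}_loc(Ω)` for every `t ∈ (0,T]`. -/
  memLp : ∀ C : Set (RN N), IsCompact C → C ⊆ Ω → ∀ t ∈ Ioc 0 T,
    MemLp (fun x => u x t) (ENNReal.ofReal (q + 1)) (volume.restrict C)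
  /-- `t ↦ u(·,t)` is continuous on `(0,T]` with values in `L^{q+1}_loc(Ω)`. -/
  continuous : ∀ C : Set (RN N), IsCompact C → C ⊆ Ω → ∀ t₀ ∈ Ioc 0 T,
    Tendsto (fun t => eLpNorm (fun x => u x t - u x t₀) (ENNReal.ofReal (q + 1))
      (volume.restrict C)) (𝓝[Ioc 0 T] t₀) (𝓝 0)
  /-- `u ∈ L²_loc(0,T; W^{s,2}_loc(Ω))`. -/
  sobolev : ∀ A : Set (RN N), IsOpen A → CompactlyIn A Ω →
    ∀ t₁ t₂, 0 < t₁ → t₁ ≤ t₂ → t₂ ≤ T → MemL2Sobolev s A t₁ t₂ u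
  tail : ∀ t₁ t₂, 0 < t₁ → t₁ ≤ t₂ → t₂ ≤ T →
    ∫⁻ t in Icc t₁ t₂, ∫⁻ x : RN N,
      ENNReal.ofReal (|u x t| / (1 + ‖x‖ ^ ((N : ℝ) + 2 * s))) < ∞
  weak : ∀ t₁ t₂, 0 < t₁ → t₁ ≤ t₂ → t₂ ≤ T →
    ∀ A : Set (RN N), IsOpen A → CompactlyIn A Ω →
    ∀ φ dφ : RN N → ℝ → ℝ, IsTestFunction s q T A φ dφ →
      ((∫ x in A, |u x t₂| ^ (q - 1) * u x t₂ * φ x t₂)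
          - ∫ x in A, |u x t₁| ^ (q - 1) * u x t₁ * φ x t₁)
        - (∫ t in t₁..t₂, ∫ x in A, |u x t| ^ (q - 1) * u x t * dφ x t)
        + (∫ t in t₁..t₂, ∫ p : RN N × RN N,
            (u p.1 t - u p.2 t) * (φ p.1 t - φ p.2 t) * K p.1 p.2 t) ≤ 0

/-- `𝔤₊(a,k) = q ∫_k^a |τ|^{q-1} (τ-k)₊ dτ`. -/
noncomputable def gPlus (q a k : ℝ) : ℝ :=
  q * ∫ τ in k..a, |τ| ^ (q - 1) * max (τ - k) 0

/-- The function
`ℓ(t) = [2L (R/(R-ρ̃))^{N+2s} ∫_{t₀-θ}^t ∫_{ℝ^N∖B_R(x₀)} u(x,τ)/|x-x₀|^{N+2s} dx dτ]^{1/q}`. -/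
noncomputable def tailLevel {N : ℕ} (s q L R ρ' θ : ℝ) (x₀ : RN N) (t₀ : ℝ)
    (u : RN N → ℝ → ℝ) (t : ℝ) : ℝ :=
  (2 * L * (R / (R - ρ')) ^ ((N : ℝ) + 2 * s) *
    ∫ τ in (t₀ - θ)..t, ∫ x in (Metric.ball x₀ R)ᶜ,
      u x τ / ‖x - x₀‖ ^ ((N : ℝ) + 2 * s)) ^ (1 / q)

/-! Formally the equation is tested with `(u - k(t))₊ ζ² η`, where `ζ` and `η` are cutoffs in space
and time. Since the level moves, the parabolic term is `∂ₜ 𝔤₊(u, k(t))` plus `k'(t) (u^q -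
k(t)^q)₊`, and convexity of `τ ↦ τ^q` bounds the extra term below by `(k(t)^q)' (u - k(t))₊`. The
level is built so that `(k^q)' ≥ (ℓ^q)'`, and `(ℓ^q)'` is `2L (R/(R-ρ'))^{N+2s}` times the tail of
`u` outside `B_R`. This is what the nonlocal form can lose on pairs with one point outside `B_R`,
because `u ≥ 0` and `ζ` is supported in `B_ρ'`. The tail is thus absorbed by the growth of the level
and leaves no trace in the estimate. On `B_R × B_R`, `truncation_identity` splits the form into the
two good terms and the commutator `(u-k)₊(x) (u-k)₊(y) (ζ(x)-ζ(y))²`.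

A sub-solution has no time derivative, so the argument is made discrete instead of mollifying in
time. On `[τ - l, τ]` the test function is the truncation at the final time `τ`, held constant in
time. The parabolic term becomes an increment, and `gPlus_increment_le` is the exact discrete form
of the computation above, with constant one; hence the final constant does not depend on `q`.
Freezing the profile costs two errors. The near part of the form sees the difference of the profiles
at `τ` and at `t`, split off by Young's inequality (`near_pointwise`). The absorption of the tail
sees `∫ |u(τ) - u(τ-l)|`.

Integrating the one-step inequality (`testing_estimate`) over `τ` makes the first error small by
continuity of translations in `L²`, applied to the Gagliardo difference quotients of the profile;
the second is small by uniform continuity of `u` in time. The energies telescope: what survives is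
an average over the last step and the slope of `η` times the energy. Division by `l` and `l → 0`
give `LevelSetup.energy_estimate`. The supremum over all times follows since the energy is lower
semicontinuous along `L^{q+1}` convergence.

The commutator is estimated by the Lipschitz bound on `ζ` when both points lie in `B_ρ`, and by the
gap of width `(ρ-r)/2` between the support of `ζ` and the complement of `B_ρ` otherwise. The
estimates run on a measurable nonnegative representative `v` of `u`, with integrals in `[0,∞]`, so
that no finiteness of the right hand side is needed. -/

/-! ### Scalar inequalities for powers, for `𝔤₊` and for the moving level -/

theorem rpow_mul_le_young {p x y : ℝ} (hp : 0 < p) (hx : 0 ≤ x) (hy : 0 ≤ y) :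
    x ^ p * y ≤ p / (p + 1) * x ^ (p + 1) + y ^ (p + 1) / (p + 1) := by
  have hc : Real.HolderConjugate ((p + 1) / p) (p + 1) := by
    rw [Real.holderConjugate_iff]
    refine ⟨by rw [lt_div_iff₀ hp]; linarith, ?_⟩
    field_simp
  have h := Real.young_inequality_of_nonneg (Real.rpow_nonneg hx p) hy hc
  have e : (x ^ p) ^ ((p + 1) / p) = x ^ (p + 1) := by
    rw [← Real.rpow_mul hx]; congr 1; field_simp
  rw [e] at h
  calc x ^ p * y ≤ _ := h
    _ = _ := by field_simp

theorem rpow_tangent_le {q x y : ℝ} (hq : 1 < q) (hx : 0 ≤ x) (hy : 0 < y) :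
    y ^ q + q * y ^ (q - 1) * (x - y) ≤ x ^ q := by
  have h := rpow_mul_le_young (p := q - 1) (by linarith) hy.le hx
  have e : y ^ (q - 1) * y = y ^ q := by
    rw [← Real.rpow_add_one hy.ne']; congr 1; ring
  rw [sub_add_cancel] at h
  have hq0 : 0 < q := by linarith
  have h2 : q * (y ^ (q - 1) * x) ≤ (q - 1) * y ^ q + x ^ q := by
    calc q * (y ^ (q - 1) * x) ≤ q * ((q - 1) / q * y ^ q + x ^ q / q) := by gcongr
      _ = _ := by field_simp
  nlinarith

/-- The truncation enters only through `max a k`, so one closed formula serves both sides of the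
level. Measurability and continuity of `𝔤₊` jointly in `(a, k)` are read off from it. -/
theorem gPlus_eq {q : ℝ} (hq : 1 < q) (a : ℝ) {k : ℝ} (hk : 0 < k) :
    gPlus q a k = q / (q + 1) * max a k ^ (q + 1) - k * max a k ^ q + k ^ (q + 1) / (q + 1) := by
  have hq1 : q + 1 ≠ 0 := by linarith
  have hq0 : q ≠ 0 := by linarith
  rw [gPlus]
  rcases le_total a k with h | h
  · rw [max_eq_right h]
    have : ∫ τ in k..a, |τ| ^ (q - 1) * max (τ - k) 0 = ∫ _τ in k..a, (0 : ℝ) := by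
      refine intervalIntegral.integral_congr fun τ hτ => ?_
      rw [uIcc_of_ge h] at hτ
      simp [max_eq_right (sub_nonpos.2 hτ.2)]
    rw [this, intervalIntegral.integral_zero, Real.rpow_add_one hk.ne']
    field_simp; ring
  · rw [max_eq_left h]
    have : ∫ τ in k..a, |τ| ^ (q - 1) * max (τ - k) 0
        = ∫ τ in k..a, (τ ^ q - k * τ ^ (q - 1)) := by
      refine intervalIntegral.integral_congr fun τ hτ => ?_
      rw [uIcc_of_le h] at hτ
      have hτ0 : 0 < τ := hk.trans_le hτ.1
      have e : τ ^ (q - 1) * τ = τ ^ q := by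
        rw [← Real.rpow_add_one hτ0.ne']; congr 1; ring
      simp only [max_eq_left (sub_nonneg.2 hτ.1), abs_of_pos hτ0]
      rw [mul_sub, e]; ring
    rw [this, intervalIntegral.integral_sub, intervalIntegral.integral_const_mul,
      integral_rpow (Or.inl (by linarith)), integral_rpow (Or.inl (by linarith)), sub_add_cancel,
      Real.rpow_add_one hk.ne']
    · field_simp; ring
    · exact intervalIntegral.intervalIntegrable_rpow' (by linarith)
    · exact (intervalIntegral.intervalIntegrable_rpow' (by linarith)).const_mul _

theorem gPlus_nonneg {q : ℝ} (hq : 1 < q) (a : ℝ) {k : ℝ} (hk : 0 < k) : 0 ≤ gPlus q a k := by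
  rw [gPlus_eq hq a hk]
  have := rpow_mul_le_young (p := q) (by linarith) (hk.le.trans (le_max_right a k)) hk.le
  linarith

theorem gPlus_of_le {q : ℝ} (hq : 1 < q) {a k : ℝ} (hk : 0 < k) (h : a ≤ k) :
    gPlus q a k = 0 := by
  rw [gPlus_eq hq a hk, max_eq_right h, Real.rpow_add_one hk.ne']
  have hq1 : q + 1 ≠ 0 := by linarith
  field_simp; ring

theorem gPlus_le {q : ℝ} (hq : 1 < q) {a k : ℝ} (hk : 0 < k) (ha : 0 ≤ a) :
    gPlus q a k ≤ a ^ (q + 1) := by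
  rcases le_total a k with h | h
  · rw [gPlus_of_le hq hk h]; positivity
  · rw [gPlus_eq hq a hk, max_eq_left h]
    have h1 : k ^ (q + 1) ≤ k * a ^ q := by
      rw [Real.rpow_add_one hk.ne', mul_comm]; gcongr
    have h2 : k ^ (q + 1) / (q + 1) ≤ k ^ (q + 1) := div_le_self (by positivity) (by linarith)
    have h3 : q / (q + 1) * a ^ (q + 1) ≤ 1 * a ^ (q + 1) := by
      gcongr; rw [div_le_one (by linarith)]; linarith
    linarith

/-- As a function of `a^q`, `𝔤₊(·, k)` has derivative `(a - k)₊`, which is nondecreasing. So it is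
convex in that variable, and this is its tangent inequality at `b`. -/
theorem gPlus_sub_le {q : ℝ} (hq : 1 < q) {a b k : ℝ} (hk : 0 < k) (ha : 0 ≤ a) :
    gPlus q b k - gPlus q a k ≤ (b ^ q - a ^ q) * max (b - k) 0 := by
  rcases le_total b k with h | h
  · rw [gPlus_of_le hq hk h, max_eq_right (sub_nonpos.2 h)]
    linarith [gPlus_nonneg hq a hk]
  · have hb : 0 < b := hk.trans_le h
    rw [gPlus_eq hq a hk, gPlus_eq hq b hk, max_eq_left h, max_eq_left (sub_nonneg.2 h)]
    have hm : 0 < max a k := hk.trans_le (le_max_right a k)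
    have h1 := rpow_mul_le_young (p := q) (by linarith) hm.le hb.le
    have h2 : a ^ q ≤ max a k ^ q := by gcongr; exact le_max_left a k
    have h3 : a ^ q * (b - k) ≤ max a k ^ q * (b - k) :=
      mul_le_mul_of_nonneg_right h2 (sub_nonneg.2 h)
    have e : b ^ q * b = b ^ (q + 1) := (Real.rpow_add_one hb.ne' q).symm
    have e2 : q / (q + 1) * b ^ (q + 1) = b ^ (q + 1) - b ^ (q + 1) / (q + 1) := by
      have hq1 : q + 1 ≠ 0 := by linarith
      field_simp; ring
    nlinarith

/-- For `a ≥ k₂` the right side is `∫_{k₁}^{k₂} (a^q - k^q) dk ≥ (a^q - k₂^q)(k₂ - k₁)`. Convexity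
of `τ^q` compares slopes: the secant on `[k₁, k₂]` is no steeper than the tangent at `k₂`, and the
tangent no steeper than the secant on `[k₂, a]`. This gain from raising the level is what pays for
the tail. -/
theorem mul_max_le_gPlus_sub {q : ℝ} (hq : 1 < q) {a k₁ k₂ D : ℝ} (hk : 0 < k₁) (hk₂ : k₁ ≤ k₂)
    (hD : D ≤ k₂ ^ q - k₁ ^ q) :
    D * max (a - k₂) 0 ≤ gPlus q a k₁ - gPlus q a k₂ := by
  have hk2 : 0 < k₂ := hk.trans_le hk₂
  rcases le_total a k₂ with h | h
  · rw [gPlus_of_le hq hk2 h, max_eq_right (sub_nonpos.2 h)]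
    linarith [gPlus_nonneg hq a hk]
  · have ha : 0 < a := hk2.trans_le h
    rw [gPlus_eq hq a hk, gPlus_eq hq a hk2, max_eq_left h, max_eq_left (hk₂.trans h),
      max_eq_left (sub_nonneg.2 h)]
    have h1 := rpow_mul_le_young (p := q) (by linarith) hk2.le hk.le
    have h2 := rpow_tangent_le hq ha.le hk2
    have h3 := rpow_tangent_le hq hk.le hk2
    have e : k₂ ^ q * k₂ = k₂ ^ (q + 1) := (Real.rpow_add_one hk2.ne' q).symm
    have e2 : q / (q + 1) * k₂ ^ (q + 1) = k₂ ^ (q + 1) - k₂ ^ (q + 1) / (q + 1) := by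
      have hq1 : q + 1 ≠ 0 := by linarith
      field_simp; ring
    have h4 : D * (a - k₂) ≤ (q * k₂ ^ (q - 1) * (k₂ - k₁)) * (a - k₂) :=
      mul_le_mul_of_nonneg_right (by linarith) (sub_nonneg.2 h)
    have h5 : (k₂ ^ q + q * k₂ ^ (q - 1) * (a - k₂)) * (k₂ - k₁) ≤ a ^ q * (k₂ - k₁) :=
      mul_le_mul_of_nonneg_right h2 (sub_nonneg.2 hk₂)
    nlinarith

/-- The discrete form of `∂ₜ(u^q) (u - k(t))₊ ≥ ∂ₜ 𝔤₊(u, k(t)) + ∂ₜΛ (u - k(t))₊`. -/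
theorem gPlus_increment_le {q : ℝ} (hq : 1 < q) {a b k₁ k₂ D : ℝ} (hk : 0 < k₁) (hk₂ : k₁ ≤ k₂)
    (hD : D ≤ k₂ ^ q - k₁ ^ q) (ha : 0 ≤ a) :
    gPlus q b k₂ + D * max (a - k₂) 0 ≤ (b ^ q - a ^ q) * max (b - k₂) 0 + gPlus q a k₁ := by
  have h1 := gPlus_sub_le hq (b := b) (hk.trans_le hk₂) ha
  have h2 := mul_max_le_gPlus_sub hq (a := a) hk hk₂ hD
  linarith

/-- The points `y` and `k + x` lie between `x` and `k + y` and have the same sum, so a convex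
function has the smaller sum on the inner pair. -/
theorem rpow_sub_rpow_le_shift {q k x y : ℝ} (hq : 1 ≤ q) (hk : 0 ≤ k) (hx : 0 ≤ x) (hxy : x ≤ y) :
    y ^ q - x ^ q ≤ (k + y) ^ q - (k + x) ^ q := by
  rcases eq_or_lt_of_le (show 0 ≤ k + y - x by linarith) with h | h
  · have h1 : k = 0 := by linarith
    simp [h1]
  · have hc := (convexOn_rpow hq).2
    have hx' : x ∈ Ici (0 : ℝ) := hx
    have hy' : k + y ∈ Ici (0 : ℝ) := by simp only [mem_Ici]; linarith
    have ht : 0 ≤ (y - x) / (k + y - x) := div_nonneg (by linarith) h.le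
    have ht' : 0 ≤ k / (k + y - x) := div_nonneg hk h.le
    have hs : (y - x) / (k + y - x) + k / (k + y - x) = 1 := by field_simp; ring
    have h1 := hc hx' hy' ht' ht (by linarith)
    have h2 := hc hx' hy' ht ht' hs
    simp only [smul_eq_mul] at h1 h2
    have e1 : k / (k + y - x) * x + (y - x) / (k + y - x) * (k + y) = y := by field_simp; ring
    have e2 : (y - x) / (k + y - x) * x + k / (k + y - x) * (k + y) = k + x := by field_simp; ring
    rw [e1] at h1
    rw [e2] at h2
    linear_combination h1 + h2 + (x ^ q + (k + y) ^ q) * hs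

/-- With `x`, `y` the tail accumulated up to two times, this says that the `q`-th power of the level
grows at least as fast as the tail; it explains the exponent `1/q` in `ℓ`. -/
theorem sub_le_level_rpow_sub {q k x y : ℝ} (hq : 1 ≤ q) (hk : 0 ≤ k) (hx : 0 ≤ x) (hxy : x ≤ y) :
    y - x ≤ (k + y ^ (1 / q)) ^ q - (k + x ^ (1 / q)) ^ q := by
  have hq0 : q ≠ 0 := by linarith
  have h := rpow_sub_rpow_le_shift hq hk (Real.rpow_nonneg hx (1 / q))
    (Real.rpow_le_rpow hx hxy (by positivity))
  rwa [← Real.rpow_mul hx, ← Real.rpow_mul (hx.trans hxy), one_div_mul_cancel hq0, Real.rpow_one,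
    Real.rpow_one] at h

theorem abs_rpow_mul_self {q a : ℝ} (hq : 1 < q) (ha : 0 ≤ a) : |a| ^ (q - 1) * a = a ^ q := by
  rcases ha.eq_or_lt with rfl | h
  · simp [Real.zero_rpow (show q ≠ 0 by linarith)]
  · rw [abs_of_pos h, ← Real.rpow_add_one h.ne']; congr 1; ring

/-- The product of an increment with the increment of the cut truncation `(v - k)₊ z²`, expanded
into good terms and a commutator. -/
theorem truncation_identity (v v' k z z' : ℝ) :
    (v - v') * (max (v - k) 0 * z ^ 2 - max (v' - k) 0 * z' ^ 2)
      = (max (v - k) 0 * z - max (v' - k) 0 * z') ^ 2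
        - max (v - k) 0 * max (v' - k) 0 * (z - z') ^ 2
        + max (-(v' - k)) 0 * max (v - k) 0 * z ^ 2
        + max (-(v - k)) 0 * max (v' - k) 0 * z' ^ 2 := by
  rcases le_total (v - k) 0 with h | h <;> rcases le_total (v' - k) 0 with h' | h'
  · rw [max_eq_right h, max_eq_right h']; ring
  · rw [max_eq_right h, max_eq_left h', max_eq_right (neg_nonpos.2 h'),
      max_eq_left (neg_nonneg.2 h)]; ring
  · rw [max_eq_left h, max_eq_right h', max_eq_right (neg_nonpos.2 h),
      max_eq_left (neg_nonneg.2 h')]; ring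
  · rw [max_eq_left h, max_eq_left h', max_eq_right (neg_nonpos.2 h),
      max_eq_right (neg_nonpos.2 h')]; ring

/-! ### Integrals of the kernel near the diagonal and at infinity -/

/-- In polar coordinates the radial integrand is `y^{1-2s}`, integrable at `0` because `s < 1`. -/
theorem integrableOn_ball_norm_sq_div_rpow {N : ℕ} (hN : 2 ≤ N) {s : ℝ} (hs : s < 1) (r : ℝ) :
    IntegrableOn (fun z : RN N => ‖z‖ ^ 2 / ‖z‖ ^ ((N : ℝ) + 2 * s)) (Metric.ball 0 r) := by
  have : Nontrivial (RN N) := by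
    have : Nonempty (Fin N) := ⟨⟨0, by omega⟩⟩
    infer_instance
  rw [integrableOn_fun_norm_addHaar (f := fun y : ℝ => y ^ 2 / y ^ ((N : ℝ) + 2 * s)) volume]
  rcases le_total r 0 with hr | hr
  · rw [Ioo_eq_empty (by linarith)]; exact integrableOn_empty
  have h := (intervalIntegrable_iff_integrableOn_Ioo_of_le hr).1
    (intervalIntegral.intervalIntegrable_rpow' (a := 0) (b := r) (r := 1 - 2 * s)
      (by linarith))
  refine h.congr_fun (fun y hy => ?_) measurableSet_Ioo
  have hy0 : 0 < y := hy.1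
  simp only [finrank_euclideanSpace_fin, smul_eq_mul]
  rw [← Real.rpow_natCast, ← Real.rpow_natCast, ← Real.rpow_sub hy0, ← Real.rpow_add hy0]
  congr 1
  rw [Nat.cast_sub (by omega)]
  push_cast; ring

/-- For `x ∈ B_ρ(x₀)` the ball lies in `B_{2ρ}(x)`, and homogeneity of the integrand reduces that
ball to the unit ball, with the factor `(2ρ)^{2(1-s)}`. -/
theorem exists_lintegral_ball_kernel_le {N : ℕ} (hN : 2 ≤ N) {s : ℝ} (hs : s < 1) :
    ∃ C : ℝ, 0 < C ∧ ∀ (x₀ x : RN N) (ρ : ℝ), x ∈ Metric.ball x₀ ρ →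
      ∫⁻ y in Metric.ball x₀ ρ, ENNReal.ofReal (‖x - y‖ ^ 2 / ‖x - y‖ ^ ((N : ℝ) + 2 * s))
        ≤ ENNReal.ofReal (C * ρ ^ (2 * (1 - s))) := by
  set d : ℝ := (N : ℝ) + 2 * s with hd
  set g : RN N → ℝ := fun z => ‖z‖ ^ 2 / ‖z‖ ^ d with hg
  have hg0 : ∀ z, 0 ≤ g z := fun z => by positivity
  have hgm : Measurable g := by fun_prop
  set I : ℝ := ∫ z in Metric.ball (0 : RN N) 1, g z with hI
  have hI0 : 0 ≤ I := integral_nonneg hg0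
  -- The power of `2` comes from doubling the radius; `I + 1` replaces `I` so that positivity of the
  -- constant needs only `0 ≤ I`.
  refine ⟨2 ^ (2 * (1 - s)) * (I + 1), by positivity, fun x₀ x ρ hx => ?_⟩
  have hρ : 0 < ρ := dist_nonneg.trans_lt (Metric.mem_ball.1 hx)
  have h2 : (0 : ℝ) < 2 * ρ := by linarith
  have hscale : ∫ z in Metric.ball (0 : RN N) (2 * ρ), g z = (2 * ρ) ^ (2 * (1 - s)) * I := by
    have e := Measure.setIntegral_comp_smul_of_pos (volume : Measure (RN N)) g
      (Metric.ball (0 : RN N) 1) h2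
    rw [smul_ball h2.ne', smul_zero, Real.norm_of_nonneg h2.le, mul_one] at e
    have e2 : ∀ z : RN N, g ((2 * ρ) • z) = ((2 * ρ) ^ 2 / (2 * ρ) ^ d) * g z := fun z => by
      simp only [hg, norm_smul, Real.norm_of_nonneg h2.le]
      rw [Real.mul_rpow h2.le (norm_nonneg _)]
      ring
    simp_rw [e2] at e
    rw [integral_const_mul, finrank_euclideanSpace_fin, smul_eq_mul] at e
    have hpos : (0 : ℝ) < (2 * ρ) ^ N := by positivity
    rw [eq_inv_mul_iff_mul_eq₀ hpos.ne'] at e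
    rw [← e, ← mul_assoc, hI]
    congr 1
    rw [← Real.rpow_natCast, ← Real.rpow_natCast, ← Real.rpow_sub h2, ← Real.rpow_add h2]
    congr 1
    rw [hd]; push_cast; ring
  calc ∫⁻ y in Metric.ball x₀ ρ, ENNReal.ofReal (‖x - y‖ ^ 2 / ‖x - y‖ ^ d)
      ≤ ∫⁻ y, (Metric.ball (0 : RN N) (2 * ρ)).indicator (fun z => ENNReal.ofReal (g z)) (x - y) := by
        rw [← lintegral_indicator measurableSet_ball]
        refine lintegral_mono fun y => ?_
        by_cases hy : y ∈ Metric.ball x₀ ρ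
        · have : x - y ∈ Metric.ball (0 : RN N) (2 * ρ) := by
            rw [mem_ball_zero_iff, ← dist_eq_norm]
            have := dist_triangle_right x y x₀
            rw [Metric.mem_ball] at hx hy
            linarith
          rw [indicator_of_mem hy, indicator_of_mem this]
        · rw [indicator_of_notMem hy]; exact zero_le
    _ = ∫⁻ z, (Metric.ball (0 : RN N) (2 * ρ)).indicator (fun z => ENNReal.ofReal (g z)) z :=
        lintegral_sub_left_eq_self _ x
    _ = ∫⁻ z in Metric.ball (0 : RN N) (2 * ρ), ENNReal.ofReal (g z) := by
        rw [lintegral_indicator measurableSet_ball]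
    _ = ENNReal.ofReal (∫ z in Metric.ball (0 : RN N) (2 * ρ), g z) := by
        rw [ofReal_integral_eq_lintegral_ofReal (integrableOn_ball_norm_sq_div_rpow hN hs _)
          (Eventually.of_forall hg0)]
    _ ≤ _ := by
        rw [hscale]
        refine ENNReal.ofReal_le_ofReal ?_
        rw [Real.mul_rpow (by norm_num) hρ.le]
        have : (0 : ℝ) ≤ 2 ^ (2 * (1 - s)) * ρ ^ (2 * (1 - s)) := by positivity
        nlinarith

theorem lintegral_compl_ball_kernel_lt_top {N : ℕ} {s : ℝ} (hs : 0 < s) (x₀ : RN N) {R : ℝ}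
    (hR : 0 < R) :
    ∫⁻ y in (Metric.ball x₀ R)ᶜ, ENNReal.ofReal (1 / ‖y - x₀‖ ^ ((N : ℝ) + 2 * s)) < ∞ := by
  set d : ℝ := (N : ℝ) + 2 * s with hd
  have hd0 : 0 < d := by positivity
  have h : ∫⁻ y : RN N, ENNReal.ofReal ((1 + ‖y - x₀‖) ^ (-d)) < ∞ := by
    rw [lintegral_sub_right_eq_self (fun y : RN N => ENNReal.ofReal ((1 + ‖y‖) ^ (-d)))]
    exact finite_integral_one_add_norm (by rw [finrank_euclideanSpace_fin]; linarith)
  calc ∫⁻ y in (Metric.ball x₀ R)ᶜ, ENNReal.ofReal (1 / ‖y - x₀‖ ^ d)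
      ≤ ∫⁻ y in (Metric.ball x₀ R)ᶜ, ENNReal.ofReal ((1 + 1 / R) ^ d)
          * ENNReal.ofReal ((1 + ‖y - x₀‖) ^ (-d)) := by
        refine setLIntegral_mono' measurableSet_ball.compl fun y hy => ?_
        have hy' : R ≤ ‖y - x₀‖ := by
          simpa [dist_eq_norm] using hy
        have hy0 : 0 < ‖y - x₀‖ := hR.trans_le hy'
        rw [← ENNReal.ofReal_mul (by positivity)]
        refine ENNReal.ofReal_le_ofReal ?_
        rw [Real.rpow_neg (by positivity), ← div_eq_mul_inv, div_le_div_iff₀ (by positivity)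
          (by positivity), one_mul, ← Real.mul_rpow (by positivity) (by positivity)]
        refine Real.rpow_le_rpow (by positivity) ?_ hd0.le
        have : 1 ≤ 1 / R * ‖y - x₀‖ := by rw [one_div, inv_mul_eq_div, one_le_div hR]; exact hy'
        linarith
    _ ≤ ∫⁻ y, ENNReal.ofReal ((1 + 1 / R) ^ d) * ENNReal.ofReal ((1 + ‖y - x₀‖) ^ (-d)) :=
        setLIntegral_le_lintegral _ _
    _ < ∞ := by
        rw [lintegral_const_mul' _ _ ENNReal.ofReal_ne_top]
        exact ENNReal.mul_lt_top ENNReal.ofReal_lt_top h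

/-- Converts the tail condition in the definition of solution, weighted about the origin, into
finiteness of the tail centred at `x₀`. -/
theorem exists_one_add_norm_rpow_le {N : ℕ} {d : ℝ} (hd : 0 ≤ d) (x₀ : RN N) {R : ℝ}
    (hR : 0 < R) :
    ∃ C : ℝ, 0 < C ∧ ∀ y ∉ Metric.ball x₀ R, 1 + ‖y‖ ^ d ≤ C * ‖y - x₀‖ ^ d := by
  refine ⟨(1 / R) ^ d + (1 + ‖x₀‖ / R) ^ d, by positivity, fun y hy => ?_⟩
  have hy' : R ≤ ‖y - x₀‖ := by simpa [dist_eq_norm] using hy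
  have h1 : 1 ≤ 1 / R * ‖y - x₀‖ := by rw [one_div, inv_mul_eq_div, one_le_div hR]; exact hy'
  have h2 : ‖y‖ ≤ (1 + ‖x₀‖ / R) * ‖y - x₀‖ := by
    have : ‖y‖ ≤ ‖y - x₀‖ + ‖x₀‖ := by simpa using norm_add_le (y - x₀) x₀
    have h3 : ‖x₀‖ * 1 ≤ ‖x₀‖ * (1 / R * ‖y - x₀‖) := by gcongr
    calc ‖y‖ ≤ ‖y - x₀‖ + ‖x₀‖ * (1 / R * ‖y - x₀‖) := by linarith
      _ = _ := by ring
  rw [add_mul, ← Real.mul_rpow (by positivity) (by positivity),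
    ← Real.mul_rpow (by positivity) (by positivity)]
  exact add_le_add (Real.one_le_rpow h1 hd) (Real.rpow_le_rpow (norm_nonneg _) h2 hd)

/-- Off a ball, the distance to a point well inside is comparable to the distance to the centre. -/
theorem norm_sub_center_le {N : ℕ} {x₀ x y : RN N} {R ρ : ℝ} (hρ : ρ < R) (hρ0 : 0 ≤ ρ)
    (hx : ‖x - x₀‖ ≤ ρ) (hy : R ≤ ‖y - x₀‖) : ‖y - x₀‖ ≤ R / (R - ρ) * ‖x - y‖ := by
  have h : ‖y - x₀‖ ≤ ‖x - y‖ + ‖x - x₀‖ := by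
    rw [norm_sub_rev x y]; simpa using norm_add_le (y - x) (x - x₀)
  have hR : 0 < R - ρ := by linarith
  rw [div_mul_eq_mul_div, le_div_iff₀ hR]
  nlinarith

/-- Source of the factor `(R/(R-ρ'))^{N+2s}` in `ℓ`: off `B_R` the kernel seen from any point of the
support of the profile is dominated by the kernel seen from the centre. -/
theorem one_div_rpow_norm_sub_le {N : ℕ} {x₀ x y : RN N} {R ρ d : ℝ} (hd : 0 ≤ d) (hρ : ρ < R)
    (hρ0 : 0 ≤ ρ) (hx : ‖x - x₀‖ ≤ ρ) (hy : R ≤ ‖y - x₀‖) :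
    1 / ‖x - y‖ ^ d ≤ (R / (R - ρ)) ^ d * (1 / ‖y - x₀‖ ^ d) := by
  have hR : 0 < R := hρ0.trans_lt hρ
  have h := norm_sub_center_le hρ hρ0 hx hy
  have h1 : 0 < R / (R - ρ) := div_pos hR (by linarith)
  have hxy : 0 < ‖x - y‖ := by
    by_contra hc
    have : ‖x - y‖ = 0 := le_antisymm (not_lt.1 hc) (norm_nonneg _)
    rw [this] at h
    linarith
  have hy0 : 0 < ‖y - x₀‖ := hR.trans_le hy
  rw [mul_one_div, div_le_div_iff₀ (by positivity) (by positivity), one_mul,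
    ← Real.mul_rpow h1.le hxy.le]
  exact Real.rpow_le_rpow hy0.le h hd

/-! ### Translations in time, averaging over lags, and continuity in time -/

/-- Translations act continuously on `L²(X × ℝ)`; only translations along the time axis are used
here. -/
theorem exists_forall_lintegral_time_translate_sub_sq_le {X : Type*} [NormedAddCommGroup X]
    [MeasureSpace X] [BorelSpace X] [SecondCountableTopology X] [LocallyCompactSpace X]
    [(volume : Measure X).IsAddHaarMeasure] [SFinite (volume : Measure X)]
    {f : X × ℝ → ℝ} (hf : MemLp f 2) {ε : ℝ} (hε : 0 < ε) :
    ∃ h₀ > 0, ∀ l, |l| < h₀ →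
      ∫⁻ z, ENNReal.ofReal ((f z - f (z.1, z.2 - l)) ^ 2) ≤ ENNReal.ofReal ε := by
  have : Fact ((2 : ℝ≥0∞) ≠ ∞) := ⟨by simp⟩
  have : (volume : Measure (X × ℝ)).IsAddHaarMeasure := by
    rw [Measure.volume_eq_prod]; infer_instance
  set T : ℝ → X × ℝ := fun l => (0, -l)
  have hT : Continuous T := by fun_prop
  have hc : Continuous fun l => DomAddAct.mk (T l) +ᵥ hf.toLp f :=
    Continuous.vadd (M := (X × ℝ)ᵈᵃᵃ) (X := Lp ℝ 2 (volume : Measure (X × ℝ)))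
      (DomAddAct.continuous_mk.comp hT) continuous_const
  have h0 : DomAddAct.mk (T 0) +ᵥ hf.toLp f = hf.toLp f := by
    have : DomAddAct.mk (T 0) = 0 := by simp [T]; rfl
    rw [this, zero_vadd]
  obtain ⟨h₀, hh₀, H⟩ := Metric.continuousAt_iff.1 (hc.continuousAt (x := 0)) (Real.sqrt ε)
    (Real.sqrt_pos.2 hε)
  refine ⟨h₀, hh₀, fun l hl => ?_⟩
  have h1 := H (x := l) (by simpa using hl)
  rw [h0, dist_comm, DomAddAct.mk_vadd_toLp] at h1
  have h2 : edist (hf.toLp f) ((hf.comp_measurePreserving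
      (measurePreserving_vadd (T l) volume)).toLp (f <| T l +ᵥ ·)) ≤ ENNReal.ofReal (Real.sqrt ε) := by
    rw [edist_dist]; exact ENNReal.ofReal_le_ofReal h1.le
  rw [Lp.edist_toLp_toLp, eLpNorm_eq_lintegral_rpow_enorm_toReal (by simp) (by simp)] at h2
  have h3 := ENNReal.rpow_le_rpow h2 (z := 2) (by norm_num)
  rw [← ENNReal.rpow_mul, ENNReal.ofReal_rpow_of_nonneg (Real.sqrt_nonneg _) (by norm_num)] at h3
  simp only [ENNReal.toReal_ofNat, one_div, ne_eq, OfNat.ofNat_ne_zero, not_false_eq_true,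
    inv_mul_cancel₀, ENNReal.rpow_one, Real.rpow_ofNat, Real.sq_sqrt hε.le] at h3
  refine le_trans (le_of_eq (lintegral_congr fun z => ?_)) h3
  have hz : T l + z = (z.1, z.2 - l) := by ext1 <;> simp [T, sub_eq_neg_add]
  simp only [Pi.sub_apply, vadd_eq_add, hz]
  rw [Real.enorm_eq_ofReal_abs, ENNReal.ofReal_rpow_of_nonneg (abs_nonneg _) (by norm_num)]
  congr 1
  rw [Real.rpow_ofNat, sq_abs]

/-- Substitution `t = τ - l` and Tonelli. The integral over `τ` of one-step integrals becomes an
integral over lags `l < h` of full time integrals, which supplies the factor `h` to be divided out.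
-/
theorem lintegral_lintegral_Ioc_eq {Φ : ℝ → ℝ → ℝ≥0∞} (hΦ : Measurable (Function.uncurry Φ))
    (I : Set ℝ) (h : ℝ) :
    ∫⁻ τ in I, ∫⁻ t in Ioc (τ - h) τ, Φ t τ = ∫⁻ l in Ico 0 h, ∫⁻ τ in I, Φ (τ - l) τ := by
  have h1 : ∀ τ, ∫⁻ t in Ioc (τ - h) τ, Φ t τ = ∫⁻ l in Ico 0 h, Φ (τ - l) τ := fun τ => by
    rw [← lintegral_indicator measurableSet_Ioc, ← lintegral_indicator measurableSet_Ico,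
      ← lintegral_sub_left_eq_self _ τ]
    refine lintegral_congr fun l => ?_
    by_cases hl : l ∈ Ico 0 h
    · rw [indicator_of_mem hl, indicator_of_mem (by constructor <;> linarith [hl.1, hl.2])]
    · rw [indicator_of_notMem hl, indicator_of_notMem]
      rintro ⟨h2, h3⟩
      exact hl ⟨by linarith, by linarith⟩
  simp_rw [h1]
  refine lintegral_lintegral_swap (Measurable.aemeasurable ?_)
  exact hΦ.comp (g := Function.uncurry Φ) (f := fun z : ℝ × ℝ => (z.1 - z.2, z.1)) (by fun_prop)

theorem setLIntegral_Ioo_comp_sub (Φ : ℝ → ℝ≥0∞) (c₁ c₂ l : ℝ) :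
    ∫⁻ τ in Ioo c₁ c₂, Φ (τ - l) = ∫⁻ τ in Ioo (c₁ - l) (c₂ - l), Φ τ := by
  rw [← lintegral_indicator measurableSet_Ioo, ← lintegral_indicator measurableSet_Ioo,
    ← lintegral_sub_right_eq_self ((Ioo (c₁ - l) (c₂ - l)).indicator Φ) l]
  refine lintegral_congr fun τ => ?_
  by_cases hl : τ ∈ Ioo c₁ c₂
  · rw [indicator_of_mem hl, indicator_of_mem (by constructor <;> linarith [hl.1, hl.2])]
  · rw [indicator_of_notMem hl, indicator_of_notMem]
    rintro ⟨h2, h3⟩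
    exact hl ⟨by linarith, by linarith⟩

/-- Lower semicontinuity of the energy in time. A sequence of times violating the claim would have,
by convergence in measure, a subsequence converging almost everywhere, and Fatou's lemma contradicts
it. No growth condition on `G` is needed. -/
theorem eventually_lt_lintegral_of_tendsto_eLpNorm {X : Type*} [MeasurableSpace X]
    {μ : Measure X} {p : ℝ≥0∞} (hp : p ≠ 0) {u : X → ℝ → ℝ} {J : Set ℝ} {τ : ℝ} (hτ : τ ∈ J)
    (hu : ∀ t ∈ J, AEStronglyMeasurable (fun x => u x t) μ)
    (hlim : Tendsto (fun t => eLpNorm (fun x => u x t - u x τ) p μ) (𝓝[J] τ) (𝓝 0))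
    {κ : ℝ → ℝ} (hκ : ContinuousWithinAt κ J τ) {G : X → ℝ × ℝ → ℝ≥0∞}
    (hG : ∀ x, ContinuousAt (G x) (u x τ, κ τ))
    (hGm : ∀ t ∈ J, AEMeasurable (fun x => G x (u x t, κ t)) μ)
    {c : ℝ≥0∞} (hc : c < ∫⁻ x, G x (u x τ, κ τ) ∂μ) :
    ∀ᶠ t in 𝓝[J] τ, c < ∫⁻ x, G x (u x t, κ t) ∂μ := by
  by_contra hcon
  rw [not_eventually] at hcon
  obtain ⟨ts, hts, hts'⟩ := exists_seq_forall_of_frequently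
    (hcon.and_eventually self_mem_nhdsWithin)
  have hJ : ∀ n, ts n ∈ J := fun n => (hts' n).2
  have hm : TendstoInMeasure μ (fun n x => u x (ts n)) atTop (fun x => u x τ) :=
    tendstoInMeasure_of_tendsto_eLpNorm hp (fun n => hu _ (hJ n)) (hu τ hτ) (hlim.comp hts)
  obtain ⟨ns, hns, hae⟩ := hm.exists_seq_tendsto_ae
  have hκ' : Tendsto (fun i => κ (ts (ns i))) atTop (𝓝 (κ τ)) :=
    (hκ.tendsto.comp hts).comp hns.tendsto_atTop
  refine absurd hc (not_lt.2 ?_)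
  calc ∫⁻ x, G x (u x τ, κ τ) ∂μ
      = ∫⁻ x, liminf (fun i => G x (u x (ts (ns i)), κ (ts (ns i)))) atTop ∂μ := by
        refine lintegral_congr_ae ?_
        filter_upwards [hae] with x hx
        exact (((hG x).tendsto.comp (hx.prodMk_nhds hκ')).liminf_eq).symm
    _ ≤ liminf (fun i => ∫⁻ x, G x (u x (ts (ns i)), κ (ts (ns i))) ∂μ) atTop :=
        lintegral_liminf_le' fun i => hGm _ (hJ _)
    _ ≤ liminf (fun _ : ℕ => c) atTop :=
        liminf_le_liminf (Eventually.of_forall fun i => not_lt.1 (hts' (ns i)).1)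
    _ = c := by simp

/-- A continuous map from a compact set of times to `L^p` is bounded and uniformly continuous. -/
theorem exists_eLpNorm_le_and_modulus {X : Type*} [MeasurableSpace X]
    {μ : Measure X} {p : ℝ≥0∞} (hp : 1 ≤ p) {u : X → ℝ → ℝ} {J : Set ℝ} (hJ : IsCompact J)
    (hu : ∀ t ∈ J, MemLp (fun x => u x t) p μ)
    (hlim : ∀ τ ∈ J, Tendsto (fun t => eLpNorm (fun x => u x t - u x τ) p μ) (𝓝[J] τ) (𝓝 0)) :
    (∃ M : ℝ, ∀ t ∈ J, eLpNorm (fun x => u x t) p μ ≤ ENNReal.ofReal M) ∧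
    ∀ ε > 0, ∃ δ > 0, ∀ t ∈ J, ∀ t' ∈ J, |t - t'| < δ →
      eLpNorm (fun x => u x t - u x t') p μ ≤ ENNReal.ofReal ε := by
  have : Fact (1 ≤ p) := ⟨hp⟩
  have : CompactSpace J := isCompact_iff_compactSpace.1 hJ
  set U : J → Lp ℝ p μ := fun t => (hu t t.2).toLp _ with hU
  have hc : Continuous U := by
    rw [continuous_iff_continuousAt]
    intro τ
    rw [ContinuousAt, tendsto_iff_edist_tendsto_0]
    have h1 := (hlim τ τ.2).comp (tendsto_nhdsWithin_iff.2
      ⟨continuous_subtype_val.tendsto τ, Eventually.of_forall fun t => t.2⟩)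
    refine h1.congr fun t => ?_
    simp only [hU, Lp.edist_toLp_toLp]
    rfl
  have huc := CompactSpace.uniformContinuous_of_continuous hc
  constructor
  · obtain ⟨M, hM⟩ := (isCompact_range hc).isBounded.exists_norm_le
    refine ⟨M, fun t ht => ?_⟩
    have := hM (U ⟨t, ht⟩) (mem_range_self _)
    have h2 : ‖U ⟨t, ht⟩‖ₑ ≤ ENNReal.ofReal M := by
      rw [← ofReal_norm]; exact ENNReal.ofReal_le_ofReal this
    rwa [hU, Lp.enorm_toLp] at h2
  · intro ε hε
    obtain ⟨δ, hδ, H⟩ := Metric.uniformContinuous_iff.1 huc ε hε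
    refine ⟨δ, hδ, fun t ht t' ht' htt => ?_⟩
    have h1 := H (a := ⟨t, ht⟩) (b := ⟨t', ht'⟩) (by rw [Subtype.dist_eq, Real.dist_eq]; exact htt)
    have h2 : edist (U ⟨t, ht⟩) (U ⟨t', ht'⟩) ≤ ENNReal.ofReal ε := by
      rw [edist_dist]; exact ENNReal.ofReal_le_ofReal h1.le
    rwa [hU, Lp.edist_toLp_toLp] at h2

/-! ### From signed integrals to integrals with values in `[0,∞]` -/

/-- The inequality `g ≤ f + P` with the signed `f` split into positive and negative parts, each put
on the side where no subtraction in `[0,∞]` occurs. -/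
theorem ofReal_add_ofReal_neg_le {f g P : ℝ} (hg : 0 ≤ g) (hP : 0 ≤ P) (h : g ≤ f + P) :
    ENNReal.ofReal g + ENNReal.ofReal (-f) ≤ ENNReal.ofReal P + ENNReal.ofReal f := by
  rcases le_total 0 f with h0 | h0
  · rw [ENNReal.ofReal_of_nonpos (neg_nonpos.2 h0), add_zero, ← ENNReal.ofReal_add hP h0]
    exact ENNReal.ofReal_le_ofReal (by linarith)
  · rw [ENNReal.ofReal_of_nonpos h0, add_zero, ← ENNReal.ofReal_add hg (neg_nonneg.2 h0)]
    exact ENNReal.ofReal_le_ofReal (by linarith)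

/-- Passage from a signed inequality `∫ f₁ + ∫ f₂ ≤ 0` to nonnegative lower and upper parts. -/
theorem lintegral_add_le_of_integral_add_nonpos {α β : Type*} [MeasurableSpace α]
    [MeasurableSpace β] {μ : Measure α} {ν : Measure β} {f₁ : α → ℝ} {f₂ : β → ℝ}
    (h₁ : Integrable f₁ μ) (h₂ : Integrable f₂ ν) (h : ∫ x, f₁ x ∂μ + ∫ y, f₂ y ∂ν ≤ 0)
    {g₁ P₁ : α → ℝ≥0∞} {g₂ P₂ : β → ℝ≥0∞}
    (hg₁ : ∀ᵐ x ∂μ, g₁ x + ENNReal.ofReal (-f₁ x) ≤ P₁ x + ENNReal.ofReal (f₁ x))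
    (hg₂ : ∀ᵐ x ∂ν, g₂ x + ENNReal.ofReal (-f₂ x) ≤ P₂ x + ENNReal.ofReal (f₂ x)) :
    ∫⁻ x, g₁ x ∂μ + ∫⁻ y, g₂ y ∂ν ≤ ∫⁻ x, P₁ x ∂μ + ∫⁻ y, P₂ y ∂ν := by
  have m₁ : AEMeasurable (fun x => ENNReal.ofReal (-f₁ x)) μ := h₁.neg.aemeasurable.ennreal_ofReal
  have m₂ : AEMeasurable (fun x => ENNReal.ofReal (-f₂ x)) ν := h₂.neg.aemeasurable.ennreal_ofReal
  have k₁ := lintegral_mono_ae hg₁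
  have k₂ := lintegral_mono_ae hg₂
  rw [lintegral_add_right' _ m₁, lintegral_add_right' _ h₁.aemeasurable.ennreal_ofReal] at k₁
  rw [lintegral_add_right' _ m₂, lintegral_add_right' _ h₂.aemeasurable.ennreal_ofReal] at k₂
  rw [integral_eq_lintegral_pos_part_sub_lintegral_neg_part h₁,
    integral_eq_lintegral_pos_part_sub_lintegral_neg_part h₂] at h
  have a₁ := h₁.lintegral_lt_top.ne
  have a₂ := h₂.lintegral_lt_top.ne
  have b₁ := h₁.neg.lintegral_lt_top.ne
  have b₂ := h₂.neg.lintegral_lt_top.ne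
  simp only [Pi.neg_apply] at b₁ b₂
  set A₁ := ∫⁻ x, ENNReal.ofReal (f₁ x) ∂μ
  set A₂ := ∫⁻ x, ENNReal.ofReal (f₂ x) ∂ν
  set B₁ := ∫⁻ x, ENNReal.ofReal (-f₁ x) ∂μ
  set B₂ := ∫⁻ x, ENNReal.ofReal (-f₂ x) ∂ν
  have hAB : A₁ + A₂ ≤ B₁ + B₂ := by
    rw [← ENNReal.toReal_le_toReal (ENNReal.add_ne_top.2 ⟨a₁, a₂⟩)
      (ENNReal.add_ne_top.2 ⟨b₁, b₂⟩), ENNReal.toReal_add a₁ a₂, ENNReal.toReal_add b₁ b₂]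
    linarith
  have hB : B₁ + B₂ ≠ ∞ := ENNReal.add_ne_top.2 ⟨b₁, b₂⟩
  -- Only the negative parts of `f₁` and `f₂` are cancelled, and these have finite integral. The
  -- bounds `P₁`, `P₂` may have infinite integral and need not be measurable.
  refine (ENNReal.add_le_add_iff_right hB).1 ?_
  calc _ = (∫⁻ x, g₁ x ∂μ + B₁) + (∫⁻ y, g₂ y ∂ν + B₂) := by
        abel
    _ ≤ _ := add_le_add k₁ k₂
    _ = (∫⁻ x, P₁ x ∂μ + ∫⁻ y, P₂ y ∂ν) + (A₁ + A₂) := by abel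
    _ ≤ _ := by gcongr

/-! ### The quantities of the estimate, and pointwise bounds for the form -/

/-- The squared Gagliardo seminorm, as an integral over the product `B × B`. -/
noncomputable def gagliardoProd {N : ℕ} (s : ℝ) (B : Set (RN N)) (φ : RN N → ℝ) : ℝ≥0∞ :=
  ∫⁻ p in B ×ˢ B, ENNReal.ofReal ((φ p.1 - φ p.2) ^ 2 / ‖p.1 - p.2‖ ^ ((N : ℝ) + 2 * s))

/-- The tail `∫_{ℝ^N ∖ B} v(y,t) / |y - x₀|^{N+2s} dy`. -/
noncomputable def farTail {N : ℕ} (s : ℝ) (B : Set (RN N)) (x₀ : RN N) (v : RN N → ℝ → ℝ)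
    (t : ℝ) : ℝ≥0∞ :=
  ∫⁻ y in Bᶜ, ENNReal.ofReal (v y t / ‖y - x₀‖ ^ ((N : ℝ) + 2 * s))

/-- The integrand of the good terms of the Caccioppoli estimate. -/
noncomputable def goodIntegrand (v v' k : ℝ) : ℝ :=
  (max (v - k) 0 - max (v' - k) 0) ^ 2 + max (-(v' - k)) 0 * max (v - k) 0
    + max (-(v - k)) 0 * max (v' - k) 0

/-- The good terms of the Caccioppoli estimate at time `t`. -/
noncomputable def goodForm {N : ℕ} (s : ℝ) (B : Set (RN N)) (κ : ℝ → ℝ) (v : RN N → ℝ → ℝ)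
    (t : ℝ) : ℝ≥0∞ :=
  ∫⁻ p in B ×ˢ B,
    ENNReal.ofReal (goodIntegrand (v p.1 t) (v p.2 t) (κ t) / ‖p.1 - p.2‖ ^ ((N : ℝ) + 2 * s))

/-- The commutator term produced by the spatial cutoff at time `t`. -/
noncomputable def badForm {N : ℕ} (s : ℝ) (B : Set (RN N)) (κ : ℝ → ℝ) (ζ : RN N → ℝ)
    (v : RN N → ℝ → ℝ) (t : ℝ) : ℝ≥0∞ :=
  ∫⁻ p in B ×ˢ B, ENNReal.ofReal (max (v p.1 t - κ t) 0 * max (v p.2 t - κ t) 0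
    * (ζ p.1 - ζ p.2) ^ 2 / ‖p.1 - p.2‖ ^ ((N : ℝ) + 2 * s))

/-- The localized energy `∫_B 𝔤₊(v, κ) ζ²` at time `t`. -/
noncomputable def cutEnergy {N : ℕ} (q : ℝ) (B : Set (RN N)) (κ : ℝ → ℝ) (ζ : RN N → ℝ)
    (v : RN N → ℝ → ℝ) (t : ℝ) : ℝ≥0∞ :=
  ∫⁻ x in B, ENNReal.ofReal (gPlus q (v x t) (κ t) * ζ x ^ 2)

/-- The truncated test function `η(t) (v(·,t) - κ(t))₊ ζ²`. -/
noncomputable def truncTest {N : ℕ} (η κ : ℝ → ℝ) (ζ : RN N → ℝ) (v : RN N → ℝ → ℝ) (t : ℝ)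
    (x : RN N) : ℝ :=
  η t * (max (v x t - κ t) 0 * ζ x ^ 2)

theorem goodIntegrand_nonneg (v v' k : ℝ) : 0 ≤ goodIntegrand v v' k := by
  unfold goodIntegrand; positivity

/-- `P` is the increment of a profile frozen at another time, and its defect from the increment of
`η (v - k)₊ z²` is split off by Young's inequality with parameter `ε`. The remaining part is treated
by `truncation_identity`, with the lower kernel bound used on the good terms and the upper one on
the commutator. The indicator `χ` keeps the good terms only where the cutoff equals one; elsewhere
they are nonnegative and dropped. -/
theorem near_pointwise {v v' k z z' η K k₀ L ε P χ : ℝ} (hk₀ : 0 ≤ k₀) (hL : 0 < L) (hε : 0 < ε)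
    (hη : 0 ≤ η) (hK₁ : L⁻¹ * k₀ ≤ K) (hK₂ : K ≤ L * k₀)
    (hχ : χ = 0 ∨ (χ = 1 ∧ z = 1 ∧ z' = 1)) :
    χ * (L⁻¹ * (η * (goodIntegrand v v' k * k₀))) ≤ (v - v') * P * K +
      (L * (η * (max (v - k) 0 * max (v' - k) 0 * (z - z') ^ 2 * k₀))
        + ε * L * ((v - v') ^ 2 * k₀)
        + L / (4 * ε) * ((P - η * (max (v - k) 0 * z ^ 2 - max (v' - k) 0 * z' ^ 2)) ^ 2 * k₀)) := by
  have hid := truncation_identity v v' k z z'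
  set a := max (v - k) 0
  set b := max (v' - k) 0
  set c := max (-(v - k)) 0 with hc
  set c' := max (-(v' - k)) 0 with hc'
  have ha : 0 ≤ a := le_max_right _ _
  have hb : 0 ≤ b := le_max_right _ _
  have hc0 : 0 ≤ c := le_max_right _ _
  have hc0' : 0 ≤ c' := le_max_right _ _
  have hK0 : 0 ≤ K := le_trans (by positivity) hK₁
  set δ := P - η * (a * z ^ 2 - b * z' ^ 2) with hδ
  have hP : (v - v') * P = η * ((v - v') * (a * z ^ 2 - b * z' ^ 2)) + (v - v') * δ := by
    rw [hδ]; ring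
  -- Completion of the square `ε ((v - v') + δ/(2ε))²`.
  have h1 : -(ε * (v - v') ^ 2 + 1 / (4 * ε) * δ ^ 2) ≤ (v - v') * δ := by
    have : 0 ≤ ε * ((v - v') + 1 / (2 * ε) * δ) ^ 2 := by positivity
    have e : ε * ((v - v') + 1 / (2 * ε) * δ) ^ 2
        = ε * (v - v') ^ 2 + (v - v') * δ + 1 / (4 * ε) * δ ^ 2 := by field_simp; ring
    linarith
  have h2 : -((ε * (v - v') ^ 2 + 1 / (4 * ε) * δ ^ 2) * (L * k₀)) ≤ (v - v') * δ * K := by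
    have h3 : (ε * (v - v') ^ 2 + 1 / (4 * ε) * δ ^ 2) * K
      ≤ (ε * (v - v') ^ 2 + 1 / (4 * ε) * δ ^ 2) * (L * k₀) := by gcongr
    nlinarith
  have h4 : η * (a * b * (z - z') ^ 2) * K ≤ η * (a * b * (z - z') ^ 2) * (L * k₀) := by gcongr
  have h5 : χ * (L⁻¹ * (η * (goodIntegrand v v' k * k₀)))
      ≤ η * ((a * z - b * z') ^ 2 + c' * a * z ^ 2 + c * b * z' ^ 2) * K := by
    rcases hχ with rfl | ⟨rfl, rfl, rfl⟩
    · rw [zero_mul]; positivity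
    · have : η * goodIntegrand v v' k * (L⁻¹ * k₀) ≤ η * goodIntegrand v v' k * K := by
        have := goodIntegrand_nonneg v v' k
        gcongr
      calc _ = η * goodIntegrand v v' k * (L⁻¹ * k₀) := by ring
        _ ≤ _ := this
        _ = _ := by simp only [goodIntegrand]; ring
  have e1 : (v - v') * P * K = η * ((a * z - b * z') ^ 2 + c' * a * z ^ 2 + c * b * z' ^ 2) * K
      - η * (a * b * (z - z') ^ 2) * K + (v - v') * δ * K := by
    rw [hP, hid]; ring
  have e2 : L / (4 * ε) * (δ ^ 2 * k₀) = 1 / (4 * ε) * δ ^ 2 * (L * k₀) := by ring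
  rw [e1, e2]
  linarith

/-- Nonnegativity of `v` is decisive: `v ψ K` has the good sign and is dropped, so the loss involves
the value `v'` at the far point alone, which integrates to the tail. -/
theorem far_pointwise {v v' ψ K k₀ L c : ℝ} (hL : 0 ≤ L) (hv : 0 ≤ v) (hv' : 0 ≤ v') (hψ : 0 ≤ ψ)
    (hK0 : 0 ≤ K) (hK : K ≤ L * k₀) (hc : ψ = 0 ∨ k₀ ≤ c) :
    0 ≤ (v - v') * ψ * K + L * ψ * (v' * c) := by
  rcases hc with rfl | hc
  · simp
  · have h1 : v' * ψ * K ≤ v' * ψ * (L * c) := by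
      gcongr
      exact hK.trans (by gcongr)
    have h2 : 0 ≤ v * ψ * K := by positivity
    nlinarith

theorem far_abs_pointwise {v v' ψ K k₀ L c : ℝ} (hL : 0 ≤ L) (hv : 0 ≤ v) (hv' : 0 ≤ v')
    (hψ : 0 ≤ ψ) (hK0 : 0 ≤ K) (hK : K ≤ L * k₀) (hc : ψ = 0 ∨ k₀ ≤ c) :
    |(v - v') * ψ * K| ≤ L * (ψ * v) * c + L * ψ * (v' * c) := by
  rcases hc with rfl | hc
  · simp
  · have h0 : |v - v'| ≤ v + v' := by rw [abs_le]; constructor <;> linarith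
    have hc0 : K ≤ L * c := hK.trans (by gcongr)
    rw [abs_mul, abs_mul, abs_of_nonneg hψ, abs_of_nonneg hK0]
    calc |v - v'| * ψ * K ≤ (v + v') * ψ * (L * c) := by gcongr
      _ = _ := by ring

theorem lintegral_indicator_prod_mul {X : Type*} [MeasurableSpace X] {μ : Measure X} [SFinite μ]
    {A C : Set X} (hA : MeasurableSet A) (hC : MeasurableSet C) {F H : X → ℝ≥0∞}
    (hF : Measurable F) (hH : Measurable H) :
    ∫⁻ p, (A ×ˢ C).indicator (fun p => F p.1 * H p.2) p ∂(μ.prod μ)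
      = (∫⁻ x in A, F x ∂μ) * ∫⁻ y in C, H y ∂μ := by
  rw [lintegral_indicator (hA.prod hC), ← Measure.prod_restrict,
    lintegral_prod_mul hF.aemeasurable hH.aemeasurable]

/-! ### Spatial profiles and absolute convergence of the nonlocal form -/

/-- Admissible spatial profiles for testing: square integrable on `B_R(x₀)` with finite Gagliardo
seminorm there, and supported well inside. -/
structure IsSpatialProfile {N : ℕ} (s ρ' R : ℝ) (x₀ : RN N) (ψ : RN N → ℝ) : Prop where
  measurable : Measurable ψ
  nonneg : ∀ x, 0 ≤ ψ x
  eq_zero : ∀ x, ρ' < ‖x - x₀‖ → ψ x = 0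
  sq : ∫⁻ x in Metric.ball x₀ R, ENNReal.ofReal (ψ x ^ 2) < ∞
  gagliardo : gagliardoProd s (Metric.ball x₀ R) ψ < ∞

theorem IsSpatialProfile.lintegral_lt_top {N : ℕ} {s ρ' R : ℝ} {x₀ : RN N} {ψ : RN N → ℝ}
    (h : IsSpatialProfile s ρ' R x₀ ψ) :
    ∫⁻ x in Metric.ball x₀ R, ENNReal.ofReal (ψ x) < ∞ := by
  calc ∫⁻ x in Metric.ball x₀ R, ENNReal.ofReal (ψ x)
      ≤ ∫⁻ x in Metric.ball x₀ R, (1 + ENNReal.ofReal (ψ x ^ 2)) := by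
        refine lintegral_mono fun x => ?_
        rw [← ENNReal.ofReal_one, ← ENNReal.ofReal_add zero_le_one (sq_nonneg _)]
        exact ENNReal.ofReal_le_ofReal (by nlinarith [sq_nonneg (ψ x - 1)])
    _ < ∞ := by
        rw [lintegral_add_left measurable_const, setLIntegral_const, one_mul]
        exact ENNReal.add_lt_top.2 ⟨measure_ball_lt_top, h.sq⟩

theorem profile_eq_zero_or_kernel_le {N : ℕ} {s ρ' R : ℝ} (hs : 0 < s) (hρ : 0 ≤ ρ') (hR : ρ' < R)
    {x₀ : RN N} {ψ : RN N → ℝ} (h : ∀ x, ρ' < ‖x - x₀‖ → ψ x = 0) (x : RN N) {y : RN N}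
    (hy : y ∉ Metric.ball x₀ R) :
    ψ x = 0 ∨ 1 / ‖x - y‖ ^ ((N : ℝ) + 2 * s)
      ≤ (R / (R - ρ')) ^ ((N : ℝ) + 2 * s) * (1 / ‖y - x₀‖ ^ ((N : ℝ) + 2 * s)) := by
  rcases lt_or_ge ρ' ‖x - x₀‖ with hx | hx
  · exact Or.inl (h x hx)
  · refine Or.inr (one_div_rpow_norm_sub_le (by positivity) hR hρ hx ?_)
    simpa [dist_eq_norm] using hy

theorem profile_eq_zero_of_notMem {N : ℕ} {ρ' R : ℝ} (hR : ρ' < R)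
    {x₀ : RN N} {ψ : RN N → ℝ} (h : ∀ x, ρ' < ‖x - x₀‖ → ψ x = 0) {y : RN N}
    (hy : y ∉ Metric.ball x₀ R) : ψ y = 0 :=
  h y (hR.trans_le (by simpa [dist_eq_norm] using hy))

/-- On `B × B` the product of increments is bounded by the sum of their squares. On `B × Bᶜ` the
profile vanishes at the far point, and the kernel centred at `x₀` makes the bound a product of
functions of `x` and of `y`. The factor `2` counts the mirror region `Bᶜ × B`; on `Bᶜ × Bᶜ` the
integrand is zero. -/
theorem form_enorm_le {N : ℕ} {s L ρ' R : ℝ} (hs : 0 < s) (hL : 1 ≤ L) (hρ : 0 ≤ ρ') (hR : ρ' < R)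
    {x₀ : RN N} {ψ : RN N → ℝ} (hψ : IsSpatialProfile s ρ' R x₀ ψ) {w : RN N → ℝ}
    (hw : Measurable w) (hw0 : ∀ x, 0 ≤ w x) {k : RN N → RN N → ℝ}
    (hk1 : ∀ x y, L⁻¹ * (1 / ‖x - y‖ ^ ((N : ℝ) + 2 * s)) ≤ k x y)
    (hk2 : ∀ x y, k x y ≤ L * (1 / ‖x - y‖ ^ ((N : ℝ) + 2 * s))) :
    ∫⁻ p : RN N × RN N, ‖(w p.1 - w p.2) * (ψ p.1 - ψ p.2) * k p.1 p.2‖ₑ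
      ≤ ENNReal.ofReal L * (gagliardoProd s (Metric.ball x₀ R) w
            + gagliardoProd s (Metric.ball x₀ R) ψ)
        + 2 * (ENNReal.ofReal L * ((∫⁻ x in Metric.ball x₀ R, ENNReal.ofReal (ψ x ^ 2))
              + ∫⁻ x in Metric.ball x₀ R, ENNReal.ofReal (w x ^ 2)) *
            (ENNReal.ofReal ((R / (R - ρ')) ^ ((N : ℝ) + 2 * s)) *
              ∫⁻ y in (Metric.ball x₀ R)ᶜ, ENNReal.ofReal (1 / ‖y - x₀‖ ^ ((N : ℝ) + 2 * s)))
          + ENNReal.ofReal L * (∫⁻ x in Metric.ball x₀ R, ENNReal.ofReal (ψ x)) *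
            (ENNReal.ofReal ((R / (R - ρ')) ^ ((N : ℝ) + 2 * s)) *
              ∫⁻ y in (Metric.ball x₀ R)ᶜ,
                ENNReal.ofReal (w y / ‖y - x₀‖ ^ ((N : ℝ) + 2 * s)))) := by
  have hL0 : 0 < L := by linarith
  have hRR : 0 < R / (R - ρ') := div_pos (by linarith) (by linarith)
  have hψm := hψ.measurable
  have hψ0 := hψ.nonneg
  set d : ℝ := (N : ℝ) + 2 * s with hd
  set B := Metric.ball x₀ R with hB
  have hBm : MeasurableSet B := measurableSet_ball
  set c : ℝ := (R / (R - ρ')) ^ d with hc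
  have hc0 : 0 < c := by positivity
  have hk0 : ∀ x y, 0 ≤ k x y := fun x y => le_trans (by positivity) (hk1 x y)
  let F1 : RN N → ℝ≥0∞ := fun x => ENNReal.ofReal (L * (ψ x * w x))
  let H1 : RN N → ℝ≥0∞ := fun y => ENNReal.ofReal (c * (1 / ‖y - x₀‖ ^ d))
  let F2 : RN N → ℝ≥0∞ := fun x => ENNReal.ofReal (L * ψ x)
  let H2 : RN N → ℝ≥0∞ := fun y => ENNReal.ofReal (w y * (c * (1 / ‖y - x₀‖ ^ d)))
  have mF1 : Measurable F1 := by fun_prop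
  have mF2 : Measurable F2 := by fun_prop
  have mH1 : Measurable H1 := by fun_prop
  have mH2 : Measurable H2 := by fun_prop
  have hfar : ∀ x y, x ∈ B → y ∉ B →
      ‖(w x - w y) * (ψ x - ψ y) * k x y‖ₑ ≤ F1 x * H1 y + F2 x * H2 y := by
    intro x y _ hy
    have h := far_abs_pointwise hL0.le (hw0 x) (hw0 y) (hψ0 x) (hk0 x y) (hk2 x y)
      (profile_eq_zero_or_kernel_le hs hρ hR hψ.eq_zero x hy)
    rw [profile_eq_zero_of_notMem hR hψ.eq_zero hy, sub_zero, Real.enorm_eq_ofReal_abs]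
    refine (ENNReal.ofReal_le_ofReal h).trans ?_
    have h1 := hψ0 x
    have h2 := hw0 x
    have h3 := hw0 y
    rw [ENNReal.ofReal_add (by positivity) (by positivity), ENNReal.ofReal_mul (by positivity),
      ENNReal.ofReal_mul (p := L * ψ x) (by positivity)]
  have hnear : ∀ x y, ‖(w x - w y) * (ψ x - ψ y) * k x y‖ₑ
      ≤ ENNReal.ofReal L * (ENNReal.ofReal ((w x - w y) ^ 2 / ‖x - y‖ ^ d)
        + ENNReal.ofReal ((ψ x - ψ y) ^ 2 / ‖x - y‖ ^ d)) := by
    intro x y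
    rw [← ENNReal.ofReal_add (by positivity) (by positivity), ← ENNReal.ofReal_mul hL0.le,
      Real.enorm_eq_ofReal_abs]
    refine ENNReal.ofReal_le_ofReal ?_
    rw [abs_mul, abs_of_nonneg (hk0 x y), abs_mul]
    have h2 : |w x - w y| * |ψ x - ψ y| ≤ (w x - w y) ^ 2 + (ψ x - ψ y) ^ 2 := by
      have h3 := sq_nonneg (|w x - w y| - |ψ x - ψ y|)
      have h4 := sq_abs (w x - w y)
      have h5 := sq_abs (ψ x - ψ y)
      nlinarith [abs_nonneg (w x - w y), abs_nonneg (ψ x - ψ y), sq_nonneg (w x - w y),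
        sq_nonneg (ψ x - ψ y)]
    calc _ ≤ ((w x - w y) ^ 2 + (ψ x - ψ y) ^ 2) * (L * (1 / ‖x - y‖ ^ d)) :=
          mul_le_mul h2 (hk2 x y) (hk0 x y) (by positivity)
      _ = _ := by ring
  have hpt : ∀ p : RN N × RN N, ‖(w p.1 - w p.2) * (ψ p.1 - ψ p.2) * k p.1 p.2‖ₑ
      ≤ (B ×ˢ B).indicator (fun p => ENNReal.ofReal L *
          (ENNReal.ofReal ((w p.1 - w p.2) ^ 2 / ‖p.1 - p.2‖ ^ d)
        + ENNReal.ofReal ((ψ p.1 - ψ p.2) ^ 2 / ‖p.1 - p.2‖ ^ d))) p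
        + (((B ×ˢ Bᶜ).indicator (fun p => F1 p.1 * H1 p.2) p
          + (B ×ˢ Bᶜ).indicator (fun p => F2 p.1 * H2 p.2) p)
        + ((Bᶜ ×ˢ B).indicator (fun p => H1 p.1 * F1 p.2) p
          + (Bᶜ ×ˢ B).indicator (fun p => H2 p.1 * F2 p.2) p)) := by
    rintro ⟨x, y⟩
    by_cases hx : x ∈ B <;> by_cases hy : y ∈ B
    · refine le_add_right ?_
      rw [indicator_of_mem (by exact ⟨hx, hy⟩)]
      exact hnear x y
    · refine le_add_left (le_add_right ?_)
      rw [indicator_of_mem (by exact ⟨hx, hy⟩), indicator_of_mem (by exact ⟨hx, hy⟩)]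
      exact hfar x y hx hy
    · refine le_add_left (le_add_left ?_)
      rw [indicator_of_mem (by exact ⟨hx, hy⟩), indicator_of_mem (by exact ⟨hx, hy⟩)]
      have h := far_abs_pointwise (K := k x y) (k₀ := 1 / ‖y - x‖ ^ d) hL0.le (hw0 y) (hw0 x)
        (hψ0 y) (hk0 x y) (by rw [norm_sub_rev]; exact hk2 x y)
        (profile_eq_zero_or_kernel_le hs hρ hR hψ.eq_zero y hx)
      have e : (w x - w y) * (ψ x - ψ y) * k x y = (w y - w x) * ψ y * k x y := by
        rw [profile_eq_zero_of_notMem hR hψ.eq_zero hx]; ring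
      simp only [e]
      rw [Real.enorm_eq_ofReal_abs]
      refine (ENNReal.ofReal_le_ofReal h).trans ?_
      have h1 := hψ0 y
      have h2 := hw0 x
      have h3 := hw0 y
      rw [ENNReal.ofReal_add (by positivity) (by positivity), ENNReal.ofReal_mul (by positivity),
        ENNReal.ofReal_mul (p := L * ψ y) (by positivity), mul_comm, add_comm, mul_comm, add_comm]
    · simp [profile_eq_zero_of_notMem hR hψ.eq_zero hx, profile_eq_zero_of_notMem hR hψ.eq_zero hy]
  have hF1 : ∫⁻ x in B, F1 x ≤ ENNReal.ofReal L * ((∫⁻ x in B, ENNReal.ofReal (ψ x ^ 2))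
      + ∫⁻ x in B, ENNReal.ofReal (w x ^ 2)) := by
    rw [← lintegral_add_left (by fun_prop), ← lintegral_const_mul _ (by fun_prop)]
    refine lintegral_mono fun x => ?_
    rw [← ENNReal.ofReal_add (by positivity) (by positivity), ← ENNReal.ofReal_mul hL0.le]
    refine ENNReal.ofReal_le_ofReal ?_
    gcongr
    nlinarith [sq_nonneg (ψ x - w x), sq_nonneg (ψ x), sq_nonneg (w x)]
  have hF2 : ∫⁻ x in B, F2 x = ENNReal.ofReal L * ∫⁻ x in B, ENNReal.ofReal (ψ x) := by
    rw [← lintegral_const_mul _ (by fun_prop)]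
    exact lintegral_congr fun x => ENNReal.ofReal_mul hL0.le
  have hH1 : ∫⁻ y in Bᶜ, H1 y
      = ENNReal.ofReal c * ∫⁻ y in Bᶜ, ENNReal.ofReal (1 / ‖y - x₀‖ ^ d) := by
    rw [← lintegral_const_mul _ (by fun_prop)]
    exact lintegral_congr fun x => ENNReal.ofReal_mul hc0.le
  have hH2 : ∫⁻ y in Bᶜ, H2 y
      = ENNReal.ofReal c * ∫⁻ y in Bᶜ, ENNReal.ofReal (w y / ‖y - x₀‖ ^ d) := by
    rw [← lintegral_const_mul _ (by fun_prop)]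
    refine lintegral_congr fun y => ?_
    rw [← ENNReal.ofReal_mul hc0.le]
    show ENNReal.ofReal _ = _
    congr 1; ring
  have mi : ∀ {A C : Set (RN N)} {F H : RN N → ℝ≥0∞}, MeasurableSet A → MeasurableSet C →
      Measurable F → Measurable H →
      Measurable ((A ×ˢ C).indicator fun p : RN N × RN N => F p.1 * H p.2) :=
    fun hA hC hF hH => Measurable.indicator (by fun_prop) (hA.prod hC)
  calc _ ≤ _ := lintegral_mono hpt
    _ = ENNReal.ofReal L * (gagliardoProd s B w + gagliardoProd s B ψ)
        + (((∫⁻ x in B, F1 x) * (∫⁻ y in Bᶜ, H1 y) + (∫⁻ x in B, F2 x) * (∫⁻ y in Bᶜ, H2 y))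
          + ((∫⁻ y in Bᶜ, H1 y) * (∫⁻ x in B, F1 x)
            + (∫⁻ y in Bᶜ, H2 y) * (∫⁻ x in B, F2 x))) := by
        have m1 := mi hBm hBm.compl mF1 mH1
        have m2 := mi hBm hBm.compl mF2 mH2
        have m3 := mi hBm.compl hBm mH1 mF1
        have m4 := mi hBm.compl hBm mH2 mF2
        rw [lintegral_add_right _ (by fun_prop), lintegral_add_left (by fun_prop),
          lintegral_add_left (mi hBm hBm.compl mF1 mH1),
          lintegral_add_left (mi hBm.compl hBm mH1 mF1), Measure.volume_eq_prod,
          lintegral_indicator_prod_mul hBm hBm.compl mF1 mH1,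
          lintegral_indicator_prod_mul hBm hBm.compl mF2 mH2,
          lintegral_indicator_prod_mul hBm.compl hBm mH1 mF1,
          lintegral_indicator_prod_mul hBm.compl hBm mH2 mF2,
          lintegral_indicator (hBm.prod hBm), lintegral_const_mul _ (by fun_prop),
          lintegral_add_left (by fun_prop)]
        rfl
    _ = ENNReal.ofReal L * (gagliardoProd s B w + gagliardoProd s B ψ)
        + 2 * ((∫⁻ x in B, F1 x) * (∫⁻ y in Bᶜ, H1 y) + (∫⁻ x in B, F2 x) * (∫⁻ y in Bᶜ, H2 y)) := by
        ring
    _ ≤ _ := by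
        rw [hH1, hH2, hF2]
        gcongr

theorem form_integrable {N : ℕ} {s L ρ' R : ℝ} (hs : 0 < s) (hL : 1 ≤ L) (hρ : 0 ≤ ρ')
    (hR : ρ' < R) {x₀ : RN N} {ψ : RN N → ℝ} (hψ : IsSpatialProfile s ρ' R x₀ ψ)
    {v : RN N → ℝ → ℝ} (hv : Measurable fun z : RN N × ℝ => v z.1 z.2) (hv0 : ∀ x t, 0 ≤ v x t)
    {K : RN N → RN N → ℝ → ℝ}
    (hK : Measurable fun z : ℝ × RN N × RN N => K z.2.1 z.2.2 z.1)
    (hK1 : ∀ x y t, L⁻¹ * (1 / ‖x - y‖ ^ ((N : ℝ) + 2 * s)) ≤ K x y t)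
    (hK2 : ∀ x y t, K x y t ≤ L * (1 / ‖x - y‖ ^ ((N : ℝ) + 2 * s)))
    {I : Set ℝ} (hI : volume I < ∞)
    (hsob : ∫⁻ t in I, ((∫⁻ x in Metric.ball x₀ R, ENNReal.ofReal (v x t ^ 2))
      + gagliardoProd s (Metric.ball x₀ R) fun x => v x t) < ∞)
    (htail : ∫⁻ t in I, farTail s (Metric.ball x₀ R) x₀ v t < ∞) :
    Integrable (fun z : ℝ × RN N × RN N =>
      (v z.2.1 z.1 - v z.2.2 z.1) * (ψ z.2.1 - ψ z.2.2) * K z.2.1 z.2.2 z.1)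
      ((volume.restrict I).prod volume) := by
  have hψm := hψ.measurable
  have hv1 : Measurable fun z : ℝ × RN N × RN N => v z.2.1 z.1 :=
    hv.comp (f := fun z : ℝ × RN N × RN N => (z.2.1, z.1)) (by fun_prop)
  have hv2 : Measurable fun z : ℝ × RN N × RN N => v z.2.2 z.1 :=
    hv.comp (f := fun z : ℝ × RN N × RN N => (z.2.2, z.1)) (by fun_prop)
  have hm : Measurable fun z : ℝ × RN N × RN N =>
      (v z.2.1 z.1 - v z.2.2 z.1) * (ψ z.2.1 - ψ z.2.2) * K z.2.1 z.2.2 z.1 :=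
    ((hv1.sub hv2).mul (by fun_prop)).mul hK
  refine ⟨hm.aestronglyMeasurable, ?_⟩
  rw [hasFiniteIntegral_iff_enorm, lintegral_prod _ hm.enorm.aemeasurable]
  refine lt_of_le_of_lt (lintegral_mono fun t => form_enorm_le hs hL hρ hR hψ (w := fun x => v x t)
    (hv.comp (f := fun x : RN N => (x, t)) (by fun_prop)) (fun x => hv0 x t)
    (k := fun x y => K x y t) (fun x y => hK1 x y t) (fun x y => hK2 x y t)) ?_
  have mt : Measurable (farTail s (Metric.ball x₀ R) x₀ v) := by
    have : Measurable fun z : ℝ × RN N =>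
        ENNReal.ofReal (v z.2 z.1 / ‖z.2 - x₀‖ ^ ((N : ℝ) + 2 * s)) := by
      have h1 : Measurable fun z : ℝ × RN N => v z.2 z.1 :=
        hv.comp (f := fun z : ℝ × RN N => (z.2, z.1)) (by fun_prop)
      exact (h1.div (by fun_prop)).ennreal_ofReal
    exact this.lintegral_prod_right'
  set B := Metric.ball x₀ R
  set κ := ∫⁻ y in Bᶜ, ENNReal.ofReal (1 / ‖y - x₀‖ ^ ((N : ℝ) + 2 * s)) with hκ
  have hκ' : κ < ∞ := lintegral_compl_ball_kernel_lt_top hs x₀ (by linarith)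
  set c := ENNReal.ofReal ((R / (R - ρ')) ^ ((N : ℝ) + 2 * s))
  set l := ENNReal.ofReal L
  have hψ2 := hψ.sq
  have hψg := hψ.gagliardo
  have hψ1 := hψ.lintegral_lt_top
  set a₂ := ∫⁻ x in B, ENNReal.ofReal (ψ x ^ 2)
  set a₁ := ∫⁻ x in B, ENNReal.ofReal (ψ x)
  set g := gagliardoProd s B ψ
  -- The bound is affine in the Sobolev energy and in the tail, the two quantities integrable in
  -- time, with coefficients independent of `t`.
  have hle : ∀ t, l * ((gagliardoProd s B fun x => v x t) + g)
      + 2 * (l * (a₂ + ∫⁻ x in B, ENNReal.ofReal (v x t ^ 2)) * (c * κ)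
        + l * a₁ * (c * farTail s B x₀ v t))
      ≤ (l * g + 2 * l * a₂ * c * κ) + (l + 2 * l * c * κ) *
          ((∫⁻ x in B, ENNReal.ofReal (v x t ^ 2)) + gagliardoProd s B fun x => v x t)
        + 2 * l * a₁ * c * farTail s B x₀ v t := by
    intro t
    set X := ∫⁻ x in B, ENNReal.ofReal (v x t ^ 2)
    set Y := gagliardoProd s B fun x => v x t
    calc _ = l * Y + l * g + 2 * l * a₂ * c * κ + 2 * l * c * κ * X
          + 2 * l * a₁ * c * farTail s B x₀ v t := by ring
      _ ≤ l * Y + l * g + 2 * l * a₂ * c * κ + 2 * l * c * κ * X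
          + 2 * l * a₁ * c * farTail s B x₀ v t + (l * X + 2 * l * c * κ * Y) := le_self_add
      _ = _ := by ring
  refine (lintegral_mono hle).trans_lt ?_
  have hl : l < ∞ := ENNReal.ofReal_lt_top
  have hc : c < ∞ := ENNReal.ofReal_lt_top
  have f1 : l * g + 2 * l * a₂ * c * κ ≠ ∞ := by finiteness
  have f2 : l + 2 * l * c * κ ≠ ∞ := by finiteness
  have f3 : 2 * l * a₁ * c ≠ ∞ := by finiteness
  rw [lintegral_add_right _ (mt.const_mul _), lintegral_add_left measurable_const,
    lintegral_const_mul' _ _ f2, lintegral_const_mul' _ _ f3, setLIntegral_const]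
  exact ENNReal.add_lt_top.2 ⟨ENNReal.add_lt_top.2 ⟨ENNReal.mul_lt_top f1.lt_top hI,
    ENNReal.mul_lt_top f2.lt_top hsob⟩, ENNReal.mul_lt_top f3.lt_top htail⟩

/-! ### The truncated test function as a spatial profile -/

/-- Standing assumptions for the discrete energy estimate: a nonnegative measurable function `v` on
`B_R(x₀) × [a,b]` with locally finite Sobolev energy, a spatial cutoff `ζ` and an increasing
level `κ` whose growth dominates the tail of `v`. -/
structure LevelSetup {N : ℕ} (s q L r ρ' R A a b : ℝ) (x₀ : RN N) (κ : ℝ → ℝ) (ζ : RN N → ℝ)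
    (v : RN N → ℝ → ℝ) : Prop where
  two_le : 2 ≤ N
  s_pos : 0 < s
  s_lt : s < 1
  one_lt : 1 < q
  one_le : 1 ≤ L
  inner_nonneg : 0 ≤ ρ'
  r_le : r ≤ R
  inner_lt : ρ' < R
  level_meas : Measurable κ
  level_pos : ∀ t, 0 < κ t
  level_mono : Monotone κ
  cut_meas : Measurable ζ
  cut_nonneg : ∀ x, 0 ≤ ζ x
  cut_le_one : ∀ x, ζ x ≤ 1
  cut_one : ∀ x ∈ Metric.ball x₀ r, ζ x = 1
  cut_zero : ∀ x, ρ' < ‖x - x₀‖ → ζ x = 0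
  cut_lip : ∀ x y, |ζ x - ζ y| ≤ A * ‖x - y‖
  meas : Measurable fun z : RN N × ℝ => v z.1 z.2
  nonneg : ∀ x t, 0 ≤ v x t
  sobolev : ∫⁻ t in Icc a b, ((∫⁻ x in Metric.ball x₀ R, ENNReal.ofReal (v x t ^ 2))
    + gagliardoProd s (Metric.ball x₀ R) fun x => v x t) < ∞
  tail : ∀ t₁ t₂, a ≤ t₁ → t₁ ≤ t₂ → t₂ ≤ b →
    ENNReal.ofReal (2 * L * (R / (R - ρ')) ^ ((N : ℝ) + 2 * s)) *
      (∫⁻ t in Ioc t₁ t₂, farTail s (Metric.ball x₀ R) x₀ v t)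
        ≤ ENNReal.ofReal (κ t₂ ^ q - κ t₁ ^ q)

namespace LevelSetup

variable {N : ℕ} {s q L r ρ' R A a b : ℝ} {x₀ : RN N} {κ : ℝ → ℝ} {ζ : RN N → ℝ}
  {v : RN N → ℝ → ℝ}

theorem measurable_slice (h : LevelSetup s q L r ρ' R A a b x₀ κ ζ v) (t : ℝ) :
    Measurable fun x => v x t :=
  h.meas.comp (f := fun x : RN N => (x, t)) (by fun_prop)

theorem trunc_le (h : LevelSetup s q L r ρ' R A a b x₀ κ ζ v) (x : RN N) (t : ℝ) :
    max (v x t - κ t) 0 ≤ v x t :=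
  max_le (by linarith [h.level_pos t]) (h.nonneg x t)

theorem measurable_truncTest (h : LevelSetup s q L r ρ' R A a b x₀ κ ζ v) {η : ℝ → ℝ} (t : ℝ) :
    Measurable (truncTest η κ ζ v t) := by
  have := h.measurable_slice t
  have := h.cut_meas
  unfold truncTest
  fun_prop

theorem truncTest_nonneg (h : LevelSetup s q L r ρ' R A a b x₀ κ ζ v) {η : ℝ → ℝ}
    (hη : ∀ t, 0 ≤ η t) (t : ℝ) (x : RN N) : 0 ≤ truncTest η κ ζ v t x := by
  have := hη t
  have := h.cut_nonneg x
  unfold truncTest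
  positivity

theorem truncTest_le (h : LevelSetup s q L r ρ' R A a b x₀ κ ζ v) {η : ℝ → ℝ}
    (hη : ∀ t, 0 ≤ η t) (hη1 : ∀ t, η t ≤ 1) (t : ℝ) (x : RN N) :
    truncTest η κ ζ v t x ≤ v x t := by
  have h0 := hη t
  have h1 := h.cut_nonneg x
  have h2 : 0 ≤ max (v x t - κ t) 0 := le_max_right _ _
  have h3 : ζ x ^ 2 ≤ 1 := pow_le_one₀ h1 (h.cut_le_one x)
  unfold truncTest
  calc η t * (max (v x t - κ t) 0 * ζ x ^ 2) ≤ 1 * (max (v x t - κ t) 0 * 1) := by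
        gcongr
        exact hη1 t
    _ ≤ v x t := by simpa using h.trunc_le x t

/-- Discrete product rule: the truncation is 1-Lipschitz in `v` and bounded by `v`, while `ζ²` has
Lipschitz constant `2A`. The coefficient is `8A² = 2 (2A)²`. -/
theorem truncTest_sub_sq_le (h : LevelSetup s q L r ρ' R A a b x₀ κ ζ v) {η : ℝ → ℝ}
    (hη : ∀ t, 0 ≤ η t) (hη1 : ∀ t, η t ≤ 1) (t : ℝ) (x y : RN N) :
    (truncTest η κ ζ v t x - truncTest η κ ζ v t y) ^ 2
      ≤ 2 * (v x t - v y t) ^ 2 + 8 * A ^ 2 * (v x t ^ 2 * ‖x - y‖ ^ 2) := by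
  set w := max (v x t - κ t) 0 with hw
  set w' := max (v y t - κ t) 0 with hw'
  have h0 := hη t
  have h1 := hη1 t
  have hzx := h.cut_nonneg x
  have hzy := h.cut_nonneg y
  have hzx1 := h.cut_le_one x
  have hzy1 := h.cut_le_one y
  have hww : (w - w') ^ 2 ≤ (v x t - v y t) ^ 2 := by
    rw [sq_le_sq]
    calc |w - w'| ≤ |v x t - κ t - (v y t - κ t)| := abs_max_sub_max_le_abs _ _ _
      _ = |v x t - v y t| := by congr 1; ring
  have hw2 : w ^ 2 ≤ v x t ^ 2 := by
    have h2 : 0 ≤ w := le_max_right _ _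
    gcongr
    exact h.trunc_le x t
  have hzz : (ζ x ^ 2 - ζ y ^ 2) ^ 2 ≤ 4 * A ^ 2 * ‖x - y‖ ^ 2 := by
    have e : ζ x ^ 2 - ζ y ^ 2 = (ζ x - ζ y) * (ζ x + ζ y) := by ring
    rw [e, mul_pow]
    have h3 : (ζ x - ζ y) ^ 2 ≤ (A * ‖x - y‖) ^ 2 := by
      rw [← sq_abs]; gcongr; exact h.cut_lip x y
    have h4 : (ζ x + ζ y) ^ 2 ≤ 2 ^ 2 := by gcongr; linarith
    calc _ ≤ (A * ‖x - y‖) ^ 2 * 2 ^ 2 := by gcongr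
      _ = _ := by ring
  have hz4 : (ζ y ^ 2) ^ 2 ≤ 1 := pow_le_one₀ (by positivity) (pow_le_one₀ hzy hzy1)
  have hη2 : η t ^ 2 ≤ 1 := pow_le_one₀ h0 h1
  have e : truncTest η κ ζ v t x - truncTest η κ ζ v t y
      = η t * (w * (ζ x ^ 2 - ζ y ^ 2) + (w - w') * ζ y ^ 2) := by
    simp only [truncTest, hw, hw']; ring
  rw [e, mul_pow]
  calc η t ^ 2 * (w * (ζ x ^ 2 - ζ y ^ 2) + (w - w') * ζ y ^ 2) ^ 2
      ≤ 1 * (2 * (w ^ 2 * (ζ x ^ 2 - ζ y ^ 2) ^ 2) + 2 * ((w - w') ^ 2 * (ζ y ^ 2) ^ 2)) := by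
        gcongr
        nlinarith [sq_nonneg (w * (ζ x ^ 2 - ζ y ^ 2) - (w - w') * ζ y ^ 2)]
    _ ≤ 1 * (2 * (v x t ^ 2 * (4 * A ^ 2 * ‖x - y‖ ^ 2)) + 2 * ((v x t - v y t) ^ 2 * 1)) := by
        gcongr
    _ = _ := by ring

/-- The constant does not depend on `t`, so the profiles inherit square integrability in time from
`v`. This makes the `L²` translation argument available for them. -/
theorem exists_gagliardoProd_truncTest_le (h : LevelSetup s q L r ρ' R A a b x₀ κ ζ v) {η : ℝ → ℝ}
    (hη : ∀ t, 0 ≤ η t) (hη1 : ∀ t, η t ≤ 1) :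
    ∃ C : ℝ≥0∞, C ≠ ∞ ∧ ∀ t, gagliardoProd s (Metric.ball x₀ R) (truncTest η κ ζ v t)
      ≤ C * ((∫⁻ x in Metric.ball x₀ R, ENNReal.ofReal (v x t ^ 2))
        + gagliardoProd s (Metric.ball x₀ R) fun x => v x t) := by
  obtain ⟨C, hC, hker⟩ := exists_lintegral_ball_kernel_le h.two_le h.s_lt
  refine ⟨2 + ENNReal.ofReal (8 * A ^ 2) * ENNReal.ofReal (C * R ^ (2 * (1 - s))), by finiteness,
    fun t => ?_⟩
  have hv := h.measurable_slice t
  set d : ℝ := (N : ℝ) + 2 * s with hd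
  set B := Metric.ball x₀ R with hB
  have hm : Measurable fun p : RN N × RN N =>
      ENNReal.ofReal (8 * A ^ 2) * (ENNReal.ofReal (v p.1 t ^ 2)
        * ENNReal.ofReal (‖p.1 - p.2‖ ^ 2 / ‖p.1 - p.2‖ ^ d)) := by fun_prop
  have h1 : gagliardoProd s B (truncTest η κ ζ v t) ≤ ∫⁻ p in B ×ˢ B,
      (2 * ENNReal.ofReal ((v p.1 t - v p.2 t) ^ 2 / ‖p.1 - p.2‖ ^ d)
        + ENNReal.ofReal (8 * A ^ 2) * (ENNReal.ofReal (v p.1 t ^ 2)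
          * ENNReal.ofReal (‖p.1 - p.2‖ ^ 2 / ‖p.1 - p.2‖ ^ d))) := by
    refine lintegral_mono fun p => ?_
    have e2 : ∀ X, (2 : ℝ≥0∞) * ENNReal.ofReal X = ENNReal.ofReal (2 * X) := fun X => by
      rw [ENNReal.ofReal_mul (by norm_num), ENNReal.ofReal_ofNat]
    rw [← ENNReal.ofReal_mul (by positivity), ← ENNReal.ofReal_mul (by positivity), e2,
      ← ENNReal.ofReal_add (by positivity) (by positivity)]
    refine ENNReal.ofReal_le_ofReal ?_
    have := h.truncTest_sub_sq_le hη hη1 t p.1 p.2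
    calc _ ≤ (2 * (v p.1 t - v p.2 t) ^ 2 + 8 * A ^ 2 * (v p.1 t ^ 2 * ‖p.1 - p.2‖ ^ 2))
          / ‖p.1 - p.2‖ ^ d := by gcongr
      _ = _ := by ring
  have h2 : ∫⁻ p in B ×ˢ B, ENNReal.ofReal (8 * A ^ 2) * (ENNReal.ofReal (v p.1 t ^ 2)
          * ENNReal.ofReal (‖p.1 - p.2‖ ^ 2 / ‖p.1 - p.2‖ ^ d))
      ≤ ENNReal.ofReal (8 * A ^ 2) * ENNReal.ofReal (C * R ^ (2 * (1 - s)))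
        * ∫⁻ x in B, ENNReal.ofReal (v x t ^ 2) := by
    rw [lintegral_const_mul _ (by fun_prop), mul_assoc, Measure.volume_eq_prod,
      ← Measure.prod_restrict, lintegral_prod _ (by fun_prop)]
    gcongr
    rw [mul_comm, ← lintegral_mul_const _ (by fun_prop)]
    refine setLIntegral_mono' measurableSet_ball fun x hx => ?_
    dsimp only
    rw [lintegral_const_mul _ (by fun_prop)]
    gcongr
    exact hker x₀ x R hx
  rw [lintegral_add_right _ hm, lintegral_const_mul _ (by fun_prop)] at h1
  refine h1.trans ((add_le_add le_rfl h2).trans ?_)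
  change 2 * gagliardoProd s B (fun x => v x t) + _ ≤ _
  set X := ∫⁻ x in B, ENNReal.ofReal (v x t ^ 2)
  set Y := gagliardoProd s B fun x => v x t
  set c₁ := ENNReal.ofReal (8 * A ^ 2)
  set c₂ := ENNReal.ofReal (C * R ^ (2 * (1 - s)))
  calc 2 * Y + c₁ * c₂ * X ≤ 2 * Y + c₁ * c₂ * X + (2 * X + c₁ * c₂ * Y) := le_self_add
    _ = _ := by ring

theorem isSpatialProfile_truncTest (h : LevelSetup s q L r ρ' R A a b x₀ κ ζ v) {η : ℝ → ℝ}
    (hη : ∀ t, 0 ≤ η t) (hη1 : ∀ t, η t ≤ 1) {t : ℝ}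
    (ht : (∫⁻ x in Metric.ball x₀ R, ENNReal.ofReal (v x t ^ 2))
        + gagliardoProd s (Metric.ball x₀ R) (fun x => v x t) < ∞) :
    IsSpatialProfile s ρ' R x₀ (truncTest η κ ζ v t) where
  measurable := h.measurable_truncTest t
  nonneg := h.truncTest_nonneg hη t
  eq_zero x hx := by simp [truncTest, h.cut_zero x hx]
  sq := by
    refine lt_of_le_of_lt (lintegral_mono fun x => ENNReal.ofReal_le_ofReal ?_)
      (le_self_add.trans_lt ht)
    have := h.truncTest_nonneg hη t x
    gcongr
    exact h.truncTest_le hη hη1 t x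
  gagliardo := by
    obtain ⟨C, hC, H⟩ := h.exists_gagliardoProd_truncTest_le hη hη1
    exact (H t).trans_lt (ENNReal.mul_lt_top hC.lt_top ht)

theorem measurable_farTail (h : LevelSetup s q L r ρ' R A a b x₀ κ ζ v) :
    Measurable (farTail s (Metric.ball x₀ R) x₀ v) := by
  have : Measurable fun z : ℝ × RN N =>
      ENNReal.ofReal (v z.2 z.1 / ‖z.2 - x₀‖ ^ ((N : ℝ) + 2 * s)) := by
    have h1 : Measurable fun z : ℝ × RN N => v z.2 z.1 :=
      h.meas.comp (f := fun z : ℝ × RN N => (z.2, z.1)) (by fun_prop)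
    exact (h1.div (by fun_prop)).ennreal_ofReal
  exact this.lintegral_prod_right'

/-- Finiteness is already contained in `tail`: the increment of `κ^q` is a real number and the
factor in front of the tail is positive. -/
theorem lintegral_farTail_lt_top (h : LevelSetup s q L r ρ' R A a b x₀ κ ζ v) {t₁ t₂ : ℝ}
    (h₁ : a ≤ t₁) (h₁₂ : t₁ ≤ t₂) (h₂ : t₂ ≤ b) :
    ∫⁻ t in Ioc t₁ t₂, farTail s (Metric.ball x₀ R) x₀ v t < ∞ := by
  have hc : 0 < 2 * L * (R / (R - ρ')) ^ ((N : ℝ) + 2 * s) := by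
    have h1 := h.one_le
    have h2 := h.inner_lt
    have h3 := h.inner_nonneg
    have : 0 < R / (R - ρ') := div_pos (by linarith) (by linarith)
    positivity
  by_contra hcon
  have h3 := h.tail t₁ t₂ h₁ h₁₂ h₂
  rw [not_lt_top_iff.1 hcon, ENNReal.mul_top (by simpa using hc)] at h3
  exact absurd h3 (by simp)

end LevelSetup

/-! ### The weak inequality on a single time step -/

theorem measurable_gPlus {α : Type*} [MeasurableSpace α] {q : ℝ} (hq : 1 < q) {f g : α → ℝ}
    (hf : Measurable f) (hg : Measurable g) (hg0 : ∀ x, 0 < g x) :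
    Measurable fun x => gPlus q (f x) (g x) := by
  have : (fun x => gPlus q (f x) (g x)) = fun x => q / (q + 1) * max (f x) (g x) ^ (q + 1)
      - g x * max (f x) (g x) ^ q + g x ^ (q + 1) / (q + 1) :=
    funext fun x => gPlus_eq hq (f x) (hg0 x)
  rw [this]
  fun_prop

namespace LevelSetup

variable {N : ℕ} {s q L r ρ' R A a b : ℝ} {x₀ : RN N} {κ : ℝ → ℝ} {ζ : RN N → ℝ}
  {v : RN N → ℝ → ℝ}

theorem energy_part_integrable (h : LevelSetup s q L r ρ' R A a b x₀ κ ζ v) {η : ℝ → ℝ}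
    (hη : ∀ t, 0 ≤ η t) (hη1 : ∀ t, η t ≤ 1) {t₁ τ : ℝ}
    (hp₁ : ∫⁻ x in Metric.ball x₀ R, ENNReal.ofReal (v x t₁ ^ (q + 1)) < ∞)
    (hp₂ : ∫⁻ x in Metric.ball x₀ R, ENNReal.ofReal (v x τ ^ (q + 1)) < ∞) :
    Integrable (fun x => (v x τ ^ q - v x t₁ ^ q) * truncTest η κ ζ v τ x)
      (volume.restrict (Metric.ball x₀ R)) := by
  have hm1 := h.measurable_slice t₁
  have hm2 := h.measurable_slice τ
  have hψ := h.measurable_truncTest (η := η) τ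
  refine ⟨Measurable.aestronglyMeasurable (by fun_prop), ?_⟩
  rw [hasFiniteIntegral_iff_enorm]
  refine lt_of_le_of_lt (lintegral_mono (g := fun x => ENNReal.ofReal (v x t₁ ^ (q + 1))
    + ENNReal.ofReal (2 * v x τ ^ (q + 1))) fun x => ?_) ?_
  · have hq : 0 < q := by linarith [h.one_lt]
    have ha := h.nonneg x t₁
    have hb := h.nonneg x τ
    dsimp only
    rw [← ENNReal.ofReal_add (by positivity) (by positivity), Real.enorm_eq_ofReal_abs]
    refine ENNReal.ofReal_le_ofReal ?_
    have hy := rpow_mul_le_young hq ha hb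
    have hψ0 := h.truncTest_nonneg hη τ x
    have hψ1 := h.truncTest_le hη hη1 τ x
    have e : v x τ ^ q * v x τ = v x τ ^ (q + 1) := by
      rcases hb.eq_or_lt with h0 | h0
      · rw [← h0, mul_zero, Real.zero_rpow (by linarith)]
      · exact (Real.rpow_add_one h0.ne' q).symm
    have h3 : q / (q + 1) * v x t₁ ^ (q + 1) ≤ 1 * v x t₁ ^ (q + 1) := by
      gcongr; rw [div_le_one (by linarith)]; linarith
    have h4 : v x τ ^ (q + 1) / (q + 1) ≤ v x τ ^ (q + 1) :=
      div_le_self (by positivity) (by linarith)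
    have h5 : |v x τ ^ q - v x t₁ ^ q| ≤ v x τ ^ q + v x t₁ ^ q := by
      have h6 : 0 ≤ v x τ ^ q := by positivity
      have h7 : 0 ≤ v x t₁ ^ q := by positivity
      rw [abs_le]; constructor <;> linarith
    rw [abs_mul, abs_of_nonneg hψ0]
    calc _ ≤ (v x τ ^ q + v x t₁ ^ q) * v x τ := by gcongr
      _ ≤ _ := by rw [add_mul, e]; linarith
  · rw [lintegral_add_left (by fun_prop)]
    simp_rw [ENNReal.ofReal_mul (zero_le_two : (0 : ℝ) ≤ 2)]
    rw [lintegral_const_mul _ (by fun_prop)]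
    exact ENNReal.add_lt_top.2 ⟨hp₁, ENNReal.mul_lt_top ENNReal.ofReal_lt_top hp₂⟩

/-- One inequality on the whole of `ℝ^N × ℝ^N`, checked on the four regions cut out by `B_R`. The
profile is frozen at `τ`, but the good terms carry the weight `η(t)` of the current time; the
mismatch is the third error term on `B_R × B_R`. -/
theorem form_pointwise (h : LevelSetup s q L r ρ' R A a b x₀ κ ζ v) {η : ℝ → ℝ}
    (hη : ∀ t, 0 ≤ η t) (hη1 : ∀ t, η t ≤ 1) {K : RN N → RN N → ℝ → ℝ}
    (hK1 : ∀ x y t, L⁻¹ * (1 / ‖x - y‖ ^ ((N : ℝ) + 2 * s)) ≤ K x y t)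
    (hK2 : ∀ x y t, K x y t ≤ L * (1 / ‖x - y‖ ^ ((N : ℝ) + 2 * s))) {ε : ℝ} (hε : 0 < ε)
    (t τ : ℝ) (p : RN N × RN N) :
    (Metric.ball x₀ r ×ˢ Metric.ball x₀ r).indicator (fun p => ENNReal.ofReal L⁻¹ *
        (ENNReal.ofReal (η t) * ENNReal.ofReal
          (goodIntegrand (v p.1 t) (v p.2 t) (κ t) / ‖p.1 - p.2‖ ^ ((N : ℝ) + 2 * s)))) p
      + ENNReal.ofReal (-((v p.1 t - v p.2 t) *
          (truncTest η κ ζ v τ p.1 - truncTest η κ ζ v τ p.2) * K p.1 p.2 t))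
    ≤ ((Metric.ball x₀ R ×ˢ Metric.ball x₀ R).indicator (fun p =>
          ENNReal.ofReal L * ENNReal.ofReal (max (v p.1 t - κ t) 0 * max (v p.2 t - κ t) 0
            * (ζ p.1 - ζ p.2) ^ 2 / ‖p.1 - p.2‖ ^ ((N : ℝ) + 2 * s))
          + ENNReal.ofReal (ε * L) *
            ENNReal.ofReal ((v p.1 t - v p.2 t) ^ 2 / ‖p.1 - p.2‖ ^ ((N : ℝ) + 2 * s))
          + ENNReal.ofReal (L / (4 * ε)) * ENNReal.ofReal
            (((truncTest η κ ζ v τ p.1 - truncTest η κ ζ v t p.1)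
              - (truncTest η κ ζ v τ p.2 - truncTest η κ ζ v t p.2)) ^ 2
                / ‖p.1 - p.2‖ ^ ((N : ℝ) + 2 * s))) p
        + ((Metric.ball x₀ R ×ˢ (Metric.ball x₀ R)ᶜ).indicator (fun p =>
            ENNReal.ofReal (L * truncTest η κ ζ v τ p.1) * ENNReal.ofReal (v p.2 t *
              ((R / (R - ρ')) ^ ((N : ℝ) + 2 * s) * (1 / ‖p.2 - x₀‖ ^ ((N : ℝ) + 2 * s))))) p
          + ((Metric.ball x₀ R)ᶜ ×ˢ Metric.ball x₀ R).indicator (fun p =>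
              ENNReal.ofReal (v p.1 t *
              ((R / (R - ρ')) ^ ((N : ℝ) + 2 * s) * (1 / ‖p.1 - x₀‖ ^ ((N : ℝ) + 2 * s)))) *
              ENNReal.ofReal (L * truncTest η κ ζ v τ p.2)) p))
      + ENNReal.ofReal ((v p.1 t - v p.2 t) *
          (truncTest η κ ζ v τ p.1 - truncTest η κ ζ v τ p.2) * K p.1 p.2 t) := by
  classical
  have hL0 : 0 < L := by linarith [h.one_le]
  have hρ := h.inner_nonneg
  have hR := h.inner_lt
  have hRR : 0 < R / (R - ρ') := div_pos (by linarith) (by linarith)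
  have hK0 : ∀ x y t, 0 ≤ K x y t := fun x y t => le_trans (by positivity) (hK1 x y t)
  obtain ⟨x, y⟩ := p
  set d : ℝ := (N : ℝ) + 2 * s with hd
  set ψ := truncTest η κ ζ v τ with hψ
  have hψ0 : ∀ x, 0 ≤ ψ x := h.truncTest_nonneg hη τ
  have hψz : ∀ x, ρ' < ‖x - x₀‖ → ψ x = 0 := fun x hx => by
    simp [hψ, truncTest, h.cut_zero x hx]
  have hr : Metric.ball x₀ r ⊆ Metric.ball x₀ R := Metric.ball_subset_ball h.r_le
  by_cases hx : x ∈ Metric.ball x₀ R <;> by_cases hy : y ∈ Metric.ball x₀ R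
  · set χ : ℝ := if (x, y) ∈ Metric.ball x₀ r ×ˢ Metric.ball x₀ r then 1 else 0 with hχ
    have hχ' : χ = 0 ∨ (χ = 1 ∧ ζ x = 1 ∧ ζ y = 1) := by
      by_cases hp : (x, y) ∈ Metric.ball x₀ r ×ˢ Metric.ball x₀ r
      · exact Or.inr ⟨by rw [hχ, if_pos hp], h.cut_one x hp.1, h.cut_one y hp.2⟩
      · exact Or.inl (by rw [hχ, if_neg hp])
    have hη0 := hη t
    have hbase := near_pointwise (v := v x t) (v' := v y t) (k := κ t) (P := ψ x - ψ y)
      (show 0 ≤ 1 / ‖x - y‖ ^ d by positivity) hL0 hε hη0 (hK1 x y t) (hK2 x y t) hχ'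
    have hgood := goodIntegrand_nonneg (v x t) (v y t) (κ t)
    have hχ0 : 0 ≤ χ := by rw [hχ]; split_ifs <;> norm_num
    have hb2 : χ * (L⁻¹ * (η t * (goodIntegrand (v x t) (v y t) (κ t) / ‖x - y‖ ^ d)))
        ≤ (v x t - v y t) * (ψ x - ψ y) * K x y t
          + (L * (max (v x t - κ t) 0 * max (v y t - κ t) 0 * (ζ x - ζ y) ^ 2 / ‖x - y‖ ^ d)
            + ε * L * ((v x t - v y t) ^ 2 / ‖x - y‖ ^ d)
            + L / (4 * ε) * (((ψ x - truncTest η κ ζ v t x) - (ψ y - truncTest η κ ζ v t y)) ^ 2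
              / ‖x - y‖ ^ d)) := by
      have e1 : (ψ x - truncTest η κ ζ v t x) - (ψ y - truncTest η κ ζ v t y)
        = ψ x - ψ y - η t * (max (v x t - κ t) 0 * ζ x ^ 2 - max (v y t - κ t) 0 * ζ y ^ 2) := by
        simp only [truncTest]; ring
      have e2 : η t * (max (v x t - κ t) 0 * max (v y t - κ t) 0 * (ζ x - ζ y) ^ 2
            * (1 / ‖x - y‖ ^ d))
          ≤ 1 * (max (v x t - κ t) 0 * max (v y t - κ t) 0 * (ζ x - ζ y) ^ 2
            * (1 / ‖x - y‖ ^ d)) := by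
        gcongr
        exact hη1 t
      rw [e1]
      have e3 : L * (η t * (max (v x t - κ t) 0 * max (v y t - κ t) 0 * (ζ x - ζ y) ^ 2
            * (1 / ‖x - y‖ ^ d)))
          ≤ L * (1 * (max (v x t - κ t) 0 * max (v y t - κ t) 0 * (ζ x - ζ y) ^ 2
            * (1 / ‖x - y‖ ^ d))) := by gcongr
      simp only [one_mul, mul_one_div] at hbase e3 ⊢
      linarith
    have key := ofReal_add_ofReal_neg_le (by positivity) (by positivity) hb2
    rw [indicator_of_mem (show (x, y) ∈ Metric.ball x₀ R ×ˢ Metric.ball x₀ R from ⟨hx, hy⟩),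
      indicator_of_notMem (show (x, y) ∉ Metric.ball x₀ R ×ˢ (Metric.ball x₀ R)ᶜ
        from fun hc => hc.2 hy),
      indicator_of_notMem (show (x, y) ∉ (Metric.ball x₀ R)ᶜ ×ˢ Metric.ball x₀ R
        from fun hc => hc.1 hx), add_zero, add_zero]
    rw [ENNReal.ofReal_add (by positivity) (by positivity),
      ENNReal.ofReal_add (by positivity) (by positivity), ENNReal.ofReal_mul hL0.le,
      ENNReal.ofReal_mul (p := ε * L) (by positivity),
      ENNReal.ofReal_mul (p := L / (4 * ε)) (by positivity)] at key
    refine le_trans (add_le_add (le_of_eq ?_) le_rfl) key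
    by_cases hp : (x, y) ∈ Metric.ball x₀ r ×ˢ Metric.ball x₀ r
    · rw [indicator_of_mem hp, hχ, if_pos hp, one_mul, ENNReal.ofReal_mul (by positivity),
        ENNReal.ofReal_mul hη0]
    · rw [indicator_of_notMem hp, hχ, if_neg hp, zero_mul, ENNReal.ofReal_zero]
  · rw [indicator_of_notMem (show (x, y) ∉ Metric.ball x₀ r ×ˢ Metric.ball x₀ r
        from fun hc => hy (hr hc.2)),
      indicator_of_mem (show (x, y) ∈ Metric.ball x₀ R ×ˢ (Metric.ball x₀ R)ᶜ from ⟨hx, hy⟩),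
      indicator_of_notMem (show (x, y) ∉ Metric.ball x₀ R ×ˢ Metric.ball x₀ R
        from fun hc => hy hc.2),
      indicator_of_notMem (show (x, y) ∉ (Metric.ball x₀ R)ᶜ ×ˢ Metric.ball x₀ R
        from fun hc => hy hc.2), add_zero, zero_add, zero_add]
    have hf := far_pointwise hL0.le (h.nonneg x t) (h.nonneg y t) (hψ0 x) (hK0 x y t) (hK2 x y t)
      (profile_eq_zero_or_kernel_le h.s_pos hρ hR hψz x hy)
    have h1 := hψ0 x
    have h3 := h.nonneg y t
    have key := ofReal_add_ofReal_neg_le le_rfl (by positivity) hf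
    rw [ENNReal.ofReal_zero, zero_add, ENNReal.ofReal_mul (p := L * ψ x) (by positivity)] at key
    dsimp only
    rw [profile_eq_zero_of_notMem hR hψz hy, sub_zero]
    exact key
  · rw [indicator_of_notMem (show (x, y) ∉ Metric.ball x₀ r ×ˢ Metric.ball x₀ r
        from fun hc => hx (hr hc.1)),
      indicator_of_mem (show (x, y) ∈ (Metric.ball x₀ R)ᶜ ×ˢ Metric.ball x₀ R from ⟨hx, hy⟩),
      indicator_of_notMem (show (x, y) ∉ Metric.ball x₀ R ×ˢ Metric.ball x₀ R
        from fun hc => hx hc.1),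
      indicator_of_notMem (show (x, y) ∉ Metric.ball x₀ R ×ˢ (Metric.ball x₀ R)ᶜ
        from fun hc => hx hc.1), zero_add, zero_add, zero_add]
    have hf := far_pointwise (K := K x y t) (k₀ := 1 / ‖y - x‖ ^ d) hL0.le (h.nonneg y t)
      (h.nonneg x t) (hψ0 y) (hK0 x y t) (by rw [norm_sub_rev]; exact hK2 x y t)
      (profile_eq_zero_or_kernel_le h.s_pos hρ hR hψz y hx)
    have h1 := hψ0 y
    have h3 := h.nonneg x t
    have key := ofReal_add_ofReal_neg_le le_rfl (by positivity) hf
    rw [ENNReal.ofReal_zero, zero_add, ENNReal.ofReal_mul (p := L * ψ y) (by positivity),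
      mul_comm (ENNReal.ofReal (L * ψ y))] at key
    have e : (v x t - v y t) * (ψ x - ψ y) * K x y t = (v y t - v x t) * ψ y * K x y t := by
      rw [profile_eq_zero_of_notMem hR hψz hx]; ring
    dsimp only
    rw [e]
    exact key
  · have e : (v x t - v y t) * (ψ x - ψ y) * K x y t = 0 := by
      rw [profile_eq_zero_of_notMem hR hψz hx, profile_eq_zero_of_notMem hR hψz hy]; ring
    rw [indicator_of_notMem (show (x, y) ∉ Metric.ball x₀ r ×ˢ Metric.ball x₀ r
        from fun hc => hx (hr hc.1))]
    dsimp only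
    rw [e]
    simp

end LevelSetup

theorem measurable_indicator_snd {X Y : Type*} [MeasurableSpace X] [MeasurableSpace Y] {S : Set Y}
    (hS : MeasurableSet S) {f : X → Y → ℝ≥0∞} (hf : Measurable fun z : X × Y => f z.1 z.2) :
    Measurable fun z : X × Y => S.indicator (f z.1) z.2 := by
  have : (fun z : X × Y => S.indicator (f z.1) z.2)
      = (Prod.snd ⁻¹' S).indicator fun z : X × Y => f z.1 z.2 := by
    ext z
    by_cases hz : z.2 ∈ S
    · rw [indicator_of_mem hz, indicator_of_mem (by exact hz)]
    · rw [indicator_of_notMem hz, indicator_of_notMem (by exact hz)]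
  rw [this]
  exact hf.indicator (measurable_snd hS)

theorem measurable_goodIntegrand {α : Type*} [MeasurableSpace α] {f g k : α → ℝ}
    (hf : Measurable f) (hg : Measurable g) (hk : Measurable k) :
    Measurable fun x => goodIntegrand (f x) (g x) (k x) := by
  unfold goodIntegrand; fun_prop

namespace LevelSetup

variable {N : ℕ} {s q L r ρ' R A a b : ℝ} {x₀ : RN N} {κ : ℝ → ℝ} {ζ : RN N → ℝ}
  {v : RN N → ℝ → ℝ}

theorem measurable_left (h : LevelSetup s q L r ρ' R A a b x₀ κ ζ v) :
    Measurable fun z : ℝ × RN N × RN N => v z.2.1 z.1 :=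
  h.meas.comp (f := fun z : ℝ × RN N × RN N => (z.2.1, z.1)) (by fun_prop)

theorem measurable_right (h : LevelSetup s q L r ρ' R A a b x₀ κ ζ v) :
    Measurable fun z : ℝ × RN N × RN N => v z.2.2 z.1 :=
  h.meas.comp (f := fun z : ℝ × RN N × RN N => (z.2.2, z.1)) (by fun_prop)

/-- The integrated upper bound for the error part of the nonlocal form at a fixed time. -/
theorem lintegral_error_eq (h : LevelSetup s q L r ρ' R A a b x₀ κ ζ v) {η : ℝ → ℝ} {ε : ℝ}
    (t τ : ℝ) :
    ∫⁻ p : RN N × RN N, ((Metric.ball x₀ R ×ˢ Metric.ball x₀ R).indicator (fun p =>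
          ENNReal.ofReal L * ENNReal.ofReal (max (v p.1 t - κ t) 0 * max (v p.2 t - κ t) 0
            * (ζ p.1 - ζ p.2) ^ 2 / ‖p.1 - p.2‖ ^ ((N : ℝ) + 2 * s))
          + ENNReal.ofReal (ε * L) *
            ENNReal.ofReal ((v p.1 t - v p.2 t) ^ 2 / ‖p.1 - p.2‖ ^ ((N : ℝ) + 2 * s))
          + ENNReal.ofReal (L / (4 * ε)) * ENNReal.ofReal
            (((truncTest η κ ζ v τ p.1 - truncTest η κ ζ v t p.1)
              - (truncTest η κ ζ v τ p.2 - truncTest η κ ζ v t p.2)) ^ 2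
                / ‖p.1 - p.2‖ ^ ((N : ℝ) + 2 * s))) p
        + ((Metric.ball x₀ R ×ˢ (Metric.ball x₀ R)ᶜ).indicator (fun p =>
            ENNReal.ofReal (L * truncTest η κ ζ v τ p.1) * ENNReal.ofReal (v p.2 t *
              ((R / (R - ρ')) ^ ((N : ℝ) + 2 * s) * (1 / ‖p.2 - x₀‖ ^ ((N : ℝ) + 2 * s))))) p
          + ((Metric.ball x₀ R)ᶜ ×ˢ Metric.ball x₀ R).indicator (fun p =>
              ENNReal.ofReal (v p.1 t *
              ((R / (R - ρ')) ^ ((N : ℝ) + 2 * s) * (1 / ‖p.1 - x₀‖ ^ ((N : ℝ) + 2 * s)))) *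
              ENNReal.ofReal (L * truncTest η κ ζ v τ p.2)) p))
      = (ENNReal.ofReal L * badForm s (Metric.ball x₀ R) κ ζ v t
          + ENNReal.ofReal (ε * L) * gagliardoProd s (Metric.ball x₀ R) (fun x => v x t)
          + ENNReal.ofReal (L / (4 * ε)) * gagliardoProd s (Metric.ball x₀ R)
              (fun x => truncTest η κ ζ v τ x - truncTest η κ ζ v t x))
        + ENNReal.ofReal (2 * L * (R / (R - ρ')) ^ ((N : ℝ) + 2 * s))
          * (∫⁻ x in Metric.ball x₀ R, ENNReal.ofReal (truncTest η κ ζ v τ x))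
          * farTail s (Metric.ball x₀ R) x₀ v t := by
  have hL0 : 0 < L := by linarith [h.one_le]
  have hρ := h.inner_nonneg
  have hR := h.inner_lt
  have hRR : 0 < R / (R - ρ') := div_pos (by linarith) (by linarith)
  have hBm : MeasurableSet (Metric.ball x₀ R) := measurableSet_ball
  have hv := h.measurable_slice t
  have hζ := h.cut_meas
  have m1 := h.measurable_truncTest (η := η) t
  have m2 := h.measurable_truncTest (η := η) τ
  set d : ℝ := (N : ℝ) + 2 * s with hd
  set c : ℝ := (R / (R - ρ')) ^ d with hc
  have hc0 : 0 < c := by positivity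
  set B := Metric.ball x₀ R with hB
  let F : RN N → ℝ≥0∞ := fun x => ENNReal.ofReal (L * truncTest η κ ζ v τ x)
  let H : RN N → ℝ≥0∞ := fun y => ENNReal.ofReal (v y t * (c * (1 / ‖y - x₀‖ ^ d)))
  have mF : Measurable F := by fun_prop
  have mH : Measurable H := by fun_prop
  have hF : ∫⁻ x in B, F x
      = ENNReal.ofReal L * ∫⁻ x in B, ENNReal.ofReal (truncTest η κ ζ v τ x) := by
    rw [← lintegral_const_mul _ (by fun_prop)]
    exact lintegral_congr fun x => ENNReal.ofReal_mul hL0.le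
  have hH : ∫⁻ y in Bᶜ, H y = ENNReal.ofReal c * farTail s B x₀ v t := by
    rw [farTail, ← lintegral_const_mul _ (by fun_prop)]
    refine lintegral_congr fun y => ?_
    rw [← ENNReal.ofReal_mul hc0.le]
    show ENNReal.ofReal _ = _
    congr 1; ring
  have n1 : Measurable ((B ×ˢ Bᶜ).indicator fun p : RN N × RN N => F p.1 * H p.2) :=
    Measurable.indicator (by fun_prop) (hBm.prod hBm.compl)
  have n2 : Measurable ((Bᶜ ×ˢ B).indicator fun p : RN N × RN N => H p.1 * F p.2) :=
    Measurable.indicator (by fun_prop) (hBm.compl.prod hBm)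
  have e1 : ∫⁻ p, (B ×ˢ Bᶜ).indicator (fun p : RN N × RN N => F p.1 * H p.2) p
      = (∫⁻ x in B, F x) * ∫⁻ y in Bᶜ, H y :=
    lintegral_indicator_prod_mul hBm hBm.compl mF mH
  have e2 : ∫⁻ p, (Bᶜ ×ˢ B).indicator (fun p : RN N × RN N => H p.1 * F p.2) p
      = (∫⁻ y in Bᶜ, H y) * ∫⁻ x in B, F x :=
    lintegral_indicator_prod_mul hBm.compl hBm mH mF
  have e3 := lintegral_add_left n1 ((Bᶜ ×ˢ B).indicator fun p : RN N × RN N => H p.1 * F p.2)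
    (μ := volume)
  refine (lintegral_add_right _ (n1.add n2)).trans ?_
  refine congrArg₂ (· + ·) ?_ ?_
  · rw [lintegral_indicator (hBm.prod hBm), lintegral_add_left (by fun_prop),
      lintegral_add_left (by fun_prop), lintegral_const_mul _ (by fun_prop),
      lintegral_const_mul _ (by fun_prop), lintegral_const_mul _ (by fun_prop)]
    rfl
  · refine e3.trans ?_
    rw [e1, e2, hF, hH, mul_assoc 2 L, ENNReal.ofReal_mul (by norm_num), ENNReal.ofReal_mul hL0.le,
      ENNReal.ofReal_ofNat]
    ring

/-- The increment of the level from `t₁` to `τ` yields `D ∫ (v(t₁) - κ(τ))₊ ζ²`, with `D` the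
weighted tail over the step, and the far part of the form costs `D ∫ (v(τ) - κ(τ))₊ ζ²`, both times
`η(τ)`. They cancel up to `D ω`, where `ω` bounds the `L¹` increment of `v`. So the tail survives
only multiplied by a quantity that vanishes with the step. -/
theorem testing_estimate (h : LevelSetup s q L r ρ' R A a b x₀ κ ζ v) {η : ℝ → ℝ} (hηm : Measurable η)
    (hη : ∀ t, 0 ≤ η t) (hη1 : ∀ t, η t ≤ 1) {K : RN N → RN N → ℝ → ℝ}
    (hK : Measurable fun z : ℝ × RN N × RN N => K z.2.1 z.2.2 z.1)
    (hK1 : ∀ x y t, L⁻¹ * (1 / ‖x - y‖ ^ ((N : ℝ) + 2 * s)) ≤ K x y t)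
    (hK2 : ∀ x y t, K x y t ≤ L * (1 / ‖x - y‖ ^ ((N : ℝ) + 2 * s))) {ε : ℝ} (hε : 0 < ε)
    {t₁ τ : ℝ} (h₁ : a ≤ t₁) (h₁₂ : t₁ ≤ τ) (h₂ : τ ≤ b)
    (hτ : (∫⁻ x in Metric.ball x₀ R, ENNReal.ofReal (v x τ ^ 2))
        + gagliardoProd s (Metric.ball x₀ R) (fun x => v x τ) < ∞)
    (hp₁ : ∫⁻ x in Metric.ball x₀ R, ENNReal.ofReal (v x t₁ ^ (q + 1)) < ∞)
    (hp₂ : ∫⁻ x in Metric.ball x₀ R, ENNReal.ofReal (v x τ ^ (q + 1)) < ∞)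
    (hweak : (∫ x in Metric.ball x₀ R, (v x τ ^ q - v x t₁ ^ q) * truncTest η κ ζ v τ x)
      + (∫ t in t₁..τ, ∫ p : RN N × RN N, (v p.1 t - v p.2 t) *
          (truncTest η κ ζ v τ p.1 - truncTest η κ ζ v τ p.2) * K p.1 p.2 t) ≤ 0)
    {ω : ℝ≥0∞} (hω : ∫⁻ x in Metric.ball x₀ R, ENNReal.ofReal |v x τ - v x t₁| ≤ ω) :
    ENNReal.ofReal (η τ) * cutEnergy q (Metric.ball x₀ R) κ ζ v τ
      + ENNReal.ofReal L⁻¹ *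
        (∫⁻ t in Ioc t₁ τ, ENNReal.ofReal (η t) * goodForm s (Metric.ball x₀ r) κ v t)
    ≤ ENNReal.ofReal (η τ) * cutEnergy q (Metric.ball x₀ R) κ ζ v t₁
      + (∫⁻ t in Ioc t₁ τ, (ENNReal.ofReal L * badForm s (Metric.ball x₀ R) κ ζ v t
          + ENNReal.ofReal (ε * L) * gagliardoProd s (Metric.ball x₀ R) (fun x => v x t)
          + ENNReal.ofReal (L / (4 * ε)) * gagliardoProd s (Metric.ball x₀ R)
              (fun x => truncTest η κ ζ v τ x - truncTest η κ ζ v t x)))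
      + ENNReal.ofReal (2 * L * (R / (R - ρ')) ^ ((N : ℝ) + 2 * s)) *
        (∫⁻ t in Ioc t₁ τ, farTail s (Metric.ball x₀ R) x₀ v t) * ω := by
  have hL0 : 0 < L := by linarith [h.one_le]
  have hψ := h.isSpatialProfile_truncTest hη hη1 hτ
  have hBm : MeasurableSet (Metric.ball x₀ R) := measurableSet_ball
  have hbm : MeasurableSet (Metric.ball x₀ r) := measurableSet_ball
  have hv1 := h.measurable_left
  have hv2 := h.measurable_right
  have hvτ := h.measurable_slice τ
  have hvt := h.measurable_slice t₁
  have hζ := h.cut_meas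
  have hκ := h.level_meas
  have hft := h.lintegral_farTail_lt_top h₁ h₁₂ h₂
  have hsub : Ioc t₁ τ ⊆ Icc a b := fun t ht => ⟨h₁.trans ht.1.le, ht.2.trans h₂⟩
  have hf1 := form_integrable h.s_pos h.one_le h.inner_nonneg h.inner_lt hψ h.meas h.nonneg hK hK1
    hK2 (I := Ioc t₁ τ) (by simp) ((lintegral_mono_set hsub).trans_lt h.sobolev) hft
  have hf2 := h.energy_part_integrable hη hη1 hp₁ hp₂
  set B := Metric.ball x₀ R with hB
  set c' := ENNReal.ofReal (2 * L * (R / (R - ρ')) ^ ((N : ℝ) + 2 * s)) with hc'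
  -- The amount of level growth used in `gPlus_increment_le`, chosen equal to the weighted tail and
  -- not to the full increment of `κ^q`, so that it cancels exactly below.
  set D : ℝ≥0∞ := c' * ∫⁻ t in Ioc t₁ τ, farTail s B x₀ v t with hD
  have hDtop : D ≠ ∞ := (ENNReal.mul_lt_top ENNReal.ofReal_lt_top hft).ne
  have hk1 := h.level_pos t₁
  have hk2 := h.level_pos τ
  have hkk := h.level_mono h₁₂
  have hq0 : 0 < q := by linarith [h.one_lt]
  have hDle : D.toReal ≤ κ τ ^ q - κ t₁ ^ q :=
    ENNReal.toReal_le_of_le_ofReal (sub_nonneg.2 (Real.rpow_le_rpow hk1.le hkk hq0.le))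
      (h.tail t₁ τ h₁ h₁₂ h₂)
  rw [intervalIntegral.integral_of_le h₁₂, ← integral_prod _ hf1, add_comm] at hweak
  -- the pointwise inequality for the energy part
  have hgP : ∀ x, 0 ≤ gPlus q (v x τ) (κ τ) := fun x => gPlus_nonneg h.one_lt _ hk2
  have hgP1 : ∀ x, 0 ≤ gPlus q (v x t₁) (κ t₁) := fun x => gPlus_nonneg h.one_lt _ hk1
  have hE : ∀ x, (ENNReal.ofReal (η τ) * (ENNReal.ofReal (gPlus q (v x τ) (κ τ) * ζ x ^ 2)
        + D * ENNReal.ofReal (max (v x t₁ - κ τ) 0 * ζ x ^ 2)))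
      + ENNReal.ofReal (-((v x τ ^ q - v x t₁ ^ q) * truncTest η κ ζ v τ x))
      ≤ ENNReal.ofReal (η τ) * ENNReal.ofReal (gPlus q (v x t₁) (κ t₁) * ζ x ^ 2)
      + ENNReal.ofReal ((v x τ ^ q - v x t₁ ^ q) * truncTest η κ ζ v τ x) := by
    intro x
    have hbase := gPlus_increment_le h.one_lt (a := v x t₁) (b := v x τ) hk1 hkk hDle (h.nonneg x t₁)
    have hm0 : 0 ≤ max (v x t₁ - κ τ) 0 := le_max_right _ _
    have h0 := hη τ
    have h1 := hgP x
    have h2 := hgP1 x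
    have hz : 0 ≤ η τ * ζ x ^ 2 := by positivity
    have key := ofReal_add_ofReal_neg_le
      (g := η τ * (gPlus q (v x τ) (κ τ) * ζ x ^ 2 + D.toReal * (max (v x t₁ - κ τ) 0 * ζ x ^ 2)))
      (P := η τ * (gPlus q (v x t₁) (κ t₁) * ζ x ^ 2))
      (f := (v x τ ^ q - v x t₁ ^ q) * truncTest η κ ζ v τ x) (by positivity) (by positivity)
      (by
        have := mul_le_mul_of_nonneg_left hbase hz
        simp only [truncTest]
        linarith)
    rwa [ENNReal.ofReal_mul h0, ENNReal.ofReal_mul h0,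
      ENNReal.ofReal_add (by positivity) (by positivity), ENNReal.ofReal_mul ENNReal.toReal_nonneg,
      ENNReal.ofReal_toReal hDtop] at key
  have main := lintegral_add_le_of_integral_add_nonpos hf1 hf2 hweak
    (Eventually.of_forall fun z => h.form_pointwise hη hη1 hK1 hK2 hε z.1 τ z.2)
    (Eventually.of_forall hE)
  have mgP : Measurable fun x => gPlus q (v x τ) (κ τ) :=
    measurable_gPlus h.one_lt hvτ measurable_const fun _ => hk2
  have mgP1 : Measurable fun x => gPlus q (v x t₁) (κ t₁) :=
    measurable_gPlus h.one_lt hvt measurable_const fun _ => hk1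
  have hg1 : ∫⁻ z : ℝ × RN N × RN N, (Metric.ball x₀ r ×ˢ Metric.ball x₀ r).indicator
      (fun p => ENNReal.ofReal L⁻¹ * (ENNReal.ofReal (η z.1) * ENNReal.ofReal
          (goodIntegrand (v p.1 z.1) (v p.2 z.1) (κ z.1) / ‖p.1 - p.2‖ ^ ((N : ℝ) + 2 * s)))) z.2
        ∂((volume.restrict (Ioc t₁ τ)).prod volume)
      = ENNReal.ofReal L⁻¹ *
        (∫⁻ t in Ioc t₁ τ, ENNReal.ofReal (η t) * goodForm s (Metric.ball x₀ r) κ v t) := by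
    have mg : Measurable fun z : ℝ × RN N × RN N =>
        goodIntegrand (v z.2.1 z.1) (v z.2.2 z.1) (κ z.1) :=
      measurable_goodIntegrand hv1 hv2 (hκ.comp measurable_fst)
    rw [lintegral_prod _ (measurable_indicator_snd (hbm.prod hbm) (f := fun t p =>
        ENNReal.ofReal L⁻¹ * (ENNReal.ofReal (η t) * ENNReal.ofReal
          (goodIntegrand (v p.1 t) (v p.2 t) (κ t) / ‖p.1 - p.2‖ ^ ((N : ℝ) + 2 * s))))
        (by fun_prop)).aemeasurable, ← lintegral_const_mul' _ _ ENNReal.ofReal_ne_top]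
    refine lintegral_congr fun t => ?_
    dsimp only
    rw [lintegral_indicator (hbm.prod hbm), lintegral_const_mul' _ _ ENNReal.ofReal_ne_top,
      lintegral_const_mul' _ _ ENNReal.ofReal_ne_top]
    rfl
  set W := ∫⁻ x in B, ENNReal.ofReal (truncTest η κ ζ v τ x) with hW
  set W' := ∫⁻ x in B, ENNReal.ofReal (max (v x t₁ - κ τ) 0 * ζ x ^ 2) with hW'
  -- The form sees the profile at `τ` while the energy part controls the truncation of `v(t₁)` at
  -- the level `κ(τ)`; positive parts are 1-Lipschitz, so they differ by at most `|v(τ) - v(t₁)|`.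
  have hWle : W ≤ ENNReal.ofReal (η τ) * (W' + ω) := by
    have e : W = ENNReal.ofReal (η τ) * ∫⁻ x in B, ENNReal.ofReal (max (v x τ - κ τ) 0 * ζ x ^ 2) := by
      rw [← lintegral_const_mul' _ _ ENNReal.ofReal_ne_top]
      exact lintegral_congr fun x => ENNReal.ofReal_mul (hη τ)
    rw [e]
    gcongr
    refine le_trans ?_ (add_le_add le_rfl hω)
    rw [hW', ← lintegral_add_left (by fun_prop)]
    refine lintegral_mono fun x => ?_
    have hz0 := h.cut_nonneg x
    have hz : ζ x ^ 2 ≤ 1 := pow_le_one₀ hz0 (h.cut_le_one x)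
    rw [← ENNReal.ofReal_add (by positivity) (by positivity)]
    refine ENNReal.ofReal_le_ofReal ?_
    have h3 : max (v x τ - κ τ) 0 ≤ max (v x t₁ - κ τ) 0 + |v x τ - v x t₁| := by
      refine max_le ?_ (by positivity)
      linarith [le_abs_self (v x τ - v x t₁), le_max_left (v x t₁ - κ τ) 0]
    calc _ ≤ (max (v x t₁ - κ τ) 0 + |v x τ - v x t₁|) * ζ x ^ 2 := by gcongr
      _ = max (v x t₁ - κ τ) 0 * ζ x ^ 2 + |v x τ - v x t₁| * ζ x ^ 2 := by ring
      _ ≤ max (v x t₁ - κ τ) 0 * ζ x ^ 2 + |v x τ - v x t₁| * 1 := by gcongr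
      _ = _ := by ring
  have hW'top : W' ≠ ∞ := by
    refine ne_of_lt (lt_of_le_of_lt (lintegral_mono (g := fun x => 1 +
      ENNReal.ofReal (v x t₁ ^ (q + 1))) fun x => ?_) ?_)
    · have h0 := h.nonneg x t₁
      dsimp only
      rw [← ENNReal.ofReal_one, ← ENNReal.ofReal_add zero_le_one (by positivity)]
      refine ENNReal.ofReal_le_ofReal ?_
      have hz : ζ x ^ 2 ≤ 1 := pow_le_one₀ (h.cut_nonneg x) (h.cut_le_one x)
      calc max (v x t₁ - κ τ) 0 * ζ x ^ 2 ≤ v x t₁ * 1 := by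
            gcongr
            exact max_le (by linarith) h0
        _ ≤ 1 + v x t₁ ^ (q + 1) := by
            rw [mul_one]
            rcases le_total (v x t₁) 1 with h1 | h1
            · have : 0 ≤ v x t₁ ^ (q + 1) := by positivity
              linarith
            · have := Real.rpow_le_rpow_of_exponent_le h1 (show 1 ≤ q + 1 by linarith)
              rw [Real.rpow_one] at this
              linarith
    · rw [lintegral_add_left measurable_const, setLIntegral_const, one_mul]
      exact ENNReal.add_lt_top.2 ⟨measure_ball_lt_top, hp₁⟩
  rw [hg1, lintegral_const_mul' _ _ ENNReal.ofReal_ne_top,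
    lintegral_const_mul' _ _ ENNReal.ofReal_ne_top, lintegral_add_left (by fun_prop),
    lintegral_const_mul' _ _ hDtop] at main
  -- Only this one-sided form of Tonelli is needed, and it requires no measurability of the error
  -- term.
  have hP := main.trans (add_le_add (lintegral_prod_le _) le_rfl)
  simp_rw [h.lintegral_error_eq] at hP
  rw [lintegral_add_right _ (h.measurable_farTail.const_mul _),
    lintegral_const_mul _ h.measurable_farTail] at hP
  set G := ENNReal.ofReal L⁻¹ *
        (∫⁻ t in Ioc t₁ τ, ENNReal.ofReal (η t) * goodForm s (Metric.ball x₀ r) κ v t)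
  set X := ∫⁻ t in Ioc t₁ τ, (ENNReal.ofReal L * badForm s B κ ζ v t
          + ENNReal.ofReal (ε * L) * gagliardoProd s B (fun x => v x t)
          + ENNReal.ofReal (L / (4 * ε)) * gagliardoProd s B
              (fun x => truncTest η κ ζ v τ x - truncTest η κ ζ v t x))
  change G + ENNReal.ofReal (η τ) * (cutEnergy q B κ ζ v τ + D * W')
    ≤ (X + c' * W * (∫⁻ t in Ioc t₁ τ, farTail s B x₀ v t))
      + ENNReal.ofReal (η τ) * cutEnergy q B κ ζ v t₁ at hP
  have hη1' : ENNReal.ofReal (η τ) ≤ 1 := by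
    rw [← ENNReal.ofReal_one]; exact ENNReal.ofReal_le_ofReal (hη1 τ)
  -- The common tail contribution is finite and can be cancelled from both sides.
  have hfin : D * (ENNReal.ofReal (η τ) * W') ≠ ∞ := by finiteness
  refine (ENNReal.add_le_add_iff_right hfin).1 ?_
  calc _ = G + ENNReal.ofReal (η τ) * (cutEnergy q B κ ζ v τ + D * W') := by ring
    _ ≤ _ := hP
    _ = (X + D * W) + ENNReal.ofReal (η τ) * cutEnergy q B κ ζ v t₁ := by rw [hD]; ring
    _ ≤ (X + D * (ENNReal.ofReal (η τ) * (W' + ω)))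
        + ENNReal.ofReal (η τ) * cutEnergy q B κ ζ v t₁ := by gcongr
    _ = (X + D * (ENNReal.ofReal (η τ) * W' + ENNReal.ofReal (η τ) * ω))
        + ENNReal.ofReal (η τ) * cutEnergy q B κ ζ v t₁ := by ring
    _ ≤ (X + D * (ENNReal.ofReal (η τ) * W' + 1 * ω))
        + ENNReal.ofReal (η τ) * cutEnergy q B κ ζ v t₁ := by gcongr
    _ = _ := by ring

end LevelSetup

/-! ### Integration over the final time and passage to the limit in the step -/

namespace LevelSetup

variable {N : ℕ} {s q L r ρ' R A a b : ℝ} {x₀ : RN N} {κ : ℝ → ℝ} {ζ : RN N → ℝ}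
  {v : RN N → ℝ → ℝ}

theorem measurable_cutEnergy (h : LevelSetup s q L r ρ' R A a b x₀ κ ζ v) (B : Set (RN N)) :
    Measurable (cutEnergy q B κ ζ v) := by
  have hv : Measurable fun z : ℝ × RN N => v z.2 z.1 :=
    h.meas.comp (f := fun z : ℝ × RN N => (z.2, z.1)) (by fun_prop)
  have hg : Measurable fun z : ℝ × RN N => gPlus q (v z.2 z.1) (κ z.1) :=
    measurable_gPlus h.one_lt hv (h.level_meas.comp measurable_fst) fun z => h.level_pos _
  have hζ := h.cut_meas
  have : Measurable fun z : ℝ × RN N =>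
      ENNReal.ofReal (gPlus q (v z.2 z.1) (κ z.1) * ζ z.2 ^ 2) := by fun_prop
  exact this.lintegral_prod_right'

theorem measurable_goodForm (h : LevelSetup s q L r ρ' R A a b x₀ κ ζ v) (B : Set (RN N)) :
    Measurable (goodForm s B κ v) := by
  have hg : Measurable fun z : ℝ × RN N × RN N =>
      goodIntegrand (v z.2.1 z.1) (v z.2.2 z.1) (κ z.1) :=
    measurable_goodIntegrand h.measurable_left h.measurable_right (h.level_meas.comp measurable_fst)
  have : Measurable fun z : ℝ × RN N × RN N => ENNReal.ofReal
      (goodIntegrand (v z.2.1 z.1) (v z.2.2 z.1) (κ z.1)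
        / ‖z.2.1 - z.2.2‖ ^ ((N : ℝ) + 2 * s)) := by fun_prop
  exact this.lintegral_prod_right'

theorem measurable_badForm (h : LevelSetup s q L r ρ' R A a b x₀ κ ζ v) (B : Set (RN N)) :
    Measurable (badForm s B κ ζ v) := by
  have h1 := h.measurable_left
  have h2 := h.measurable_right
  have h3 := h.level_meas
  have h4 := h.cut_meas
  have : Measurable fun z : ℝ × RN N × RN N => ENNReal.ofReal
      (max (v z.2.1 z.1 - κ z.1) 0 * max (v z.2.2 z.1 - κ z.1) 0
        * (ζ z.2.1 - ζ z.2.2) ^ 2 / ‖z.2.1 - z.2.2‖ ^ ((N : ℝ) + 2 * s)) :=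
    (((((h1.sub (h3.comp measurable_fst)).max measurable_const).mul
      ((h2.sub (h3.comp measurable_fst)).max measurable_const)).mul (by fun_prop)).div
        (by fun_prop)).ennreal_ofReal
  exact this.lintegral_prod_right'

theorem measurable_gagliardoProd (h : LevelSetup s q L r ρ' R A a b x₀ κ ζ v) (B : Set (RN N)) :
    Measurable fun t => gagliardoProd s B fun x => v x t := by
  have h1 := h.measurable_left
  have h2 := h.measurable_right
  have : Measurable fun z : ℝ × RN N × RN N => ENNReal.ofReal
      ((v z.2.1 z.1 - v z.2.2 z.1) ^ 2 / ‖z.2.1 - z.2.2‖ ^ ((N : ℝ) + 2 * s)) :=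
    (((h1.sub h2).pow_const 2).div (by fun_prop)).ennreal_ofReal
  exact this.lintegral_prod_right'

theorem measurable_truncTest_uncurry (h : LevelSetup s q L r ρ' R A a b x₀ κ ζ v) {η : ℝ → ℝ}
    (hη : Measurable η) : Measurable fun z : ℝ × RN N => truncTest η κ ζ v z.1 z.2 := by
  have h1 : Measurable fun z : ℝ × RN N => v z.2 z.1 :=
    h.meas.comp (f := fun z : ℝ × RN N => (z.2, z.1)) (by fun_prop)
  have h3 := h.level_meas
  have h4 := h.cut_meas
  exact (hη.comp measurable_fst).mul
    (((h1.sub (h3.comp measurable_fst)).max measurable_const).mul (by fun_prop))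

theorem measurable_gagliardoProd_sub (h : LevelSetup s q L r ρ' R A a b x₀ κ ζ v) {η : ℝ → ℝ}
    (hη : Measurable η) (B : Set (RN N)) :
    Measurable fun y : ℝ × ℝ => gagliardoProd s B fun x =>
      truncTest η κ ζ v y.2 x - truncTest η κ ζ v y.1 x := by
  have hm := h.measurable_truncTest_uncurry hη
  have m1 : Measurable fun z : (ℝ × ℝ) × RN N × RN N => truncTest η κ ζ v z.1.2 z.2.1 :=
    hm.comp (f := fun z : (ℝ × ℝ) × RN N × RN N => (z.1.2, z.2.1)) (by fun_prop)
  have m2 : Measurable fun z : (ℝ × ℝ) × RN N × RN N => truncTest η κ ζ v z.1.1 z.2.1 :=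
    hm.comp (f := fun z : (ℝ × ℝ) × RN N × RN N => (z.1.1, z.2.1)) (by fun_prop)
  have m3 : Measurable fun z : (ℝ × ℝ) × RN N × RN N => truncTest η κ ζ v z.1.2 z.2.2 :=
    hm.comp (f := fun z : (ℝ × ℝ) × RN N × RN N => (z.1.2, z.2.2)) (by fun_prop)
  have m4 : Measurable fun z : (ℝ × ℝ) × RN N × RN N => truncTest η κ ζ v z.1.1 z.2.2 :=
    hm.comp (f := fun z : (ℝ × ℝ) × RN N × RN N => (z.1.1, z.2.2)) (by fun_prop)
  have : Measurable fun z : (ℝ × ℝ) × RN N × RN N => ENNReal.ofReal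
      (((truncTest η κ ζ v z.1.2 z.2.1 - truncTest η κ ζ v z.1.1 z.2.1)
        - (truncTest η κ ζ v z.1.2 z.2.2 - truncTest η κ ζ v z.1.1 z.2.2)) ^ 2
          / ‖z.2.1 - z.2.2‖ ^ ((N : ℝ) + 2 * s)) :=
    ((((m1.sub m2).sub (m3.sub m4)).pow_const 2).div (by fun_prop)).ennreal_ofReal
  exact this.lintegral_prod_right'

/-- The time translations of the truncated test function are continuous in the Gagliardo
seminorm. -/
theorem exists_lintegral_gagliardoProd_translate_le (h : LevelSetup s q L r ρ' R A a b x₀ κ ζ v)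
    {η : ℝ → ℝ} (hηm : Measurable η) (hη : ∀ t, 0 ≤ η t) (hη1 : ∀ t, η t ≤ 1) {ε : ℝ}
    (hε : 0 < ε) :
    ∃ h₀ > 0, ∀ l, |l| < h₀ → ∀ c₁ c₂, a ≤ c₁ → a ≤ c₁ - l → c₂ ≤ b → c₂ - l ≤ b →
      ∫⁻ τ in Ioo c₁ c₂, gagliardoProd s (Metric.ball x₀ R) (fun x =>
        truncTest η κ ζ v τ x - truncTest η κ ζ v (τ - l) x) ≤ ENNReal.ofReal ε := by
  obtain ⟨C, hC, hCle⟩ := h.exists_gagliardoProd_truncTest_le hη hη1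
  set B := Metric.ball x₀ R with hB
  have hBm : MeasurableSet B := measurableSet_ball
  set d : ℝ := (N : ℝ) + 2 * s with hd
  -- The Gagliardo difference quotient as one function on space-pairs and time: its `L²` norm over
  -- `B × B` is the seminorm, so continuity of translations in `L²` gives the claim. Cutting to `[a,
  -- b]` is harmless because `τ` and `τ - l` both stay in that interval.
  let f : (RN N × RN N) × ℝ → ℝ := ((B ×ˢ B) ×ˢ Icc a b).indicator fun z =>
    (truncTest η κ ζ v z.2 z.1.1 - truncTest η κ ζ v z.2 z.1.2) / ‖z.1.1 - z.1.2‖ ^ (d / 2)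
  have hsq : ∀ p : RN N × RN N, (‖p.1 - p.2‖ ^ (d / 2)) ^ 2 = ‖p.1 - p.2‖ ^ d := fun p => by
    rw [← Real.rpow_natCast, ← Real.rpow_mul (norm_nonneg _)]
    congr 1; push_cast; ring
  have hm := h.measurable_truncTest_uncurry hηm
  have m1 : Measurable fun z : (RN N × RN N) × ℝ => truncTest η κ ζ v z.2 z.1.1 :=
    hm.comp (f := fun z : (RN N × RN N) × ℝ => (z.2, z.1.1)) (by fun_prop)
  have m2 : Measurable fun z : (RN N × RN N) × ℝ => truncTest η κ ζ v z.2 z.1.2 :=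
    hm.comp (f := fun z : (RN N × RN N) × ℝ => (z.2, z.1.2)) (by fun_prop)
  have mf : Measurable f :=
    Measurable.indicator ((m1.sub m2).div (by fun_prop)) ((hBm.prod hBm).prod measurableSet_Icc)
  have hfL : MemLp f 2 := by
    refine ⟨mf.aestronglyMeasurable, ?_⟩
    rw [eLpNorm_lt_top_iff_lintegral_rpow_enorm_lt_top (by simp) (by simp)]
    have e : ∫⁻ z, ‖f z‖ₑ ^ (2 : ℝ≥0∞).toReal
        = ∫⁻ t in Icc a b, gagliardoProd s B (truncTest η κ ζ v t) := by
      rw [Measure.volume_eq_prod, lintegral_prod_symm' _ (by fun_prop),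
        ← lintegral_indicator measurableSet_Icc]
      refine lintegral_congr fun t => ?_
      by_cases ht : t ∈ Icc a b
      · rw [indicator_of_mem ht, gagliardoProd, ← lintegral_indicator (hBm.prod hBm)]
        refine lintegral_congr fun p => ?_
        by_cases hp : p ∈ B ×ˢ B
        · rw [indicator_of_mem hp]
          simp only [f]
          rw [indicator_of_mem (by exact ⟨hp, ht⟩), Real.enorm_eq_ofReal_abs,
            ENNReal.ofReal_rpow_of_nonneg (abs_nonneg _) (by simp)]
          congr 1
          rw [ENNReal.toReal_ofNat, Real.rpow_ofNat, sq_abs, div_pow, hsq]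
        · rw [indicator_of_notMem hp]
          simp only [f]
          rw [indicator_of_notMem (fun hc => hp hc.1)]
          simp
      · rw [indicator_of_notMem ht]
        refine (lintegral_congr fun p => ?_).trans lintegral_zero
        simp only [f]
        rw [indicator_of_notMem (fun hc => ht hc.2)]
        simp
    rw [e]
    refine (lintegral_mono fun t => hCle t).trans_lt ?_
    rw [lintegral_const_mul' _ _ hC]
    exact ENNReal.mul_lt_top hC.lt_top h.sobolev
  have : (volume : Measure (RN N × RN N)).IsAddHaarMeasure := by
    rw [Measure.volume_eq_prod]; infer_instance
  obtain ⟨h₀, hh₀, H⟩ := exists_forall_lintegral_time_translate_sub_sq_le hfL hε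
  refine ⟨h₀, hh₀, fun l hl c₁ c₂ h1 h2 h3 h4 => le_trans ?_ (H l hl)⟩
  rw [Measure.volume_eq_prod (RN N × RN N) ℝ, lintegral_prod_symm' _ (by fun_prop),
    ← lintegral_indicator measurableSet_Ioo]
  refine lintegral_mono fun τ => ?_
  by_cases hτ : τ ∈ Ioo c₁ c₂
  · rw [indicator_of_mem hτ, gagliardoProd, ← lintegral_indicator (hBm.prod hBm)]
    refine lintegral_mono fun p => ?_
    by_cases hp : p ∈ B ×ˢ B
    · rw [indicator_of_mem hp]
      simp only [f]
      rw [indicator_of_mem (by exact ⟨hp, by constructor <;> linarith [hτ.1, hτ.2]⟩),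
        indicator_of_mem (by exact ⟨hp, by constructor <;> simp only <;> linarith [hτ.1, hτ.2]⟩)]
      refine le_of_eq ?_
      congr 1
      rw [← hsq p, ← div_pow]
      congr 1
      ring
    · rw [indicator_of_notMem hp]; exact zero_le
  · rw [indicator_of_notMem hτ]; exact zero_le

end LevelSetup

/-- A time cutoff: `0` before `c₁`, `1` after `c₂`, with slope at most `β`. -/
structure TimeCut (η : ℝ → ℝ) (c₁ c₂ β : ℝ) : Prop where
  meas : Measurable η
  nonneg : ∀ t, 0 ≤ η t
  le_one : ∀ t, η t ≤ 1
  zero : ∀ t ≤ c₁, η t = 0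
  one : ∀ t, c₂ ≤ t → η t = 1
  slope_nonneg : 0 ≤ β
  slope : ∀ t l, 0 ≤ l → η (t + l) ≤ η t + l * β

/-- The weak inequality tested with profiles constant in time, on a set `S` of good times of full
measure in `[a,b]`, together with uniform bounds in time. -/
structure WeakData {N : ℕ} (s q L ρ' R a b M : ℝ) (x₀ : RN N) (v : RN N → ℝ → ℝ)
    (K : RN N → RN N → ℝ → ℝ) (S : Set ℝ) : Prop where
  kernel_meas : Measurable fun z : ℝ × RN N × RN N => K z.2.1 z.2.2 z.1
  kernel_lower : ∀ x y t, L⁻¹ * (1 / ‖x - y‖ ^ ((N : ℝ) + 2 * s)) ≤ K x y t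
  kernel_upper : ∀ x y t, K x y t ≤ L * (1 / ‖x - y‖ ^ ((N : ℝ) + 2 * s))
  ae_mem : ∀ᵐ t : ℝ, t ∈ Icc a b → t ∈ S
  bound : ∀ t ∈ S, ∫⁻ x in Metric.ball x₀ R, ENNReal.ofReal (v x t ^ (q + 1)) ≤ ENNReal.ofReal M
  modulus : ∀ ε > 0, ∃ δ > 0, ∀ t ∈ S, ∀ t' ∈ S, |t - t'| < δ →
    ∫⁻ x in Metric.ball x₀ R, ENNReal.ofReal |v x t - v x t'| ≤ ENNReal.ofReal ε
  weak : ∀ t₁ ∈ S, ∀ τ ∈ S, a ≤ t₁ → t₁ ≤ τ → τ ≤ b → ∀ ψ : RN N → ℝ,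
    IsSpatialProfile s ρ' R x₀ ψ → (∀ x, ψ x ≤ v x τ) →
    (∫ x in Metric.ball x₀ R, (v x τ ^ q - v x t₁ ^ q) * ψ x)
      + (∫ t in t₁..τ, ∫ p : RN N × RN N,
          (v p.1 t - v p.2 t) * (ψ p.1 - ψ p.2) * K p.1 p.2 t) ≤ 0

namespace LevelSetup

variable {N : ℕ} {s q L r ρ' R A a b : ℝ} {x₀ : RN N} {κ : ℝ → ℝ} {ζ : RN N → ℝ}
  {v : RN N → ℝ → ℝ}

theorem ae_sobolev_lt_top (h : LevelSetup s q L r ρ' R A a b x₀ κ ζ v) :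
    ∀ᵐ t : ℝ, t ∈ Icc a b → (∫⁻ x in Metric.ball x₀ R, ENNReal.ofReal (v x t ^ 2))
      + gagliardoProd s (Metric.ball x₀ R) (fun x => v x t) < ∞ := by
  have hv : Measurable fun z : ℝ × RN N => v z.2 z.1 :=
    h.meas.comp (f := fun z : ℝ × RN N => (z.2, z.1)) (by fun_prop)
  have m1 : Measurable fun z : ℝ × RN N => ENNReal.ofReal (v z.2 z.1 ^ 2) :=
    (hv.pow_const 2).ennreal_ofReal
  have m2 : Measurable fun t => (∫⁻ x in Metric.ball x₀ R, ENNReal.ofReal (v x t ^ 2))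
      + gagliardoProd s (Metric.ball x₀ R) (fun x => v x t) :=
    Measurable.add m1.lintegral_prod_right' (h.measurable_gagliardoProd _)
  rw [← ae_restrict_iff' measurableSet_Icc]
  exact ae_lt_top m2 h.sobolev.ne

theorem cutEnergy_le (h : LevelSetup s q L r ρ' R A a b x₀ κ ζ v) (t : ℝ) (B : Set (RN N)) :
    cutEnergy q B κ ζ v t ≤ ∫⁻ x in B, ENNReal.ofReal (v x t ^ (q + 1)) := by
  refine lintegral_mono fun x => ENNReal.ofReal_le_ofReal ?_
  have hz : ζ x ^ 2 ≤ 1 := pow_le_one₀ (h.cut_nonneg x) (h.cut_le_one x)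
  calc gPlus q (v x t) (κ t) * ζ x ^ 2 ≤ gPlus q (v x t) (κ t) * 1 := by
        gcongr
        exact gPlus_nonneg h.one_lt _ (h.level_pos t)
    _ ≤ _ := by rw [mul_one]; exact gPlus_le h.one_lt (h.level_pos t) (h.nonneg x t)

/-- The one-step inequality with step `l₀` holds for almost every `τ`, since it needs `τ` and `τ -
l₀` to be good times and finite Sobolev energy at `τ`. Integrated in `τ` and rewritten by lags, the
form contributes `l₀` times time integrals over the whole interval. -/
theorem integrated_testing_estimate_aux (h : LevelSetup s q L r ρ' R A a b x₀ κ ζ v) {M : ℝ}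
    {K : RN N → RN N → ℝ → ℝ} {S : Set ℝ} (hw : WeakData s q L ρ' R a b M x₀ v K S)
    {η : ℝ → ℝ} {c₁ c₂ β : ℝ} (hη : TimeCut η c₁ c₂ β) {α τ₂ l₀ ε : ℝ} {ω E : ℝ≥0∞}
    (hα : a ≤ α) (hαc : α ≤ c₁ - l₀) (hl₀ : 0 < l₀) (hc : c₁ ≤ c₂) (hb : τ₂ ≤ b) (hε : 0 < ε)
    (hω : ∀ t ∈ S, ∀ t' ∈ S, |t - t'| ≤ l₀ →
      ∫⁻ x in Metric.ball x₀ R, ENNReal.ofReal |v x t - v x t'| ≤ ω)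
    (hE : ∀ l ∈ Ico 0 l₀, ∫⁻ τ in Ioo c₁ τ₂, gagliardoProd s (Metric.ball x₀ R) (fun x =>
        truncTest η κ ζ v τ x - truncTest η κ ζ v (τ - l) x) ≤ E) :
    (∫⁻ τ in Ioo c₁ τ₂, ENNReal.ofReal (η τ) * cutEnergy q (Metric.ball x₀ R) κ ζ v τ)
      + ENNReal.ofReal l₀ * (ENNReal.ofReal L⁻¹ *
        ∫⁻ t in Ioo c₂ (τ₂ - l₀), goodForm s (Metric.ball x₀ r) κ v t)
    ≤ (∫⁻ τ in Ioo c₁ τ₂, ENNReal.ofReal (η τ)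
          * cutEnergy q (Metric.ball x₀ R) κ ζ v (τ - l₀))
      + ENNReal.ofReal l₀ *
        (ENNReal.ofReal L * (∫⁻ t in Ioo α τ₂, badForm s (Metric.ball x₀ R) κ ζ v t)
          + ENNReal.ofReal (ε * L) *
            (∫⁻ t in Ioo α τ₂, gagliardoProd s (Metric.ball x₀ R) (fun x => v x t))
          + ENNReal.ofReal (L / (4 * ε)) * E
          + ENNReal.ofReal (2 * L * (R / (R - ρ')) ^ ((N : ℝ) + 2 * s)) * ω *
            (∫⁻ t in Ioo α τ₂, farTail s (Metric.ball x₀ R) x₀ v t)) := by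
  set B := Metric.ball x₀ R with hB
  set c' := ENNReal.ofReal (2 * L * (R / (R - ρ')) ^ ((N : ℝ) + 2 * s)) with hc'
  have mF := h.measurable_cutEnergy B
  have mG := h.measurable_goodForm (Metric.ball x₀ r)
  have mBad := h.measurable_badForm B
  have mV := h.measurable_gagliardoProd B
  have mT := h.measurable_farTail
  have mD := h.measurable_gagliardoProd_sub hη.meas B
  have mη := hη.meas
  let Φ : ℝ → ℝ → ℝ≥0∞ := fun t τ => ENNReal.ofReal L * badForm s B κ ζ v t
    + ENNReal.ofReal (ε * L) * gagliardoProd s B (fun x => v x t)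
    + ENNReal.ofReal (L / (4 * ε)) * gagliardoProd s B
        (fun x => truncTest η κ ζ v τ x - truncTest η κ ζ v t x)
    + c' * ω * farTail s B x₀ v t
  have mΦ : Measurable (Function.uncurry Φ) :=
    ((((mBad.comp measurable_fst).const_mul _).add ((mV.comp measurable_fst).const_mul _)).add
      (mD.const_mul _)).add ((mT.comp measurable_fst).const_mul _)
  -- The good terms do not involve the freezing time; the dummy argument fits the exchange of
  -- integrals used for the errors.
  let Γ : ℝ → ℝ → ℝ≥0∞ := fun t _ => ENNReal.ofReal (η t) * goodForm s (Metric.ball x₀ r) κ v t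
  have mΓ : Measurable (Function.uncurry Γ) :=
    ((mη.comp measurable_fst).ennreal_ofReal).mul (mG.comp measurable_fst)
  -- the one-step inequality holds at almost every time
  have hS' : ∀ᵐ τ : ℝ, τ - l₀ ∈ Icc a b → τ - l₀ ∈ S :=
    (measurePreserving_sub_right volume l₀).quasiMeasurePreserving.ae hw.ae_mem
  have step : ∀ᵐ τ ∂(volume.restrict (Ioo c₁ τ₂)),
      ENNReal.ofReal (η τ) * cutEnergy q B κ ζ v τ
        + ENNReal.ofReal L⁻¹ * (∫⁻ t in Ioc (τ - l₀) τ, Γ t τ)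
      ≤ ENNReal.ofReal (η τ) * cutEnergy q B κ ζ v (τ - l₀)
        + ∫⁻ t in Ioc (τ - l₀) τ, Φ t τ := by
    rw [ae_restrict_iff' measurableSet_Ioo]
    filter_upwards [hw.ae_mem, hS', h.ae_sobolev_lt_top] with τ h1 h2 h3 hτ
    have hτI : τ ∈ Icc a b := ⟨by linarith [hτ.1], by linarith [hτ.2]⟩
    have hτI' : τ - l₀ ∈ Icc a b := ⟨by linarith [hτ.1], by linarith [hτ.2]⟩
    have s1 := h1 hτI
    have s2 := h2 hτI'
    have hone := h.testing_estimate hη.meas hη.nonneg hη.le_one hw.kernel_meas hw.kernel_lower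
      hw.kernel_upper hε hτI'.1 (by linarith) hτI.2 (h3 hτI)
      ((hw.bound _ s2).trans_lt ENNReal.ofReal_lt_top)
      ((hw.bound _ s1).trans_lt ENNReal.ofReal_lt_top)
      (hw.weak _ s2 _ s1 hτI'.1 (by linarith) hτI.2 _
        (h.isSpatialProfile_truncTest hη.nonneg hη.le_one (h3 hτI))
        (h.truncTest_le hη.nonneg hη.le_one τ))
      (hω τ s1 _ s2 (by rw [sub_sub_cancel, abs_of_pos hl₀]))
    refine hone.trans (le_of_eq ?_)
    simp only [Φ]
    rw [lintegral_add_right _ (mT.const_mul _), lintegral_const_mul _ mT]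
    ring
  have main := lintegral_mono_ae step
  rw [lintegral_add_left (by fun_prop), lintegral_add_left (by fun_prop),
    lintegral_const_mul' _ _ ENNReal.ofReal_ne_top, lintegral_lintegral_Ioc_eq mΓ,
    lintegral_lintegral_Ioc_eq mΦ] at main
  -- lower bound for the good terms
  have hΓ : ENNReal.ofReal l₀ * (∫⁻ t in Ioo c₂ (τ₂ - l₀), goodForm s (Metric.ball x₀ r) κ v t)
      ≤ ∫⁻ l in Ico 0 l₀, ∫⁻ τ in Ioo c₁ τ₂, Γ (τ - l) τ := by
    have : ∀ l ∈ Ico 0 l₀, (∫⁻ t in Ioo c₂ (τ₂ - l₀), goodForm s (Metric.ball x₀ r) κ v t)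
        ≤ ∫⁻ τ in Ioo c₁ τ₂, Γ (τ - l) τ := by
      intro l hl
      simp only [Γ]
      rw [setLIntegral_Ioo_comp_sub (fun t => ENNReal.ofReal (η t) *
        goodForm s (Metric.ball x₀ r) κ v t)]
      calc _ = ∫⁻ t in Ioo c₂ (τ₂ - l₀), ENNReal.ofReal (η t) *
              goodForm s (Metric.ball x₀ r) κ v t := by
            refine setLIntegral_congr_fun measurableSet_Ioo fun t ht => ?_
            simp only [hη.one t ht.1.le, ENNReal.ofReal_one, one_mul]
        _ ≤ _ := lintegral_mono_set
            (Ioo_subset_Ioo (by linarith [hl.1]) (by linarith [hl.2]))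
    calc _ = ∫⁻ _l in Ico 0 l₀,
          (∫⁻ t in Ioo c₂ (τ₂ - l₀), goodForm s (Metric.ball x₀ r) κ v t) := by
          rw [setLIntegral_const, Real.volume_Ico, sub_zero, mul_comm]
      _ ≤ _ := setLIntegral_mono' measurableSet_Ico this
  -- upper bound for the error terms
  have hsub : ∀ l ∈ Ico 0 l₀, Ioo (c₁ - l) (τ₂ - l) ⊆ Ioo α τ₂ := fun l hl =>
    Ioo_subset_Ioo (by linarith [hl.2]) (by linarith [hl.1])
  have hΦ : (∫⁻ l in Ico 0 l₀, ∫⁻ τ in Ioo c₁ τ₂, Φ (τ - l) τ) ≤ ENNReal.ofReal l₀ *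
        (ENNReal.ofReal L * (∫⁻ t in Ioo α τ₂, badForm s B κ ζ v t)
          + ENNReal.ofReal (ε * L) * (∫⁻ t in Ioo α τ₂, gagliardoProd s B (fun x => v x t))
          + ENNReal.ofReal (L / (4 * ε)) * E
          + c' * ω * (∫⁻ t in Ioo α τ₂, farTail s B x₀ v t)) := by
    refine (setLIntegral_mono' measurableSet_Ico (g := fun _ =>
        (ENNReal.ofReal L * (∫⁻ t in Ioo α τ₂, badForm s B κ ζ v t)
          + ENNReal.ofReal (ε * L) * (∫⁻ t in Ioo α τ₂, gagliardoProd s B (fun x => v x t))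
          + ENNReal.ofReal (L / (4 * ε)) * E
          + c' * ω * (∫⁻ t in Ioo α τ₂, farTail s B x₀ v t))) fun l hl => ?_).trans ?_
    · simp only [Φ]
      have ms : Measurable fun τ : ℝ => τ - l := by fun_prop
      have o1 : Measurable fun τ => badForm s B κ ζ v (τ - l) := mBad.comp ms
      have o2 : Measurable fun τ => gagliardoProd s B (fun x => v x (τ - l)) := mV.comp ms
      have o3 : Measurable fun τ => farTail s B x₀ v (τ - l) := mT.comp ms
      have n1 : Measurable fun τ => ENNReal.ofReal L * badForm s B κ ζ v (τ - l) :=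
        o1.const_mul _
      have n2 : Measurable fun τ => ENNReal.ofReal (ε * L) *
          gagliardoProd s B (fun x => v x (τ - l)) :=
        o2.const_mul _
      have n12 : Measurable fun τ => ENNReal.ofReal L * badForm s B κ ζ v (τ - l)
          + ENNReal.ofReal (ε * L) * gagliardoProd s B (fun x => v x (τ - l)) := n1.add n2
      have n3 : Measurable fun τ => c' * ω * farTail s B x₀ v (τ - l) :=
        o3.const_mul _
      rw [lintegral_add_right _ n3, lintegral_add_left n12, lintegral_add_left n1,
        lintegral_const_mul _ o1, lintegral_const_mul _ o2, lintegral_const_mul _ o3,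
        lintegral_const_mul' _ _ ENNReal.ofReal_ne_top,
        setLIntegral_Ioo_comp_sub (badForm s B κ ζ v),
        setLIntegral_Ioo_comp_sub (fun t => gagliardoProd s B (fun x => v x t)),
        setLIntegral_Ioo_comp_sub (farTail s B x₀ v)]
      have h1 := hsub l hl
      have h2 := hE l hl
      exact add_le_add (add_le_add (add_le_add
        (mul_le_mul_right (lintegral_mono_set h1) _) (mul_le_mul_right (lintegral_mono_set h1) _))
        (mul_le_mul_right h2 _)) (mul_le_mul_right (lintegral_mono_set h1) _)
    · rw [setLIntegral_const, Real.volume_Ico, sub_zero, mul_comm]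
  calc _ ≤ _ := by
        refine add_le_add le_rfl ?_
        rw [mul_left_comm]
        exact mul_le_mul_right hΓ _
    _ ≤ _ := main
    _ ≤ _ := add_le_add le_rfl hΦ

end LevelSetup

/-- Shifting by `l₀` moves the difference onto the cutoff, `η(t + l₀) ≤ η(t) + l₀ β`. The strip
before `c₁` contributes nothing to the first term because `η` vanishes there. -/
theorem TimeCut.telescope {η : ℝ → ℝ} {c₁ c₂ β : ℝ} (hη : TimeCut η c₁ c₂ β) {F : ℝ → ℝ≥0∞}
    (hF : Measurable F) {α τ₂ l₀ : ℝ} (hαc : α ≤ c₁ - l₀) (hl₀ : 0 < l₀) :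
    (∫⁻ τ in Ioo c₁ τ₂, ENNReal.ofReal (η τ) * F (τ - l₀))
      ≤ (∫⁻ t in Ioo c₁ (τ₂ - l₀), ENNReal.ofReal (η t) * F t)
        + ENNReal.ofReal l₀ * (ENNReal.ofReal β * ∫⁻ t in Ioo α τ₂, F t) := by
  have mη := hη.meas
  have e : (∫⁻ τ in Ioo c₁ τ₂, ENNReal.ofReal (η τ) * F (τ - l₀))
      = ∫⁻ t in Ioo (c₁ - l₀) (τ₂ - l₀), ENNReal.ofReal (η (t + l₀)) * F t := by
    rw [← setLIntegral_Ioo_comp_sub (fun t => ENNReal.ofReal (η (t + l₀)) * F t)]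
    simp only [sub_add_cancel]
  calc _ = _ := e
    _ ≤ ∫⁻ t in Ioo (c₁ - l₀) (τ₂ - l₀), (ENNReal.ofReal (η t) * F t
          + ENNReal.ofReal l₀ * (ENNReal.ofReal β * F t)) := by
        refine lintegral_mono fun t => ?_
        rw [← mul_assoc, ← add_mul, ← ENNReal.ofReal_mul hl₀.le,
          ← ENNReal.ofReal_add (hη.nonneg t) (mul_nonneg hl₀.le hη.slope_nonneg)]
        gcongr
        exact hη.slope t l₀ hl₀.le
    _ = (∫⁻ t in Ioo (c₁ - l₀) (τ₂ - l₀), ENNReal.ofReal (η t) * F t)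
        + ENNReal.ofReal l₀ * (ENNReal.ofReal β * ∫⁻ t in Ioo (c₁ - l₀) (τ₂ - l₀), F t) := by
        rw [lintegral_add_left (by fun_prop), lintegral_const_mul' _ _ ENNReal.ofReal_ne_top,
          lintegral_const_mul' _ _ ENNReal.ofReal_ne_top]
    _ ≤ _ := by
        refine add_le_add ?_ (mul_le_mul_right (mul_le_mul_right (lintegral_mono_set
          (Ioo_subset_Ioo hαc (by linarith))) _) _)
        rw [← lintegral_indicator measurableSet_Ioo, ← lintegral_indicator measurableSet_Ioo]
        refine lintegral_mono fun t => ?_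
        by_cases ht : t ∈ Ioo (c₁ - l₀) (τ₂ - l₀)
        · rw [indicator_of_mem ht]
          rcases le_or_gt t c₁ with h1 | h1
          · simp [hη.zero t h1]
          · rw [indicator_of_mem (by exact ⟨h1, ht.2⟩)]
        · rw [indicator_of_notMem ht]; exact zero_le

namespace LevelSetup

variable {N : ℕ} {s q L r ρ' R A a b : ℝ} {x₀ : RN N} {κ : ℝ → ℝ} {ζ : RN N → ℝ}
  {v : RN N → ℝ → ℝ}

/-- The weighted energies on `(c₁, τ₂ - l₀)` cancel. On the left remains the integral over the last
step, at least `l₀ c₀` because there `η = 1` and the energy is at least `c₀`; every other term also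
has a factor `l₀`, which is divided out. -/
theorem integrated_testing_estimate (h : LevelSetup s q L r ρ' R A a b x₀ κ ζ v) {M : ℝ}
    {K : RN N → RN N → ℝ → ℝ} {S : Set ℝ} (hw : WeakData s q L ρ' R a b M x₀ v K S)
    {η : ℝ → ℝ} {c₁ c₂ β : ℝ} (hη : TimeCut η c₁ c₂ β) {α τ₂ l₀ ε : ℝ} {ω E c₀ : ℝ≥0∞}
    (hα : a ≤ α) (hαc : α ≤ c₁ - l₀) (hl₀ : 0 < l₀) (hc : c₁ ≤ c₂) (hτ₂ : c₂ ≤ τ₂ - l₀)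
    (hb : τ₂ ≤ b) (hε : 0 < ε)
    (hω : ∀ t ∈ S, ∀ t' ∈ S, |t - t'| ≤ l₀ →
      ∫⁻ x in Metric.ball x₀ R, ENNReal.ofReal |v x t - v x t'| ≤ ω)
    (hE : ∀ l ∈ Ico 0 l₀, ∫⁻ τ in Ioo c₁ τ₂, gagliardoProd s (Metric.ball x₀ R) (fun x =>
        truncTest η κ ζ v τ x - truncTest η κ ζ v (τ - l) x) ≤ E)
    (hc₀ : ∀ t ∈ S, τ₂ - l₀ < t → t < τ₂ → c₀ ≤ cutEnergy q (Metric.ball x₀ R) κ ζ v t) :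
    c₀ + ENNReal.ofReal L⁻¹ *
        (∫⁻ t in Ioo c₂ (τ₂ - l₀), goodForm s (Metric.ball x₀ r) κ v t)
    ≤ ENNReal.ofReal β * (∫⁻ t in Ioo α τ₂, cutEnergy q (Metric.ball x₀ R) κ ζ v t)
      + (ENNReal.ofReal L * (∫⁻ t in Ioo α τ₂, badForm s (Metric.ball x₀ R) κ ζ v t)
          + ENNReal.ofReal (ε * L) *
            (∫⁻ t in Ioo α τ₂, gagliardoProd s (Metric.ball x₀ R) (fun x => v x t))
          + ENNReal.ofReal (L / (4 * ε)) * E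
          + ENNReal.ofReal (2 * L * (R / (R - ρ')) ^ ((N : ℝ) + 2 * s)) * ω *
            (∫⁻ t in Ioo α τ₂, farTail s (Metric.ball x₀ R) x₀ v t)) := by
  have main := h.integrated_testing_estimate_aux hw hη hα hαc hl₀ hc hb hε hω hE
  have mF := h.measurable_cutEnergy (Metric.ball x₀ R)
  have tel := hη.telescope mF (τ₂ := τ₂) hαc hl₀
  set B := Metric.ball x₀ R with hB
  set G := ENNReal.ofReal L⁻¹ *
    (∫⁻ t in Ioo c₂ (τ₂ - l₀), goodForm s (Metric.ball x₀ r) κ v t)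
  set Y := ENNReal.ofReal L * (∫⁻ t in Ioo α τ₂, badForm s B κ ζ v t)
          + ENNReal.ofReal (ε * L) * (∫⁻ t in Ioo α τ₂, gagliardoProd s B (fun x => v x t))
          + ENNReal.ofReal (L / (4 * ε)) * E
          + ENNReal.ofReal (2 * L * (R / (R - ρ')) ^ ((N : ℝ) + 2 * s)) * ω *
            (∫⁻ t in Ioo α τ₂, farTail s B x₀ v t)
  set Z := ENNReal.ofReal β * (∫⁻ t in Ioo α τ₂, cutEnergy q B κ ζ v t)
  set U := ∫⁻ t in Ioo c₁ (τ₂ - l₀), ENNReal.ofReal (η t) * cutEnergy q B κ ζ v t with hU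
  -- The energy is bounded uniformly over good times by `M`, so the telescoped part is finite and
  -- may be subtracted.
  have hUtop : U ≠ ∞ := by
    refine ne_of_lt (lt_of_le_of_lt (setLIntegral_mono_ae (g := fun _ => ENNReal.ofReal M)
      measurable_const.aemeasurable ?_) ?_)
    · filter_upwards [hw.ae_mem] with t ht htI
      have : t ∈ S := ht ⟨by linarith [htI.1], by linarith [htI.2]⟩
      calc ENNReal.ofReal (η t) * cutEnergy q B κ ζ v t ≤ 1 * ENNReal.ofReal M := by
            gcongr
            · rw [← ENNReal.ofReal_one]; exact ENNReal.ofReal_le_ofReal (hη.le_one t)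
            · exact (h.cutEnergy_le t B).trans (hw.bound t this)
        _ = _ := one_mul _
    · rw [setLIntegral_const]
      exact ENNReal.mul_lt_top ENNReal.ofReal_lt_top (by simp)
  have hlow : U + ENNReal.ofReal l₀ * c₀
      ≤ ∫⁻ τ in Ioo c₁ τ₂, ENNReal.ofReal (η τ) * cutEnergy q B κ ζ v τ := by
    have h1 : ENNReal.ofReal l₀ * c₀
        ≤ ∫⁻ τ in Ioo (τ₂ - l₀) τ₂, ENNReal.ofReal (η τ) * cutEnergy q B κ ζ v τ := by
      calc ENNReal.ofReal l₀ * c₀ = ∫⁻ _ in Ioo (τ₂ - l₀) τ₂, c₀ := by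
            rw [setLIntegral_const, Real.volume_Ioo, sub_sub_cancel, mul_comm]
        _ ≤ _ := by
            refine setLIntegral_mono_ae (hη.meas.ennreal_ofReal.mul mF).aemeasurable ?_
            filter_upwards [hw.ae_mem] with t ht htI
            have : t ∈ S := ht ⟨by linarith [htI.1], by linarith [htI.2]⟩
            rw [hη.one t (by linarith [htI.1]), ENNReal.ofReal_one, one_mul]
            exact hc₀ t this htI.1 htI.2
    calc _ ≤ _ := add_le_add le_rfl h1
      _ = ∫⁻ τ in Ioo c₁ (τ₂ - l₀) ∪ Ioo (τ₂ - l₀) τ₂,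
          ENNReal.ofReal (η τ) * cutEnergy q B κ ζ v τ := by
          rw [lintegral_union measurableSet_Ioo]
          rw [Set.disjoint_left]
          intro t h1 h2
          linarith [h1.2, h2.1]
      _ ≤ _ := lintegral_mono_set (union_subset (Ioo_subset_Ioo le_rfl (by linarith))
          (Ioo_subset_Ioo (by linarith) le_rfl))
  have hl : ENNReal.ofReal l₀ ≠ 0 := by simpa using hl₀
  rw [← ENNReal.mul_le_mul_iff_right hl ENNReal.ofReal_ne_top]
  refine (ENNReal.add_le_add_iff_left hUtop).1 ?_
  calc U + ENNReal.ofReal l₀ * (c₀ + G) = (U + ENNReal.ofReal l₀ * c₀) + ENNReal.ofReal l₀ * G := by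
        ring
    _ ≤ _ := add_le_add hlow le_rfl
    _ ≤ _ := main
    _ ≤ _ := add_le_add tel le_rfl
    _ = _ := by ring

/-- The energy estimate after letting the time step tend to zero. -/
theorem energy_estimate (h : LevelSetup s q L r ρ' R A a b x₀ κ ζ v) {M : ℝ}
    {K : RN N → RN N → ℝ → ℝ} {S : Set ℝ} (hw : WeakData s q L ρ' R a b M x₀ v K S)
    {η : ℝ → ℝ} {c₁ c₂ β : ℝ} (hη : TimeCut η c₁ c₂ β) {α τ₂ δ₀ : ℝ} {c₀ : ℝ≥0∞}
    (hα : a ≤ α) (hαc : α < c₁) (hc : c₁ ≤ c₂) (hτ₂ : c₂ < τ₂) (hb : τ₂ ≤ b) (hδ₀ : 0 < δ₀)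
    (hc₀ : ∀ t ∈ S, τ₂ - δ₀ < t → t < τ₂ → c₀ ≤ cutEnergy q (Metric.ball x₀ R) κ ζ v t) :
    c₀ + ENNReal.ofReal L⁻¹ *
        (∫⁻ t in Ioo c₂ (τ₂ - δ₀), goodForm s (Metric.ball x₀ r) κ v t)
    ≤ ENNReal.ofReal β * (∫⁻ t in Ioo α τ₂, cutEnergy q (Metric.ball x₀ R) κ ζ v t)
      + ENNReal.ofReal L * (∫⁻ t in Ioo α τ₂, badForm s (Metric.ball x₀ R) κ ζ v t) := by
  have hL0 : 0 < L := by linarith [h.one_le]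
  refine ENNReal.le_of_forall_pos_le_add fun e he _ => ?_
  set B := Metric.ball x₀ R with hB
  set c' := ENNReal.ofReal (2 * L * (R / (R - ρ')) ^ ((N : ℝ) + 2 * s)) with hc'
  set V := ∫⁻ t in Ioo α τ₂, gagliardoProd s B (fun x => v x t) with hV
  set T := ∫⁻ t in Ioo α τ₂, farTail s B x₀ v t with hT
  have hVtop : V ≠ ∞ := by
    refine ne_of_lt (lt_of_le_of_lt ?_ h.sobolev)
    refine (lintegral_mono_set (Ioo_subset_Icc_self.trans (Icc_subset_Icc hα hb))).trans ?_
    exact lintegral_mono fun t => le_add_self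
  have hTtop : T ≠ ∞ := ne_of_lt (lt_of_le_of_lt (lintegral_mono_set Ioo_subset_Ioc_self)
    (h.lintegral_farTail_lt_top hα (by linarith) hb))
  -- One third of the tolerance for each error. The order matters: `ε₁` makes `ε₁ L` times the
  -- Sobolev energy small, then `ε₂` is chosen against the resulting large factor `L/(4ε₁)`; `ω₀`
  -- handles the tail error separately.
  set δ : ℝ := e / 3 with hδ
  have hδ0 : 0 < δ := by have : (0 : ℝ) < e := he; positivity
  set ε₁ : ℝ := δ / (V.toReal + 1) / L with hε₁
  have hV0 : 0 ≤ V.toReal := ENNReal.toReal_nonneg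
  have hε₁0 : 0 < ε₁ := by positivity
  set ε₂ : ℝ := δ * (4 * ε₁) / L with hε₂
  have hε₂0 : 0 < ε₂ := by positivity
  set ω₀ : ℝ := δ / ((c' * T).toReal + 1) with hω₀
  have hcT0 : 0 ≤ (c' * T).toReal := ENNReal.toReal_nonneg
  have hω₀0 : 0 < ω₀ := by positivity
  obtain ⟨h₀, hh₀, H⟩ := h.exists_lintegral_gagliardoProd_translate_le hη.meas hη.nonneg hη.le_one
    hε₂0
  obtain ⟨δ₁, hδ₁, Hm⟩ := hw.modulus ω₀ hω₀0
  -- Half the minimum, so that all five constraints on the step hold strictly: translation error,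
  -- `L¹` modulus, room before `c₁`, room after `c₂`, and the window `δ₀` on which the lower bound
  -- `c₀` is known.
  set l₀ : ℝ := min (min h₀ δ₁) (min (min (c₁ - α) (τ₂ - c₂)) δ₀) / 2 with hl₀
  have hm0 : 0 < min (min h₀ δ₁) (min (min (c₁ - α) (τ₂ - c₂)) δ₀) := by
    simp only [lt_min_iff]; exact ⟨⟨hh₀, hδ₁⟩, ⟨by linarith, by linarith⟩, hδ₀⟩
  have hl0 : 0 < l₀ := by positivity
  have hlt : l₀ < min (min h₀ δ₁) (min (min (c₁ - α) (τ₂ - c₂)) δ₀) := half_lt_self hm0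
  simp only [lt_min_iff] at hlt
  obtain ⟨⟨l1, l2⟩, ⟨l3, l4⟩, l5⟩ := hlt
  have main := h.integrated_testing_estimate hw hη (ω := ENNReal.ofReal ω₀) (E := ENNReal.ofReal ε₂) (c₀ := c₀)
    (l₀ := l₀) (τ₂ := τ₂) hα (by linarith) hl0 hc (by linarith) hb hε₁0
    (fun t ht t' ht' htt => Hm t ht t' ht' (htt.trans_lt l2))
    (fun l hl => H l (by rw [abs_of_nonneg hl.1]; exact hl.2.trans l1) c₁ τ₂ (by linarith)
      (by linarith [hl.2]) hb (by linarith [hl.1]))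
    (fun t ht h1 h2 => hc₀ t ht (by linarith) h2)
  have b1 : ENNReal.ofReal (ε₁ * L) * V ≤ ENNReal.ofReal δ := by
    rw [← ENNReal.ofReal_toReal hVtop, ← ENNReal.ofReal_mul (by positivity)]
    refine ENNReal.ofReal_le_ofReal ?_
    rw [hε₁, div_mul_cancel₀ _ hL0.ne', div_mul_eq_mul_div, div_le_iff₀ (by positivity)]
    nlinarith
  have b2 : ENNReal.ofReal (L / (4 * ε₁)) * ENNReal.ofReal ε₂ ≤ ENNReal.ofReal δ := by
    rw [← ENNReal.ofReal_mul (by positivity)]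
    refine ENNReal.ofReal_le_ofReal (le_of_eq ?_)
    rw [hε₂]; field_simp
  have b3 : c' * ENNReal.ofReal ω₀ * T ≤ ENNReal.ofReal δ := by
    have hcT : c' * T ≠ ∞ := by finiteness
    rw [mul_right_comm, ← ENNReal.ofReal_toReal hcT, ← ENNReal.ofReal_mul hcT0]
    refine ENNReal.ofReal_le_ofReal ?_
    rw [hω₀, mul_div_assoc', div_le_iff₀ (by positivity)]
    nlinarith
  have he' : ENNReal.ofReal δ + ENNReal.ofReal δ + ENNReal.ofReal δ = e := by
    rw [← ENNReal.ofReal_add hδ0.le hδ0.le, ← ENNReal.ofReal_add (by positivity) hδ0.le, hδ]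
    rw [show (e : ℝ) / 3 + e / 3 + e / 3 = e by ring, ENNReal.ofReal_coe_nnreal]
  set X₁ := ENNReal.ofReal β * (∫⁻ t in Ioo α τ₂, cutEnergy q B κ ζ v t)
  set X₂ := ENNReal.ofReal L * (∫⁻ t in Ioo α τ₂, badForm s B κ ζ v t)
  calc _ ≤ c₀ + ENNReal.ofReal L⁻¹ *
        (∫⁻ t in Ioo c₂ (τ₂ - l₀), goodForm s (Metric.ball x₀ r) κ v t) :=
        add_le_add le_rfl (mul_le_mul_right (lintegral_mono_set
          (Ioo_subset_Ioo le_rfl (by linarith))) _)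
    _ ≤ _ := main
    _ ≤ X₁ + (X₂ + ENNReal.ofReal δ + ENNReal.ofReal δ + ENNReal.ofReal δ) :=
        add_le_add le_rfl (add_le_add (add_le_add (add_le_add le_rfl b1) b2) b3)
    _ = X₁ + X₂ + (ENNReal.ofReal δ + ENNReal.ofReal δ + ENNReal.ofReal δ) := by ring
    _ = _ := by rw [he']

end LevelSetup

/-! ### The commutator of the spatial cutoff -/

/-- If both points lie in `B_ρ`, the Lipschitz bound on `ζ` gains `|x - y|²` and the product `w(x)
w(y)` is split into squares. If exactly one does, the commutator vanishes unless that point lies in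
the support of `ζ`, at distance at least `(ρ - r)/2` from the other, so the kernel is bounded. If
neither does, both values of `ζ` are zero. -/
theorem badForm_pointwise {N : ℕ} {s r ρ R : ℝ} (hs : 0 < s) (hrρ : r < ρ)
    {x₀ : RN N} {ζ : RN N → ℝ} (hζ0 : ∀ x, 0 ≤ ζ x) (hζ1 : ∀ x, ζ x ≤ 1)
    (hζz : ∀ x, (r + ρ) / 2 < ‖x - x₀‖ → ζ x = 0)
    (hζl : ∀ x y, |ζ x - ζ y| ≤ 2 / (ρ - r) * ‖x - y‖)
    {w : RN N → ℝ} (hw0 : ∀ x, 0 ≤ w x) {p : RN N × RN N}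
    (hp : p ∈ Metric.ball x₀ R ×ˢ Metric.ball x₀ R) :
    ENNReal.ofReal (w p.1 * w p.2 * (ζ p.1 - ζ p.2) ^ 2 / ‖p.1 - p.2‖ ^ ((N : ℝ) + 2 * s))
    ≤ (Metric.ball x₀ ρ ×ˢ Metric.ball x₀ ρ).indicator (fun p =>
          ENNReal.ofReal (2 / (ρ - r) ^ 2) * (ENNReal.ofReal (w p.1 ^ 2) *
            ENNReal.ofReal (‖p.1 - p.2‖ ^ 2 / ‖p.1 - p.2‖ ^ ((N : ℝ) + 2 * s)))
          + ENNReal.ofReal (2 / (ρ - r) ^ 2) * (ENNReal.ofReal (w p.2 ^ 2) *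
            ENNReal.ofReal (‖p.2 - p.1‖ ^ 2 / ‖p.2 - p.1‖ ^ ((N : ℝ) + 2 * s)))) p
        + ((Metric.ball x₀ ρ ×ˢ Metric.ball x₀ R).indicator (fun p =>
            (ENNReal.ofReal ((2 / (ρ - r)) ^ ((N : ℝ) + 2 * s)) * ENNReal.ofReal (w p.1))
              * ENNReal.ofReal (w p.2)) p
          + (Metric.ball x₀ R ×ˢ Metric.ball x₀ ρ).indicator (fun p =>
            ENNReal.ofReal (w p.1) * (ENNReal.ofReal ((2 / (ρ - r)) ^ ((N : ℝ) + 2 * s))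
              * ENNReal.ofReal (w p.2))) p) := by
  obtain ⟨x, y⟩ := p
  obtain ⟨hx, hy⟩ := hp
  simp only at hx hy
  have hd : 0 < ρ - r := by linarith
  set d : ℝ := (N : ℝ) + 2 * s with hdd
  have hd0 : 0 ≤ d := by positivity
  have hwx := hw0 x
  have hwy := hw0 y
  have hfar : ∀ x y, x ∈ Metric.ball x₀ ρ → y ∉ Metric.ball x₀ ρ →
      (ζ x - ζ y) ^ 2 / ‖x - y‖ ^ d ≤ (2 / (ρ - r)) ^ d := by
    intro x y hx hy
    have hy' : ρ ≤ ‖y - x₀‖ := by simpa [dist_eq_norm] using hy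
    have hζy : ζ y = 0 := hζz y (by linarith)
    rw [hζy, sub_zero]
    rcases lt_or_ge ((r + ρ) / 2) ‖x - x₀‖ with h1 | h1
    · rw [hζz x h1]; simp; positivity
    · have h2 : ‖y - x₀‖ ≤ ‖x - y‖ + ‖x - x₀‖ := by
        rw [norm_sub_rev x y]; simpa using norm_add_le (y - x) (x - x₀)
      have h3 : (ρ - r) / 2 ≤ ‖x - y‖ := by linarith
      have h4 : 0 < ‖x - y‖ := by linarith
      have h5 : ζ x ^ 2 ≤ 1 := pow_le_one₀ (hζ0 x) (hζ1 x)
      calc ζ x ^ 2 / ‖x - y‖ ^ d ≤ 1 / ((ρ - r) / 2) ^ d := by gcongr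
        _ = (2 / (ρ - r)) ^ d := by
            rw [one_div, ← Real.inv_rpow (by positivity), inv_div]
  have hnear : ∀ x y, (ζ x - ζ y) ^ 2 ≤ 4 / (ρ - r) ^ 2 * ‖x - y‖ ^ 2 := fun x y => by
    calc (ζ x - ζ y) ^ 2 = |ζ x - ζ y| ^ 2 := (sq_abs _).symm
      _ ≤ (2 / (ρ - r) * ‖x - y‖) ^ 2 := by gcongr; exact hζl x y
      _ = _ := by rw [mul_pow, div_pow]; norm_num
  by_cases hx' : x ∈ Metric.ball x₀ ρ <;> by_cases hy' : y ∈ Metric.ball x₀ ρ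
  · refine le_add_right ?_
    rw [indicator_of_mem (by exact ⟨hx', hy'⟩)]
    dsimp only
    rw [← ENNReal.ofReal_mul (by positivity), ← ENNReal.ofReal_mul (by positivity),
      ← ENNReal.ofReal_mul (by positivity), ← ENNReal.ofReal_mul (by positivity),
      ← ENNReal.ofReal_add (by positivity) (by positivity)]
    refine ENNReal.ofReal_le_ofReal ?_
    rw [norm_sub_rev y x]
    have h1 : w x * w y ≤ (w x ^ 2 + w y ^ 2) / 2 := by nlinarith [sq_nonneg (w x - w y)]
    calc w x * w y * (ζ x - ζ y) ^ 2 / ‖x - y‖ ^ d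
        ≤ ((w x ^ 2 + w y ^ 2) / 2) * (4 / (ρ - r) ^ 2 * ‖x - y‖ ^ 2) / ‖x - y‖ ^ d := by
          gcongr
          exact hnear x y
      _ = _ := by ring
  · refine le_add_left (le_add_right ?_)
    rw [indicator_of_mem (by exact ⟨hx', hy⟩)]
    dsimp only
    rw [← ENNReal.ofReal_mul (by positivity), ← ENNReal.ofReal_mul (by positivity)]
    refine ENNReal.ofReal_le_ofReal ?_
    calc _ = w x * w y * ((ζ x - ζ y) ^ 2 / ‖x - y‖ ^ d) := by ring
      _ ≤ w x * w y * (2 / (ρ - r)) ^ d := by gcongr; exact hfar x y hx' hy'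
      _ = _ := by ring
  · refine le_add_left (le_add_left ?_)
    rw [indicator_of_mem (by exact ⟨hx, hy'⟩)]
    dsimp only
    rw [← ENNReal.ofReal_mul (by positivity), ← ENNReal.ofReal_mul (by positivity)]
    refine ENNReal.ofReal_le_ofReal ?_
    have := hfar y x hy' hx'
    rw [norm_sub_rev] at this
    calc _ = w x * w y * ((ζ y - ζ x) ^ 2 / ‖x - y‖ ^ d) := by ring
      _ ≤ w x * w y * (2 / (ρ - r)) ^ d := by gcongr
      _ = _ := by ring
  · have h1 : ρ ≤ ‖x - x₀‖ := by simpa [dist_eq_norm] using hx'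
    have h2 : ρ ≤ ‖y - x₀‖ := by simpa [dist_eq_norm] using hy'
    simp [hζz x (by linarith), hζz y (by linarith)]

theorem lintegral_ball_prod_kernel_le {N : ℕ} {s C ρ : ℝ} {x₀ : RN N}
    (hC : ∀ (x₀ x : RN N) (ρ : ℝ), x ∈ Metric.ball x₀ ρ →
      ∫⁻ y in Metric.ball x₀ ρ, ENNReal.ofReal (‖x - y‖ ^ 2 / ‖x - y‖ ^ ((N : ℝ) + 2 * s))
        ≤ ENNReal.ofReal (C * ρ ^ (2 * (1 - s)))) {w : RN N → ℝ} (hw : Measurable w) :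
    ∫⁻ p in Metric.ball x₀ ρ ×ˢ Metric.ball x₀ ρ, (ENNReal.ofReal (w p.1 ^ 2) *
        ENNReal.ofReal (‖p.1 - p.2‖ ^ 2 / ‖p.1 - p.2‖ ^ ((N : ℝ) + 2 * s)))
      ≤ ENNReal.ofReal (C * ρ ^ (2 * (1 - s))) *
        ∫⁻ x in Metric.ball x₀ ρ, ENNReal.ofReal (w x ^ 2) := by
  rw [Measure.volume_eq_prod, ← Measure.prod_restrict, lintegral_prod _ (by fun_prop),
    mul_comm (ENNReal.ofReal (C * _)), ← lintegral_mul_const _ (by fun_prop)]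
  refine setLIntegral_mono' measurableSet_ball fun x hx => ?_
  dsimp only
  rw [lintegral_const_mul _ (by fun_prop)]
  gcongr
  exact hC x₀ x ρ hx

/-- The off-diagonal part keeps the product of the masses over `B_ρ` and over `B_R`: the second
becomes the supremum of averages, the first the integral over the cylinder. Each `2` comes from the
symmetry in `x` and `y`. -/
theorem badForm_le {N : ℕ} {s C r ρ R : ℝ} (hs : 0 < s) (hrρ : r < ρ)
    {x₀ : RN N} (hC : ∀ (x₀ x : RN N) (ρ : ℝ), x ∈ Metric.ball x₀ ρ →
      ∫⁻ y in Metric.ball x₀ ρ, ENNReal.ofReal (‖x - y‖ ^ 2 / ‖x - y‖ ^ ((N : ℝ) + 2 * s))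
        ≤ ENNReal.ofReal (C * ρ ^ (2 * (1 - s))))
    {ζ : RN N → ℝ} (hζ0 : ∀ x, 0 ≤ ζ x) (hζ1 : ∀ x, ζ x ≤ 1)
    (hζz : ∀ x, (r + ρ) / 2 < ‖x - x₀‖ → ζ x = 0)
    (hζl : ∀ x y, |ζ x - ζ y| ≤ 2 / (ρ - r) * ‖x - y‖)
    {v : RN N → ℝ → ℝ} {κ : ℝ → ℝ} {t : ℝ} (hv : Measurable fun x => v x t) :
    badForm s (Metric.ball x₀ R) κ ζ v t
      ≤ 2 * (ENNReal.ofReal (2 / (ρ - r) ^ 2) * (ENNReal.ofReal (C * ρ ^ (2 * (1 - s))) *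
          ∫⁻ x in Metric.ball x₀ ρ, ENNReal.ofReal (max (v x t - κ t) 0 ^ 2)))
        + 2 * (ENNReal.ofReal ((2 / (ρ - r)) ^ ((N : ℝ) + 2 * s)) *
          (∫⁻ x in Metric.ball x₀ ρ, ENNReal.ofReal (max (v x t - κ t) 0)) *
          ∫⁻ x in Metric.ball x₀ R, ENNReal.ofReal (max (v x t - κ t) 0)) := by
  set w : RN N → ℝ := fun x => max (v x t - κ t) 0 with hw
  have mw : Measurable w := by fun_prop
  set d : ℝ := (N : ℝ) + 2 * s with hd
  set Bρ := Metric.ball x₀ ρ with hBρ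
  set B := Metric.ball x₀ R with hB
  have mBρ : MeasurableSet Bρ := measurableSet_ball
  have mB : MeasurableSet B := measurableSet_ball
  set b := ENNReal.ofReal (2 / (ρ - r) ^ 2)
  set c := ENNReal.ofReal ((2 / (ρ - r)) ^ d)
  let g : RN N × RN N → ℝ≥0∞ := fun p => ENNReal.ofReal (w p.1 ^ 2) *
      ENNReal.ofReal (‖p.1 - p.2‖ ^ 2 / ‖p.1 - p.2‖ ^ d)
  have mg : Measurable g := by fun_prop
  have mg' : Measurable fun p : RN N × RN N => g p.swap := mg.comp measurable_swap
  let F : RN N → ℝ≥0∞ := fun x => ENNReal.ofReal (w x)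
  have mF : Measurable F := by fun_prop
  have hle : badForm s B κ ζ v t ≤ ∫⁻ p, ((Bρ ×ˢ Bρ).indicator (fun p => b * g p + b * g p.swap) p
      + ((Bρ ×ˢ B).indicator (fun p => (c * F p.1) * F p.2) p
        + (B ×ˢ Bρ).indicator (fun p => F p.1 * (c * F p.2)) p)) := by
    refine le_trans (setLIntegral_mono' (mB.prod mB) fun p hp => ?_) (setLIntegral_le_lintegral _ _)
    exact badForm_pointwise hs hrρ hζ0 hζ1 hζz hζl (w := w) (fun x => le_max_right _ _) hp
  have n1 : Measurable ((Bρ ×ˢ B).indicator fun p : RN N × RN N => (c * F p.1) * F p.2) :=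
    Measurable.indicator (by fun_prop) (mBρ.prod mB)
  have n2 : Measurable ((B ×ˢ Bρ).indicator fun p : RN N × RN N => F p.1 * (c * F p.2)) :=
    Measurable.indicator (by fun_prop) (mB.prod mBρ)
  have n12 : Measurable fun p => (Bρ ×ˢ B).indicator (fun p : RN N × RN N => (c * F p.1) * F p.2) p
      + (B ×ˢ Bρ).indicator (fun p => F p.1 * (c * F p.2)) p := n1.add n2
  have e1 : ∫⁻ p, (Bρ ×ˢ B).indicator (fun p : RN N × RN N => (c * F p.1) * F p.2) p
      = (∫⁻ x in Bρ, c * F x) * ∫⁻ y in B, F y :=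
    lintegral_indicator_prod_mul mBρ mB (mF.const_mul c) mF
  have e2 : ∫⁻ p, (B ×ˢ Bρ).indicator (fun p : RN N × RN N => F p.1 * (c * F p.2)) p
      = (∫⁻ y in B, F y) * ∫⁻ x in Bρ, c * F x :=
    lintegral_indicator_prod_mul mB mBρ mF (mF.const_mul c)
  have e3 : ∫⁻ p in Bρ ×ˢ Bρ, g p.swap = ∫⁻ p in Bρ ×ˢ Bρ, g p := by
    rw [Measure.volume_eq_prod, ← Measure.prod_restrict]
    exact lintegral_prod_swap g
  have e4 := lintegral_ball_prod_kernel_le hC (x₀ := x₀) (ρ := ρ) mw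
  refine hle.trans ?_
  rw [lintegral_add_right _ n12, lintegral_add_left n1, e1, e2,
    lintegral_indicator (mBρ.prod mBρ), lintegral_add_left (by fun_prop),
    lintegral_const_mul _ mg, lintegral_const_mul _ mg', e3, lintegral_const_mul _ mF, ← two_mul,
    mul_comm (∫⁻ y in B, F y), ← two_mul]
  exact add_le_add (mul_le_mul_right (mul_le_mul_right e4 _) _) le_rfl

/-! ### Measurable representatives and the level function -/

theorem closure_parabolicCylinder {N : ℕ} {R θ : ℝ} (hR : 0 < R) (hθ : 0 < θ) (x₀ : RN N)
    (t₀ : ℝ) : closure (parabolicCylinder R θ x₀ t₀)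
      = Metric.closedBall x₀ R ×ˢ Icc (t₀ - θ) t₀ := by
  rw [parabolicCylinder, closure_prod_eq, closure_ball x₀ hR.ne', closure_Ioo (by linarith)]

theorem closedBall_subset_of_compactlyIn {N : ℕ} {R θ T t₀ : ℝ} {x₀ : RN N} {Ω : Set (RN N)}
    (hR : 0 < R) (hθ : 0 < θ)
    (h : CompactlyIn (parabolicCylinder R θ x₀ t₀) (Ω ×ˢ Ioc 0 T)) :
    Metric.closedBall x₀ R ⊆ Ω ∧ 0 < t₀ - θ ∧ t₀ ≤ T := by
  have h2 := h.2
  rw [closure_parabolicCylinder hR hθ] at h2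
  have hx : x₀ ∈ Metric.closedBall x₀ R := Metric.mem_closedBall_self hR.le
  have h3 : t₀ - θ ∈ Icc (t₀ - θ) t₀ := ⟨le_rfl, by linarith⟩
  have h4 : t₀ ∈ Icc (t₀ - θ) t₀ := ⟨by linarith, le_rfl⟩
  exact ⟨fun x hx => (h2 (mk_mem_prod hx h3)).1, (h2 (mk_mem_prod hx h3)).2.1,
    (h2 (mk_mem_prod hx h4)).2.2⟩

theorem compactlyIn_ball {N : ℕ} {R : ℝ} {x₀ : RN N} {Ω : Set (RN N)} (hR : 0 < R)
    (h : Metric.closedBall x₀ R ⊆ Ω) : CompactlyIn (Metric.ball x₀ R) Ω := by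
  rw [CompactlyIn, closure_ball x₀ hR.ne']
  exact ⟨isCompact_closedBall _ _, h⟩

/-- A function that is a.e. measurable and a.e. nonnegative on `ℝ^N × I` has a measurable and
nonnegative representative, which agrees with it a.e., and a.e. in space
for a.e. time in `I`. -/
theorem exists_measurable_nonneg_representative {N : ℕ} {I : Set ℝ} (hI : MeasurableSet I)
    {u : RN N → ℝ → ℝ}
    (hu : AEMeasurable (fun z : RN N × ℝ => u z.1 z.2) (volume.restrict (univ ×ˢ I)))
    (hpos : ∀ᵐ z : RN N × ℝ ∂(volume.restrict (univ ×ˢ I)), 0 ≤ u z.1 z.2) :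
    ∃ v : RN N → ℝ → ℝ, Measurable (fun z : RN N × ℝ => v z.1 z.2) ∧ (∀ x t, 0 ≤ v x t) ∧
      (∀ᵐ z : RN N × ℝ ∂(volume.restrict (univ ×ˢ I)), v z.1 z.2 = u z.1 z.2) ∧
      ∀ᵐ t : ℝ, t ∈ I → ∀ᵐ x : RN N, v x t = u x t := by
  obtain ⟨f, mf, hf⟩ := hu
  have h1 : ∀ᵐ z : RN N × ℝ ∂(volume.restrict (univ ×ˢ I)), max (f z) 0 = u z.1 z.2 := by
    filter_upwards [hf, hpos] with z h1 h2
    rw [← h1, max_eq_left h2]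
  refine ⟨fun x t => max (f (x, t)) 0, ?_, fun _ _ => le_max_right _ _, h1, ?_⟩
  · exact mf.max measurable_const
  · rw [Measure.volume_eq_prod, ← Measure.prod_restrict, Measure.restrict_univ] at h1
    have h2 := (Measure.measurePreserving_swap (μ := volume.restrict I)
      (ν := (volume : Measure (RN N)))).quasiMeasurePreserving.ae h1
    rw [← ae_restrict_iff' hI]
    exact Measure.ae_ae_of_ae_prod h2

/-- A kernel comparable to `|x-y|^{-(N+2s)}` has a measurable representative with the same bounds,
up to its values on the diagonal. -/
theorem IsKernel.exists_measurable_representative {N : ℕ} {s L T : ℝ} (hL : 1 ≤ L)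
    {K : RN N → RN N → ℝ → ℝ} (hK : IsKernel s L T K) :
    ∃ K' : RN N → RN N → ℝ → ℝ, Measurable (fun z : ℝ × RN N × RN N => K' z.2.1 z.2.2 z.1) ∧
      (∀ x y t, L⁻¹ * (1 / ‖x - y‖ ^ ((N : ℝ) + 2 * s)) ≤ K' x y t) ∧
      (∀ x y t, K' x y t ≤ L * (1 / ‖x - y‖ ^ ((N : ℝ) + 2 * s))) ∧
      ∀ᵐ t : ℝ, t ∈ Ioc 0 T → ∀ᵐ p : RN N × RN N, p.1 ≠ p.2 →
        K' p.1 p.2 t = K p.1 p.2 t := by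
  obtain ⟨K₀, mK₀, h1⟩ := hK.aemeasurable
  have hle : ∀ x y : RN N, L⁻¹ * (1 / ‖x - y‖ ^ ((N : ℝ) + 2 * s))
      ≤ L * (1 / ‖x - y‖ ^ ((N : ℝ) + 2 * s)) := fun x y => by
    have : L⁻¹ ≤ L := (inv_le_one_of_one_le₀ hL).trans hL
    gcongr
  -- Clamping an arbitrary measurable representative between the two bounds makes them hold
  -- everywhere, and changes nothing where they already hold.
  refine ⟨fun x y t => max (L⁻¹ * (1 / ‖x - y‖ ^ ((N : ℝ) + 2 * s)))
    (min (K₀ (x, y, t)) (L * (1 / ‖x - y‖ ^ ((N : ℝ) + 2 * s)))), ?_, fun _ _ _ => le_max_left _ _,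
    fun x y t => max_le (hle x y) (min_le_right _ _), ?_⟩
  · have : Measurable fun z : ℝ × RN N × RN N => K₀ (z.2.1, z.2.2, z.1) :=
      mK₀.comp (by fun_prop)
    fun_prop
  · rw [Measure.volume_eq_prod, ← Measure.prod_restrict, Measure.volume_eq_prod,
      ← Measure.prod_restrict, Measure.restrict_univ] at h1
    have h2 := ((measurePreserving_prodAssoc (volume : Measure (RN N)) (volume : Measure (RN N))
      ((volume : Measure ℝ).restrict (Ioc 0 T))).comp (Measure.measurePreserving_swap
        (μ := (volume : Measure ℝ).restrict (Ioc 0 T))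
        (ν := (volume : Measure (RN N)).prod volume))).quasiMeasurePreserving.ae h1
    have h3 := Measure.ae_ae_of_ae_prod h2
    rw [ae_restrict_iff' measurableSet_Ioc] at h3
    filter_upwards [h3] with t ht hT
    rw [Measure.volume_eq_prod]
    filter_upwards [ht hT] with p hp hne
    have hp' : K p.1 p.2 t = K₀ (p.1, p.2, t) := hp
    have h4 := hK.lower t hT p.1 p.2 hne
    have h5 := hK.upper t hT p.1 p.2 hne
    rw [← hp', mul_one_div, mul_one_div, min_eq_left h5, max_eq_right h4]

theorem gagliardoSq_eq_gagliardoProd {N : ℕ} (s : ℝ) (B : Set (RN N)) {φ : RN N → ℝ}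
    (hφ : Measurable φ) : gagliardoSq s B φ = gagliardoProd s B φ := by
  rw [gagliardoProd, Measure.volume_eq_prod, ← Measure.prod_restrict,
    lintegral_prod _ (by fun_prop)]
  simp only [gagliardoSq, sq_abs]

theorem gagliardoSq_congr_ae {N : ℕ} (s : ℝ) {B : Set (RN N)} {φ ψ : RN N → ℝ}
    (h : ∀ᵐ x ∂(volume.restrict B), φ x = ψ x) : gagliardoSq s B φ = gagliardoSq s B ψ := by
  refine lintegral_congr_ae ?_
  filter_upwards [h] with x hx
  refine lintegral_congr_ae ?_
  filter_upwards [h] with y hy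
  rw [hx, hy]

section level

variable {q k c a b : ℝ} {F kt : ℝ → ℝ}

theorem level_mono_aux (hc : 0 ≤ c) (hF : ∀ t, 0 ≤ F t) (hFi : IntegrableOn F (Icc a b)) {x y : ℝ}
    (hx : a ≤ x) (hxy : x ≤ y) (hy : y ≤ b) :
    0 ≤ c * (∫ τ in a..x, F τ) ∧
      c * (∫ τ in a..y, F τ) - c * (∫ τ in a..x, F τ) = c * ∫ τ in x..y, F τ := by
  have hi : ∀ z w, a ≤ z → z ≤ w → w ≤ b → IntervalIntegrable F volume z w := fun z w h1 h2 h3 =>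
    (intervalIntegrable_iff_integrableOn_Icc_of_le h2).2 (hFi.mono_set (Icc_subset_Icc h1 h3))
  refine ⟨mul_nonneg hc (intervalIntegral.integral_nonneg hx fun t _ => hF t), ?_⟩
  rw [← intervalIntegral.integral_add_adjacent_intervals (hi a x le_rfl hx (hxy.trans hy))
    (hi x y hx hxy hy)]
  ring

theorem level_increment (hq : 1 ≤ q) (hk : 0 < k) (hc : 0 ≤ c) (hF : ∀ t, 0 ≤ F t)
    (hFi : IntegrableOn F (Icc a b))
    (hkt : ∀ t ∈ Icc a b, kt t = k + (c * ∫ τ in a..t, F τ) ^ (1 / q)) {x y : ℝ}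
    (hx : a ≤ x) (hxy : x ≤ y) (hy : y ≤ b) :
    c * (∫ τ in x..y, F τ) ≤ kt y ^ q - kt x ^ q := by
  obtain ⟨h1, h2⟩ := level_mono_aux hc hF hFi hx hxy hy
  have h3 : 0 ≤ c * ∫ τ in x..y, F τ :=
    mul_nonneg hc (intervalIntegral.integral_nonneg hxy fun t _ => hF t)
  rw [← h2, hkt x ⟨hx, hxy.trans hy⟩, hkt y ⟨hx.trans hxy, hy⟩]
  exact sub_le_level_rpow_sub hq hk.le h1 (by linarith)

theorem level_monotoneOn (hq : 1 ≤ q) (hc : 0 ≤ c) (hF : ∀ t, 0 ≤ F t)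
    (hFi : IntegrableOn F (Icc a b))
    (hkt : ∀ t ∈ Icc a b, kt t = k + (c * ∫ τ in a..t, F τ) ^ (1 / q)) :
    MonotoneOn kt (Icc a b) := by
  intro x hx y hy hxy
  obtain ⟨h1, h2⟩ := level_mono_aux hc hF hFi hx.1 hxy hy.2
  have h3 : 0 ≤ c * ∫ τ in x..y, F τ :=
    mul_nonneg hc (intervalIntegral.integral_nonneg hxy fun t _ => hF t)
  rw [hkt x hx, hkt y hy]
  refine add_le_add le_rfl (Real.rpow_le_rpow h1 ?_ (by positivity))
  linarith

theorem le_level (hc : 0 ≤ c) (hF : ∀ t, 0 ≤ F t)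
    (hkt : ∀ t ∈ Icc a b, kt t = k + (c * ∫ τ in a..t, F τ) ^ (1 / q)) {t : ℝ}
    (ht : t ∈ Icc a b) : k ≤ kt t := by
  rw [hkt t ht]
  have : 0 ≤ c * ∫ τ in a..t, F τ :=
    mul_nonneg hc (intervalIntegral.integral_nonneg ht.1 fun t _ => hF t)
  linarith [Real.rpow_nonneg this (1 / q)]

theorem level_continuousOn (hq : 1 ≤ q) (hab : a ≤ b) (hFi : IntegrableOn F (Icc a b))
    (hkt : ∀ t ∈ Icc a b, kt t = k + (c * ∫ τ in a..t, F τ) ^ (1 / q)) :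
    ContinuousOn kt (Icc a b) := by
  have h1 : ContinuousOn (fun t => ∫ τ in a..t, F τ) (Icc a b) := by
    have := intervalIntegral.continuousOn_primitive_interval (f := F) (μ := volume) (a := a) (b := b)
      (by rwa [uIcc_of_le hab])
    rwa [uIcc_of_le hab] at this
  refine ContinuousOn.congr ?_ hkt
  refine continuousOn_const.add ((continuousOn_const.mul h1).rpow_const fun x _ => Or.inr ?_)
  positivity

end level

theorem measurable_farTail {N : ℕ} (s : ℝ) (B : Set (RN N)) (x₀ : RN N) {v : RN N → ℝ → ℝ}
    (hv : Measurable fun z : RN N × ℝ => v z.1 z.2) : Measurable (farTail s B x₀ v) := by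
  have h1 : Measurable fun z : ℝ × RN N => v z.2 z.1 :=
    hv.comp (f := fun z : ℝ × RN N => (z.2, z.1)) (by fun_prop)
  have : Measurable fun z : ℝ × RN N =>
      ENNReal.ofReal (v z.2 z.1 / ‖z.2 - x₀‖ ^ ((N : ℝ) + 2 * s)) :=
    (h1.div (by fun_prop)).ennreal_ofReal
  exact this.lintegral_prod_right'

theorem setIntegral_tail_eq {N : ℕ} {s R t : ℝ} {x₀ : RN N} {u v : RN N → ℝ → ℝ}
    (hv : Measurable fun x => v x t) (h0 : ∀ x, 0 ≤ v x t) (h : ∀ᵐ x : RN N, v x t = u x t) :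
    ∫ x in (Metric.ball x₀ R)ᶜ, u x t / ‖x - x₀‖ ^ ((N : ℝ) + 2 * s)
      = (farTail s (Metric.ball x₀ R) x₀ v t).toReal := by
  rw [farTail, ← integral_eq_lintegral_of_nonneg_ae
    (Eventually.of_forall fun x => div_nonneg (h0 x) (by positivity))
    (by exact (hv.div (by fun_prop)).aestronglyMeasurable)]
  refine integral_congr_ae ?_
  filter_upwards [ae_restrict_of_ae h] with x hx
  rw [hx]

theorem lintegral_farTail_lt_top {N : ℕ} {s R a b : ℝ} (hs : 0 < s) (hR : 0 < R) {x₀ : RN N}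
    {u v : RN N → ℝ → ℝ} (h : ∀ᵐ t : ℝ, t ∈ Icc a b → ∀ᵐ x : RN N, v x t = u x t)
    (htail : ∫⁻ t in Icc a b, ∫⁻ x : RN N,
      ENNReal.ofReal (|u x t| / (1 + ‖x‖ ^ ((N : ℝ) + 2 * s))) < ∞) :
    ∫⁻ t in Icc a b, farTail s (Metric.ball x₀ R) x₀ v t < ∞ := by
  obtain ⟨C, hC, hC'⟩ := exists_one_add_norm_rpow_le (d := (N : ℝ) + 2 * s) (by positivity) x₀ hR
  have key : ∀ᵐ t ∂(volume.restrict (Icc a b)), farTail s (Metric.ball x₀ R) x₀ v t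
      ≤ ENNReal.ofReal C * ∫⁻ x : RN N,
        ENNReal.ofReal (|u x t| / (1 + ‖x‖ ^ ((N : ℝ) + 2 * s))) := by
    rw [ae_restrict_iff' measurableSet_Icc]
    filter_upwards [h] with t ht hti
    rw [← lintegral_const_mul' _ _ ENNReal.ofReal_ne_top, farTail]
    refine le_trans (lintegral_mono_ae ?_) (setLIntegral_le_lintegral (Metric.ball x₀ R)ᶜ _)
    filter_upwards [ae_restrict_mem measurableSet_ball.compl, ae_restrict_of_ae (ht hti)] with y hy hu
    rw [← ENNReal.ofReal_mul hC.le, hu]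
    refine ENNReal.ofReal_le_ofReal ?_
    have h1 := hC' y hy
    have h2 : 0 < 1 + ‖y‖ ^ ((N : ℝ) + 2 * s) := by positivity
    have h3 : 0 < ‖y - x₀‖ ^ ((N : ℝ) + 2 * s) := by
      by_contra hcon
      have : ‖y - x₀‖ ^ ((N : ℝ) + 2 * s) ≤ 0 := not_lt.1 hcon
      nlinarith
    rw [mul_div_assoc', div_le_div_iff₀ h3 h2]
    calc u y t * (1 + ‖y‖ ^ ((N : ℝ) + 2 * s)) ≤ |u y t| * (1 + ‖y‖ ^ ((N : ℝ) + 2 * s)) := by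
          gcongr; exact le_abs_self _
      _ ≤ |u y t| * (C * ‖y - x₀‖ ^ ((N : ℝ) + 2 * s)) := by gcongr
      _ = _ := by ring
  calc _ ≤ _ := lintegral_mono_ae key
    _ < ∞ := by
      rw [lintegral_const_mul' _ _ ENNReal.ofReal_ne_top]
      exact ENNReal.mul_lt_top ENNReal.ofReal_lt_top htail

theorem lintegral_eq_ofReal_intervalIntegral_toReal {a b x y : ℝ} {f : ℝ → ℝ≥0∞} (hf : Measurable f)
    (hfi : ∫⁻ t in Icc a b, f t < ∞) (hx : a ≤ x) (hxy : x ≤ y) (hy : y ≤ b) :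
    ∫⁻ t in Ioc x y, f t = ENNReal.ofReal (∫ t in x..y, (f t).toReal) := by
  have h1 : ∫⁻ t in Ioc x y, f t < ∞ := lt_of_le_of_lt
    (lintegral_mono_set (Ioc_subset_Icc_self.trans (Icc_subset_Icc hx hy))) hfi
  rw [intervalIntegral.integral_of_le hxy, integral_toReal hf.aemeasurable (ae_lt_top hf h1.ne),
    ENNReal.ofReal_toReal h1.ne]

/-- The level function of the Caccioppoli estimate, frozen outside `[a,b]`. -/
theorem exists_level {N : ℕ} {s q L R ρ' θ k t₀ : ℝ} (hs : 0 < s) (hq : 1 < q) (hL : 1 ≤ L)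
    (hR : 0 < R) (hρ : ρ' < R) (hθ : 0 < θ) (hk : 0 < k) {x₀ : RN N} {u v : RN N → ℝ → ℝ}
    (hv : Measurable fun z : RN N × ℝ => v z.1 z.2) (hv0 : ∀ x t, 0 ≤ v x t)
    (h : ∀ᵐ t : ℝ, t ∈ Icc (t₀ - θ) t₀ → ∀ᵐ x : RN N, v x t = u x t)
    (htail : ∫⁻ t in Icc (t₀ - θ) t₀, ∫⁻ x : RN N,
      ENNReal.ofReal (|u x t| / (1 + ‖x‖ ^ ((N : ℝ) + 2 * s))) < ∞)
    {kt : ℝ → ℝ} (hkt : ∀ t, kt t = k + tailLevel s q L R ρ' θ x₀ t₀ u t) :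
    ContinuousOn kt (Icc (t₀ - θ) t₀) ∧ (∀ t ∈ Icc (t₀ - θ) t₀, 0 < kt t) ∧
    ∃ κ : ℝ → ℝ, EqOn κ kt (Icc (t₀ - θ) t₀) ∧ Measurable κ ∧ (∀ t, 0 < κ t) ∧ Monotone κ ∧
      ∀ t₁ t₂, t₀ - θ ≤ t₁ → t₁ ≤ t₂ → t₂ ≤ t₀ →
        ENNReal.ofReal (2 * L * (R / (R - ρ')) ^ ((N : ℝ) + 2 * s)) *
          (∫⁻ t in Ioc t₁ t₂, farTail s (Metric.ball x₀ R) x₀ v t)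
            ≤ ENNReal.ofReal (κ t₂ ^ q - κ t₁ ^ q) := by
  set F : ℝ → ℝ≥0∞ := farTail s (Metric.ball x₀ R) x₀ v with hF
  set c := 2 * L * (R / (R - ρ')) ^ ((N : ℝ) + 2 * s) with hc
  have hc0 : 0 ≤ c := by
    have : 0 < R / (R - ρ') := div_pos hR (by linarith)
    positivity
  have mF : Measurable F := measurable_farTail s _ x₀ hv
  have hFi : ∫⁻ t in Icc (t₀ - θ) t₀, F t < ∞ := lintegral_farTail_lt_top hs hR h htail
  have hFI : IntegrableOn (fun t => (F t).toReal) (Icc (t₀ - θ) t₀) :=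
    integrable_toReal_of_lintegral_ne_top mF.aemeasurable hFi.ne
  have hab : t₀ - θ ≤ t₀ := by linarith
  -- The level is defined through `u`, the estimates run on `v`; agreement of the two tails at
  -- almost every time is enough because the level integrates them in time.
  have hkt' : ∀ t ∈ Icc (t₀ - θ) t₀,
      kt t = k + (c * ∫ τ in (t₀ - θ)..t, (F τ).toReal) ^ (1 / q) := by
    intro t ht
    rw [hkt, tailLevel]
    congr 3
    refine intervalIntegral.integral_congr_ae ?_
    filter_upwards [h] with τ hτ hτi
    rw [uIoc_of_le ht.1] at hτi
    exact setIntegral_tail_eq (hv.comp (f := fun x : RN N => (x, τ)) (by fun_prop))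
      (fun x => hv0 x τ) (hτ ⟨hτi.1.le, hτi.2.trans ht.2⟩)
  have hF0 : ∀ t, 0 ≤ (F t).toReal := fun t => ENNReal.toReal_nonneg
  have hmono := level_monotoneOn hq.le hc0 hF0 hFI hkt'
  have hpos : ∀ t ∈ Icc (t₀ - θ) t₀, 0 < kt t := fun t ht => hk.trans_le (le_level hc0 hF0 hkt' ht)
  refine ⟨level_continuousOn hq.le hab hFI hkt', hpos, ?_⟩
  -- Composition with the projection onto `[t₀ - θ, t₀]` extends monotonicity and positivity to the
  -- whole line; measurability then follows from monotonicity.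
  have heq : EqOn (fun t => kt (projIcc (t₀ - θ) t₀ hab t)) kt (Icc (t₀ - θ) t₀) := fun t ht => by
    dsimp only
    rw [projIcc_of_mem hab ht]
  have hm : Monotone fun t => kt (projIcc (t₀ - θ) t₀ hab t) := fun x y hxy =>
    hmono (projIcc (t₀ - θ) t₀ hab x).2 (projIcc (t₀ - θ) t₀ hab y).2 (monotone_projIcc hab hxy)
  refine ⟨_, heq, hm.measurable, fun t => hpos _ (projIcc (t₀ - θ) t₀ hab t).2, hm, ?_⟩
  intro t₁ t₂ h1 h2 h3
  have e1 := heq ⟨h1, h2.trans h3⟩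
  have e2 := heq ⟨h1.trans h2, h3⟩
  dsimp only at e1 e2
  rw [e1, e2, lintegral_eq_ofReal_intervalIntegral_toReal mF hFi h1 h2 h3, ← ENNReal.ofReal_mul hc0]
  exact ENNReal.ofReal_le_ofReal (level_increment hq.le hk hc0 hF0 hFI hkt' h1 h2 h3)

/-! ### Time-independent test functions and the weak inequality at good times -/

theorem IsSpatialProfile.lintegral_sq_univ_lt_top {N : ℕ} {s ρ' R : ℝ} {x₀ : RN N} {ψ : RN N → ℝ}
    (hR : ρ' < R) (h : IsSpatialProfile s ρ' R x₀ ψ) :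
    ∫⁻ x, ENNReal.ofReal (ψ x ^ 2) < ∞ := by
  have : ∫⁻ x, ENNReal.ofReal (ψ x ^ 2) = ∫⁻ x in Metric.ball x₀ R, ENNReal.ofReal (ψ x ^ 2) := by
    rw [← lintegral_indicator measurableSet_ball]
    refine lintegral_congr fun x => ?_
    by_cases hx : x ∈ Metric.ball x₀ R
    · rw [indicator_of_mem hx]
    · rw [indicator_of_notMem hx, profile_eq_zero_of_notMem hR h.eq_zero hx]
      simp
  rw [this]
  exact h.sq

/-- The global seminorm is the nonlocal form of `ψ` against itself with `L = 1`, so `form_enorm_le`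
applies; its tail term vanishes because `ψ` is zero off `B_R`. -/
theorem IsSpatialProfile.gagliardoSq_univ_lt_top {N : ℕ} {s ρ' R : ℝ} (hs : 0 < s) (hρ : 0 ≤ ρ')
    (hR : ρ' < R) {x₀ : RN N} {ψ : RN N → ℝ} (h : IsSpatialProfile s ρ' R x₀ ψ) :
    gagliardoSq s univ ψ < ∞ := by
  rw [gagliardoSq_eq_gagliardoProd s _ h.measurable, gagliardoProd, univ_prod_univ,
    Measure.restrict_univ]
  have h1 := form_enorm_le hs le_rfl hρ hR h h.measurable h.nonneg
    (k := fun x y => 1 / ‖x - y‖ ^ ((N : ℝ) + 2 * s)) (fun x y => by simp) (fun x y => by simp)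
  have h2 : ∫⁻ y in (Metric.ball x₀ R)ᶜ, ENNReal.ofReal (ψ y / ‖y - x₀‖ ^ ((N : ℝ) + 2 * s)) = 0 := by
    refine (setLIntegral_congr_fun measurableSet_ball.compl fun y hy => ?_).trans lintegral_zero
    rw [profile_eq_zero_of_notMem hR h.eq_zero hy]
    simp
  have h3 := lintegral_compl_ball_kernel_lt_top hs x₀ (hρ.trans_lt hR)
  rw [h2] at h1
  refine lt_of_le_of_lt (le_trans (lintegral_mono fun p => ?_) h1) ?_
  · rw [Real.enorm_eq_ofReal_abs]
    refine ENNReal.ofReal_le_ofReal (le_trans (le_of_eq ?_) (le_abs_self _))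
    ring
  · have hg := h.gagliardo
    have hsq := h.sq
    refine ENNReal.add_lt_top.2 ⟨ENNReal.mul_lt_top ENNReal.ofReal_lt_top
      (ENNReal.add_lt_top.2 ⟨hg, hg⟩), ENNReal.mul_lt_top (by simp) (ENNReal.add_lt_top.2 ⟨?_, ?_⟩)⟩
    · exact ENNReal.mul_lt_top (ENNReal.mul_lt_top ENNReal.ofReal_lt_top
        (ENNReal.add_lt_top.2 ⟨hsq, hsq⟩)) (ENNReal.mul_lt_top ENNReal.ofReal_lt_top h3)
    · simp

/-- Spatial profiles, regarded as constant in time, are test functions. -/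
theorem IsSpatialProfile.isTestFunction {N : ℕ} {s q T ρ' R : ℝ} (hs : 0 < s)
    (hρ : 0 ≤ ρ') (hR : ρ' < R) {x₀ : RN N} {ψ : RN N → ℝ} (h : IsSpatialProfile s ρ' R x₀ ψ)
    (hLp : MemLp ψ (ENNReal.ofReal (q + 1)) (volume.restrict (Metric.ball x₀ R))) :
    IsTestFunction s q T (Metric.ball x₀ R) (fun x _ => ψ x) (fun _ _ => 0) where
  nonneg := fun _ _ x => h.nonneg x
  eq_zero := fun _ _ _ hx => profile_eq_zero_of_notMem hR h.eq_zero hx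
  sobolev := fun t₁ t₂ _ _ _ => by
    refine ⟨(h.measurable.comp measurable_fst).aemeasurable, ?_⟩
    rw [setLIntegral_const]
    refine ENNReal.mul_lt_top (ENNReal.add_lt_top.2 ⟨?_, h.gagliardoSq_univ_lt_top hs hρ hR⟩) (by simp)
    simp only [sq_abs, Measure.restrict_univ]
    exact h.lintegral_sq_univ_lt_top hR
  memLp := fun t₁ t₂ _ _ _ => by
    rw [MemLpCylinder, Measure.volume_eq_prod, ← Measure.prod_restrict]
    exact hLp.comp_fst _
  memLp_deriv := fun t₁ t₂ _ _ _ => MemLp.zero'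
  deriv := fun t₁ t₂ _ _ _ => by simp

theorem lintegral_rpow_le_of_eLpNorm_le {X : Type*} [MeasurableSpace X] {μ : Measure X} {q M : ℝ}
    (hq : 0 < q) {f : X → ℝ} (h0 : ∀ x, 0 ≤ f x)
    (h : eLpNorm f (ENNReal.ofReal q) μ ≤ ENNReal.ofReal M) :
    ∫⁻ x, ENNReal.ofReal (f x ^ q) ∂μ ≤ ENNReal.ofReal (max M 0 ^ q) := by
  rw [eLpNorm_eq_lintegral_rpow_enorm_toReal (by simpa using hq) ENNReal.ofReal_ne_top,
    ENNReal.toReal_ofReal hq.le] at h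
  have h1 : ∫⁻ x, ENNReal.ofReal (f x ^ q) ∂μ = ∫⁻ x, ‖f x‖ₑ ^ q ∂μ := by
    refine lintegral_congr fun x => ?_
    rw [Real.enorm_eq_ofReal (h0 x), ENNReal.ofReal_rpow_of_nonneg (h0 x) hq.le]
  rw [h1, ← ENNReal.ofReal_rpow_of_nonneg (le_max_right _ _) hq.le]
  have h2 := ENNReal.rpow_le_rpow (h.trans (ENNReal.ofReal_le_ofReal (le_max_left M 0))) hq.le
  rwa [← ENNReal.rpow_mul, one_div, inv_mul_cancel₀ hq.ne', ENNReal.rpow_one] at h2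

theorem integrable_rpow_mul {X : Type*} [MeasurableSpace X] {μ : Measure X} {q : ℝ} (hq : 0 < q)
    {f g w : X → ℝ} (hf : Measurable f) (hg : Measurable g) (hf0 : ∀ x, 0 ≤ f x)
    (hg0 : ∀ x, 0 ≤ g x) (hgw : ∀ x, g x ≤ w x)
    (hfi : ∫⁻ x, ENNReal.ofReal (f x ^ (q + 1)) ∂μ < ∞)
    (hwi : ∫⁻ x, ENNReal.ofReal (w x ^ (q + 1)) ∂μ < ∞) :
    Integrable (fun x => f x ^ q * g x) μ := by
  refine ⟨((hf.pow_const q).mul hg).aestronglyMeasurable, ?_⟩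
  rw [hasFiniteIntegral_iff_norm]
  have mf : Measurable fun x => ENNReal.ofReal (f x ^ (q + 1)) := (hf.pow_const _).ennreal_ofReal
  refine lt_of_le_of_lt (lintegral_mono fun x => ?_)
    ((lintegral_add_left mf _).trans_lt (ENNReal.add_lt_top.2 ⟨hfi, hwi⟩))
  have h1 := hf0 x
  have h2 := hg0 x
  have h3 := h2.trans (hgw x)
  rw [← ENNReal.ofReal_add (by positivity) (by positivity), Real.norm_of_nonneg (by positivity)]
  refine ENNReal.ofReal_le_ofReal ((rpow_mul_le_young hq h1 h2).trans (add_le_add ?_ ?_))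
  · exact mul_le_of_le_one_left (by positivity) (by rw [div_le_one (by linarith)]; linarith)
  · refine (div_le_self (by positivity) (by linarith)).trans ?_
    exact Real.rpow_le_rpow h2 (hgw x) (by linarith)

/-- The weak inequality holds for `u` between all pairs of times, but `v` is tied to `u` only at
times where the slices agree almost everywhere. `S` is the set of those times; endpoints in `S`
allow `u` to be replaced by `v` in the boundary terms, and almost every intermediate time allows it
in the form. -/
theorem IsLocalWeakSubsolution.exists_weakData {N : ℕ} {s q L T ρ' R a b : ℝ} (hs : 0 < s)
    (hq : 1 < q) (hL : 1 ≤ L) (hρ : 0 ≤ ρ') (hR : ρ' < R) (ha : 0 < a) (hb : b ≤ T) {x₀ : RN N}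
    {Ω : Set (RN N)} (hΩ : Metric.closedBall x₀ R ⊆ Ω) {K : RN N → RN N → ℝ → ℝ}
    (hK : IsKernel s L T K) {u v : RN N → ℝ → ℝ} (hu : IsLocalWeakSubsolution s q T Ω K u)
    (hv : Measurable fun z : RN N × ℝ => v z.1 z.2) (hv0 : ∀ x t, 0 ≤ v x t)
    (huv : ∀ᵐ t : ℝ, t ∈ Icc a b → ∀ᵐ x : RN N, v x t = u x t) :
    ∃ (K' : RN N → RN N → ℝ → ℝ) (S : Set ℝ) (M : ℝ), WeakData s q L ρ' R a b M x₀ v K' S ∧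
      ∀ t ∈ S, t ∈ Icc a b ∧ ∀ᵐ x : RN N, v x t = u x t := by
  have hR0 : 0 < R := hρ.trans_lt hR
  obtain ⟨K', mK', hlow, hup, hKK⟩ := hK.exists_measurable_representative hL
  set S : Set ℝ := {t | t ∈ Icc a b ∧ ∀ᵐ x : RN N, v x t = u x t} with hS
  set μ := (volume : Measure (RN N)).restrict (Metric.ball x₀ R) with hμ
  have hμle : μ ≤ volume.restrict (Metric.closedBall x₀ R) :=
    Measure.restrict_mono Metric.ball_subset_closedBall le_rfl
  have hμfin : IsFiniteMeasure μ := ⟨by simp [hμ, measure_ball_lt_top]⟩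
  have hsub : Icc a b ⊆ Ioc 0 T := fun t ht => ⟨ha.trans_le ht.1, ht.2.trans hb⟩
  set p := ENNReal.ofReal (q + 1) with hp
  have hp1 : 1 ≤ p := by
    rw [hp, ← ENNReal.ofReal_one]; exact ENNReal.ofReal_le_ofReal (by linarith)
  have hmem : ∀ t ∈ Icc a b, MemLp (fun x => u x t) p μ := fun t ht =>
    (hu.memLp _ (isCompact_closedBall x₀ R) hΩ t (hsub ht)).mono_measure hμle
  have hcont : ∀ τ ∈ Icc a b, Tendsto (fun t => eLpNorm (fun x => u x t - u x τ) p μ)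
      (𝓝[Icc a b] τ) (𝓝 0) := fun τ hτ =>
    tendsto_of_tendsto_of_tendsto_of_le_of_le tendsto_const_nhds
      ((hu.continuous _ (isCompact_closedBall x₀ R) hΩ τ (hsub hτ)).mono_left
        (nhdsWithin_mono τ hsub)) (fun _ => zero_le) fun t => eLpNorm_mono_measure _ hμle
  obtain ⟨⟨M, hM⟩, hmod⟩ := exists_eLpNorm_le_and_modulus hp1 isCompact_Icc hmem hcont
  have hslice : ∀ t, Measurable fun x => v x t := fun t =>
    hv.comp (f := fun x : RN N => (x, t)) (by fun_prop)
  have hbound : ∀ t ∈ S, ∫⁻ x in Metric.ball x₀ R, ENNReal.ofReal (v x t ^ (q + 1))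
      ≤ ENNReal.ofReal (max M 0 ^ (q + 1)) := fun t ht => by
    refine lintegral_rpow_le_of_eLpNorm_le (by linarith) (fun x => hv0 x t) ?_
    rw [eLpNorm_congr_ae (g := fun x => u x t) (ae_restrict_of_ae ht.2)]
    exact hM t ht.1
  refine ⟨K', S, max M 0 ^ (q + 1), ⟨mK', hlow, hup, ?_, hbound, ?_, ?_⟩, fun t ht => ht⟩
  · filter_upwards [huv] with t ht hti using ⟨hti, ht hti⟩
  · intro ε hε
    -- Hölder constant for passing from `L^{q+1}` to `L¹` on the ball, which has finite measure.
    set m := μ univ ^ (1 / (1 : ℝ≥0∞).toReal - 1 / p.toReal) with hm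
    have hmt : m ≠ ∞ := by
      refine ENNReal.rpow_ne_top_of_nonneg ?_ (measure_ne_top _ _)
      rw [hp, ENNReal.toReal_ofReal (by linarith), ENNReal.toReal_one, sub_nonneg, div_one]
      rw [div_le_one (by linarith)]; linarith
    obtain ⟨δ, hδ, hδ'⟩ := hmod (ε / (m.toReal + 1)) (by positivity)
    refine ⟨δ, hδ, fun t ht t' ht' htt => ?_⟩
    have e1 : ∫⁻ x in Metric.ball x₀ R, ENNReal.ofReal |v x t - v x t'|
        = eLpNorm (fun x => v x t - v x t') 1 μ := by
      rw [eLpNorm_one_eq_lintegral_enorm]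
      exact lintegral_congr fun x => (Real.enorm_eq_ofReal_abs _).symm
    have e2 : eLpNorm (fun x => v x t - v x t') p μ = eLpNorm (fun x => u x t - u x t') p μ := by
      refine eLpNorm_congr_ae ?_
      filter_upwards [ae_restrict_of_ae ht.2, ae_restrict_of_ae ht'.2] with x h1 h2
      rw [h1, h2]
    rw [e1]
    refine (eLpNorm_le_eLpNorm_mul_rpow_measure_univ (f := fun x => v x t - v x t') hp1
      ((hslice t).sub (hslice t')).aestronglyMeasurable).trans ?_
    rw [← hm, e2]
    calc _ ≤ ENNReal.ofReal (ε / (m.toReal + 1)) * m := by gcongr; exact hδ' t ht.1 t' ht'.1 htt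
      _ = ENNReal.ofReal (ε / (m.toReal + 1) * m.toReal) := by
        rw [ENNReal.ofReal_mul (by positivity), ENNReal.ofReal_toReal hmt]
      _ ≤ _ := by
        refine ENNReal.ofReal_le_ofReal ?_
        have : 0 ≤ m.toReal := ENNReal.toReal_nonneg
        rw [div_mul_eq_mul_div, div_le_iff₀ (by positivity)]
        nlinarith
  · intro t₁ ht₁ τ hτ h1 h2 h3 ψ hψ hψv
    -- Domination of the profile by `v(τ)` makes it an admissible test function in `L^{q+1}`.
    have hLp : MemLp ψ p μ := by
      refine (hmem τ hτ.1).mono hψ.measurable.aestronglyMeasurable ?_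
      filter_upwards [ae_restrict_of_ae hτ.2] with x hx
      rw [← hx, Real.norm_of_nonneg (hψ.nonneg x), Real.norm_of_nonneg (hv0 x τ)]
      exact hψv x
    have hw := hu.weak t₁ τ (ha.trans_le h1) h2 (h3.trans hb) _ Metric.isOpen_ball
      (compactlyIn_ball hR0 hΩ) _ _ (hψ.isTestFunction (T := T) hs hρ hR hLp)
    have hintg : ∀ t ∈ S, Integrable (fun x => v x t ^ q * ψ x) μ := fun t ht =>
      integrable_rpow_mul (by linarith) (hslice t) hψ.measurable (fun x => hv0 x t) hψ.nonneg hψv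
        ((hbound t ht).trans_lt ENNReal.ofReal_lt_top) ((hbound τ hτ).trans_lt ENNReal.ofReal_lt_top)
    have e1 : ∀ t ∈ S, ∫ x in Metric.ball x₀ R, |u x t| ^ (q - 1) * u x t * ψ x
        = ∫ x in Metric.ball x₀ R, v x t ^ q * ψ x := fun t ht => by
      refine integral_congr_ae ?_
      filter_upwards [ae_restrict_of_ae ht.2] with x hx
      rw [← hx, abs_rpow_mul_self hq (hv0 x t)]
    have e2 : ∫ x in Metric.ball x₀ R, (v x τ ^ q - v x t₁ ^ q) * ψ x
        = (∫ x in Metric.ball x₀ R, v x τ ^ q * ψ x) - ∫ x in Metric.ball x₀ R, v x t₁ ^ q * ψ x := by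
      rw [← integral_sub (hintg τ hτ) (hintg t₁ ht₁)]
      simp only [sub_mul]
      rfl
    have e3 : (∫ t in t₁..τ, ∫ p : RN N × RN N, (v p.1 t - v p.2 t) * (ψ p.1 - ψ p.2) * K' p.1 p.2 t)
        = ∫ t in t₁..τ, ∫ p : RN N × RN N, (u p.1 t - u p.2 t) * (ψ p.1 - ψ p.2) * K p.1 p.2 t := by
      refine intervalIntegral.integral_congr_ae ?_
      filter_upwards [huv, hKK] with t ht hKt hti
      rw [uIoc_of_le h2] at hti
      have htab : t ∈ Icc a b := ⟨h1.trans hti.1.le, hti.2.trans h3⟩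
      refine integral_congr_ae ?_
      have f1 : ∀ᵐ p : RN N × RN N, v p.1 t = u p.1 t :=
        Measure.quasiMeasurePreserving_fst.ae (ht htab)
      have f2 : ∀ᵐ p : RN N × RN N, v p.2 t = u p.2 t :=
        Measure.quasiMeasurePreserving_snd.ae (ht htab)
      filter_upwards [f1, f2, hKt (hsub htab)] with p g1 g2 g3
      -- The modified kernel may differ from the original on the diagonal, but there the increments
      -- vanish.
      by_cases hpp : p.1 = p.2
      · rw [hpp]; simp
      · rw [g1, g2, g3 hpp]
    rw [e1 τ hτ, e1 t₁ ht₁] at hw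
    rw [e2, e3]
    simpa using hw

theorem IsLocalWeakSubsolution.sobolev_representative {N : ℕ} {s q T R a b : ℝ} (hR : 0 < R)
    (ha : 0 < a) (hab : a ≤ b) (hb : b ≤ T) {x₀ : RN N} {Ω : Set (RN N)}
    (hΩ : Metric.closedBall x₀ R ⊆ Ω) {K : RN N → RN N → ℝ → ℝ} {u v : RN N → ℝ → ℝ}
    (hu : IsLocalWeakSubsolution s q T Ω K u) (hv : Measurable fun z : RN N × ℝ => v z.1 z.2)
    (huv : ∀ᵐ t : ℝ, t ∈ Icc a b → ∀ᵐ x : RN N, v x t = u x t) :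
    ∫⁻ t in Icc a b, ((∫⁻ x in Metric.ball x₀ R, ENNReal.ofReal (v x t ^ 2))
      + gagliardoProd s (Metric.ball x₀ R) fun x => v x t) < ∞ := by
  have h := (hu.sobolev _ Metric.isOpen_ball (compactlyIn_ball hR hΩ) a b ha hab hb).2
  refine lt_of_le_of_lt (le_of_eq (lintegral_congr_ae ?_)) h
  rw [EventuallyEq, ae_restrict_iff' measurableSet_Icc]
  filter_upwards [huv] with t ht hti
  have h1 := ae_restrict_of_ae (s := Metric.ball x₀ R) (ht hti)
  have h2 : Measurable fun x => v x t := hv.comp (f := fun x : RN N => (x, t)) (by fun_prop)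
  rw [← gagliardoSq_eq_gagliardoProd s _ h2, gagliardoSq_congr_ae s h1]
  congr 1
  refine lintegral_congr_ae ?_
  filter_upwards [h1] with x hx
  rw [hx, sq_abs]

/-! ### Cutoff functions -/

theorem abs_ramp_sub_ramp_le (x y : ℝ) : |max 0 (min 1 x) - max 0 (min 1 y)| ≤ |x - y| :=
  (abs_max_sub_max_le_max 0 (min 1 x) 0 (min 1 y)).trans
    (max_le (by simp) ((abs_min_sub_min_le_max 1 x 1 y).trans (max_le (by simp) le_rfl)))

theorem exists_timeCut {c₁ c₂ : ℝ} (h : c₁ < c₂) : ∃ η, TimeCut η c₁ c₂ (1 / (c₂ - c₁)) := by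
  have h0 : 0 < c₂ - c₁ := by linarith
  refine ⟨fun t => max 0 (min 1 ((t - c₁) / (c₂ - c₁))), by fun_prop, fun t => le_max_left _ _,
    fun t => max_le zero_le_one (min_le_left _ _), fun t ht => ?_, fun t ht => ?_, by positivity,
    fun t l hl => ?_⟩
  · exact max_eq_left ((min_le_right _ _).trans
      (div_nonpos_of_nonpos_of_nonneg (by linarith) h0.le))
  · rw [min_eq_left, max_eq_right zero_le_one]
    rw [le_div_iff₀ h0]; linarith
  · have h1 := (abs_le.1 (abs_ramp_sub_ramp_le ((t + l - c₁) / (c₂ - c₁)) ((t - c₁) / (c₂ - c₁)))).2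
    have h2 : (t + l - c₁) / (c₂ - c₁) - (t - c₁) / (c₂ - c₁) = l * (1 / (c₂ - c₁)) := by
      field_simp; ring
    rw [h2, abs_of_nonneg (by positivity)] at h1
    linarith

theorem exists_spatialCut {N : ℕ} {r ρ : ℝ} (h : r < ρ) (x₀ : RN N) :
    ∃ ζ : RN N → ℝ, Measurable ζ ∧ (∀ x, 0 ≤ ζ x) ∧ (∀ x, ζ x ≤ 1) ∧
      (∀ x ∈ Metric.ball x₀ r, ζ x = 1) ∧ (∀ x, ρ < ‖x - x₀‖ → ζ x = 0) ∧
      ∀ x y, |ζ x - ζ y| ≤ 1 / (ρ - r) * ‖x - y‖ := by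
  have h0 : 0 < ρ - r := by linarith
  refine ⟨fun x => max 0 (min 1 ((ρ - ‖x - x₀‖) / (ρ - r))), by fun_prop, fun x => le_max_left _ _,
    fun x => max_le zero_le_one (min_le_left _ _), fun x hx => ?_, fun x hx => ?_, fun x y => ?_⟩
  · have hx' : ‖x - x₀‖ < r := by simpa [dist_eq_norm] using hx
    dsimp only
    rw [min_eq_left, max_eq_right zero_le_one]
    rw [le_div_iff₀ h0]; linarith
  · exact max_eq_left ((min_le_right _ _).trans
      (div_nonpos_of_nonpos_of_nonneg (by linarith) h0.le))
  · refine (abs_ramp_sub_ramp_le _ _).trans ?_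
    have h2 : (ρ - ‖x - x₀‖) / (ρ - r) - (ρ - ‖y - x₀‖) / (ρ - r)
        = 1 / (ρ - r) * (‖y - x₀‖ - ‖x - x₀‖) := by field_simp; ring
    rw [h2, abs_mul, abs_of_nonneg (by positivity)]
    gcongr
    refine (abs_norm_sub_norm_le _ _).trans ?_
    rw [sub_sub_sub_cancel_right, norm_sub_rev]

/-! ### Transfer between the solution and its representative -/

theorem lintegral_cylinder_eq {N : ℕ} {I J : Set ℝ} {B : Set (RN N)} (hB : MeasurableSet B)
    (hJ : MeasurableSet J) (hJI : J ⊆ I) {u v : RN N → ℝ → ℝ} {κ kt : ℝ → ℝ}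
    (huv : ∀ᵐ z : RN N × ℝ ∂(volume.restrict (univ ×ˢ I)), v z.1 z.2 = u z.1 z.2)
    (hκ : EqOn κ kt J) {H : ℝ → ℝ → ℝ≥0∞}
    (hH : Measurable fun z : RN N × ℝ => H (v z.1 z.2) (κ z.2)) :
    ∫⁻ z in B ×ˢ J, H (u z.1 z.2) (kt z.2) = ∫⁻ t in J, ∫⁻ x in B, H (v x t) (κ t) := by
  have h1 : ∫⁻ z in B ×ˢ J, H (u z.1 z.2) (kt z.2) = ∫⁻ z in B ×ˢ J, H (v z.1 z.2) (κ z.2) := by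
    refine lintegral_congr_ae ?_
    filter_upwards [ae_restrict_of_ae_restrict_of_subset (prod_mono (subset_univ B) hJI) huv,
      ae_restrict_mem (hB.prod hJ)] with z h1 h2
    rw [h1, hκ h2.2]
  rw [h1, Measure.volume_eq_prod, ← Measure.prod_restrict, lintegral_prod_symm _ hH.aemeasurable]

theorem gagliardoSq_truncation_le_goodForm {N : ℕ} (s : ℝ) {B : Set (RN N)} {t : ℝ} {κ kt : ℝ → ℝ}
    (hκ : κ t = kt t) {u v : RN N → ℝ → ℝ} (hv : Measurable fun x => v x t)
    (huv : ∀ᵐ x : RN N, v x t = u x t) :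
    gagliardoSq s B (fun x => max (u x t - kt t) 0) ≤ goodForm s B κ v t := by
  have h1 : ∀ᵐ x ∂(volume.restrict B), max (u x t - kt t) 0 = max (v x t - κ t) 0 := by
    filter_upwards [ae_restrict_of_ae huv] with x hx
    rw [hx, hκ]
  rw [gagliardoSq_congr_ae s h1, gagliardoSq_eq_gagliardoProd s B (by fun_prop)]
  refine lintegral_mono fun p => ENNReal.ofReal_le_ofReal ?_
  gcongr
  unfold goodIntegrand
  have h2 : 0 ≤ max (-(v p.2 t - κ t)) 0 * max (v p.1 t - κ t) 0 := by positivity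
  have h3 : 0 ≤ max (-(v p.1 t - κ t)) 0 * max (v p.2 t - κ t) 0 := by positivity
  linarith

/-- Only one of the two mixed products in `goodIntegrand` is kept; the square and the mirrored
product are nonnegative and dropped. -/
theorem lintegral_posPart_mul_negPart_le_goodForm {N : ℕ} (s : ℝ) {B : Set (RN N)} {t : ℝ}
    {κ : ℝ → ℝ} {v : RN N → ℝ → ℝ} (hv : Measurable fun x => v x t) :
    ∫⁻ x in B, ENNReal.ofReal (max (v x t - κ t) 0) * ∫⁻ y in B,
        ENNReal.ofReal (max (-(v y t - κ t)) 0 / ‖x - y‖ ^ ((N : ℝ) + 2 * s))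
      ≤ goodForm s B κ v t := by
  have hm : Measurable fun p : RN N × RN N => ENNReal.ofReal
      (goodIntegrand (v p.1 t) (v p.2 t) (κ t) / ‖p.1 - p.2‖ ^ ((N : ℝ) + 2 * s)) :=
    ((measurable_goodIntegrand (hv.comp measurable_fst) (hv.comp measurable_snd)
      measurable_const).div (by fun_prop)).ennreal_ofReal
  rw [goodForm, Measure.volume_eq_prod, ← Measure.prod_restrict, lintegral_prod _ hm.aemeasurable]
  refine lintegral_mono fun x => ?_
  rw [← lintegral_const_mul' _ _ ENNReal.ofReal_ne_top]
  refine lintegral_mono fun y => ?_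
  rw [← ENNReal.ofReal_mul (le_max_right _ _), mul_div_assoc']
  refine ENNReal.ofReal_le_ofReal ?_
  dsimp only
  gcongr
  unfold goodIntegrand
  have h2 : 0 ≤ (max (v x t - κ t) 0 - max (v y t - κ t) 0) ^ 2 := sq_nonneg _
  have h3 : 0 ≤ max (-(v x t - κ t)) 0 * max (v y t - κ t) 0 := by positivity
  linarith

theorem lintegral_cylinder_posPart_mul_negPart_le {N : ℕ} (s : ℝ) {I J : Set ℝ} {B : Set (RN N)}
    (hB : MeasurableSet B) (hJ : MeasurableSet J) (hJI : J ⊆ I) {u v : RN N → ℝ → ℝ} {κ kt : ℝ → ℝ}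
    (hv : Measurable fun z : RN N × ℝ => v z.1 z.2) (hκm : Measurable κ)
    (huv : ∀ᵐ z : RN N × ℝ ∂(volume.restrict (univ ×ˢ I)), v z.1 z.2 = u z.1 z.2)
    (huv' : ∀ᵐ t : ℝ, t ∈ I → ∀ᵐ x : RN N, v x t = u x t)
    (hκ : EqOn κ kt J) :
    ∫⁻ z in B ×ˢ J, ENNReal.ofReal (max (u z.1 z.2 - kt z.2) 0) *
        ∫⁻ y in B, ENNReal.ofReal (max (-(u y z.2 - kt z.2)) 0 / ‖z.1 - y‖ ^ ((N : ℝ) + 2 * s))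
      ≤ ∫⁻ t in J, goodForm s B κ v t := by
  have h0 : ∀ᵐ z : RN N × ℝ, z.2 ∈ I → ∀ᵐ x : RN N, v x z.2 = u x z.2 :=
    Measure.quasiMeasurePreserving_snd.ae huv'
  have h1 : ∫⁻ z in B ×ˢ J, ENNReal.ofReal (max (u z.1 z.2 - kt z.2) 0) *
        ∫⁻ y in B, ENNReal.ofReal (max (-(u y z.2 - kt z.2)) 0 / ‖z.1 - y‖ ^ ((N : ℝ) + 2 * s))
      = ∫⁻ z in B ×ˢ J, ENNReal.ofReal (max (v z.1 z.2 - κ z.2) 0) *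
        ∫⁻ y in B, ENNReal.ofReal (max (-(v y z.2 - κ z.2)) 0 / ‖z.1 - y‖ ^ ((N : ℝ) + 2 * s)) := by
    refine lintegral_congr_ae ?_
    filter_upwards [ae_restrict_of_ae_restrict_of_subset (prod_mono (subset_univ B) hJI) huv,
      ae_restrict_mem (hB.prod hJ), ae_restrict_of_ae h0] with z h1 h2 h3
    rw [h1, hκ h2.2]
    congr 1
    refine lintegral_congr_ae ?_
    filter_upwards [ae_restrict_of_ae (h3 (hJI h2.2))] with y hy
    rw [hy]
  have m1 : Measurable fun z : (RN N × ℝ) × RN N =>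
      ENNReal.ofReal (max (-(v z.2 z.1.2 - κ z.1.2)) 0 / ‖z.1.1 - z.2‖ ^ ((N : ℝ) + 2 * s)) := by
    have h2 : Measurable fun z : (RN N × ℝ) × RN N => v z.2 z.1.2 :=
      hv.comp (f := fun z : (RN N × ℝ) × RN N => (z.2, z.1.2)) (by fun_prop)
    exact (((h2.sub (hκm.comp (by fun_prop))).neg.max measurable_const).div
      (by fun_prop)).ennreal_ofReal
  have m2 : Measurable fun z : RN N × ℝ => ENNReal.ofReal (max (v z.1 z.2 - κ z.2) 0) *
      ∫⁻ y in B, ENNReal.ofReal (max (-(v y z.2 - κ z.2)) 0 / ‖z.1 - y‖ ^ ((N : ℝ) + 2 * s)) :=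
    (((hv.sub (hκm.comp measurable_snd)).max measurable_const).ennreal_ofReal).mul
      m1.lintegral_prod_right'
  rw [h1, Measure.volume_eq_prod, ← Measure.prod_restrict, lintegral_prod_symm _ m2.aemeasurable]
  exact lintegral_mono fun t => lintegral_posPart_mul_negPart_le_goodForm s
    (hv.comp (f := fun x : RN N => (x, t)) (by fun_prop))

theorem continuousAt_gPlus {q : ℝ} (hq : 1 < q) (a : ℝ) {k : ℝ} (hk : 0 < k) :
    ContinuousAt (fun y : ℝ × ℝ => gPlus q y.1 y.2) (a, k) := by
  have h1 : (fun y : ℝ × ℝ => gPlus q y.1 y.2) =ᶠ[𝓝 (a, k)] fun y =>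
      q / (q + 1) * max y.1 y.2 ^ (q + 1) - y.2 * max y.1 y.2 ^ q + y.2 ^ (q + 1) / (q + 1) := by
    filter_upwards [(isOpen_Ioi.preimage continuous_snd).mem_nhds (show (a, k).2 ∈ Ioi 0 from hk)]
      with y hy
    exact gPlus_eq hq y.1 hy
  refine ContinuousAt.congr ?_ h1.symm
  have hm : Continuous fun y : ℝ × ℝ => max y.1 y.2 := by fun_prop
  have c1 : Continuous fun y : ℝ × ℝ => max y.1 y.2 ^ (q + 1) :=
    hm.rpow_const fun _ => Or.inr (by linarith)
  have c2 : Continuous fun y : ℝ × ℝ => max y.1 y.2 ^ q :=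
    hm.rpow_const fun _ => Or.inr (by linarith)
  have c3 : Continuous fun y : ℝ × ℝ => y.2 ^ (q + 1) :=
    continuous_snd.rpow_const fun _ => Or.inr (by linarith)
  exact (((continuous_const.mul c1).sub (continuous_snd.mul c2)).add
    (c3.div_const _)).continuousAt

/-- Monotone exhaustion of the interval; it removes the gap before the final time left by the energy
estimate. -/
theorem lintegral_Ioo_le_of_forall_sub {c b : ℝ} {f : ℝ → ℝ≥0∞} {X : ℝ≥0∞}
    (h : ∀ δ > 0, ∫⁻ t in Ioo c (b - δ), f t ≤ X) : ∫⁻ t in Ioo c b, f t ≤ X := by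
  have h1 : Ioo c b = ⋃ n : ℕ, Ioo c (b - 1 / ((n : ℝ) + 1)) := by
    ext t
    simp only [mem_Ioo, mem_iUnion]
    refine ⟨fun ht => ?_, fun ⟨n, ht1, ht2⟩ => ⟨ht1, ?_⟩⟩
    · obtain ⟨n, hn⟩ := exists_nat_one_div_lt (show 0 < b - t by linarith [ht.2])
      exact ⟨n, ht.1, by linarith⟩
    · have : 0 < 1 / ((n : ℝ) + 1) := by positivity
      linarith
  have h2 : Monotone fun n : ℕ => Ioo c (b - 1 / ((n : ℝ) + 1)) := fun m n hmn =>
    Ioo_subset_Ioo_right (sub_le_sub_left (one_div_le_one_div_of_le (by positivity)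
      (by exact_mod_cast Nat.succ_le_succ hmn)) b)
  rw [h1, setLIntegral_iUnion_of_directed _ h2.directed_le]
  exact iSup_le fun n => h _ (by positivity)

theorem cutEnergy_le_lintegral_ball {N : ℕ} {q ρ : ℝ} (hq : 1 < q) {x₀ : RN N} {B : Set (RN N)}
    {κ : ℝ → ℝ} {ζ : RN N → ℝ} {v : RN N → ℝ → ℝ} {t : ℝ} (hκ : 0 < κ t) (hζ0 : ∀ x, 0 ≤ ζ x)
    (hζ1 : ∀ x, ζ x ≤ 1) (hζz : ∀ x, ρ ≤ ‖x - x₀‖ → ζ x = 0) :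
    cutEnergy q B κ ζ v t
      ≤ ∫⁻ x in Metric.ball x₀ ρ, ENNReal.ofReal (gPlus q (v x t) (κ t)) := by
  rw [cutEnergy, ← lintegral_indicator measurableSet_ball]
  refine (setLIntegral_le_lintegral _ _).trans (lintegral_mono fun x => ?_)
  by_cases hx : x ∈ Metric.ball x₀ ρ
  · rw [indicator_of_mem hx]
    exact ENNReal.ofReal_le_ofReal (mul_le_of_le_one_right (gPlus_nonneg hq _ hκ)
      (pow_le_one₀ (hζ0 x) (hζ1 x)))
  · rw [hζz x (by simpa [dist_eq_norm] using hx)]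
    simp

theorem lintegral_ball_le_cutEnergy {N : ℕ} {q r R : ℝ} (hr : r ≤ R) {x₀ : RN N}
    {κ : ℝ → ℝ} {ζ : RN N → ℝ} {v : RN N → ℝ → ℝ} {t : ℝ}
    (hζ : ∀ x ∈ Metric.ball x₀ r, ζ x = 1) :
    ∫⁻ x in Metric.ball x₀ r, ENNReal.ofReal (gPlus q (v x t) (κ t))
      ≤ cutEnergy q (Metric.ball x₀ R) κ ζ v t := by
  refine le_trans (setLIntegral_mono' measurableSet_ball fun x hx => ?_)
    (lintegral_mono_set (Metric.ball_subset_ball hr))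
  rw [hζ x hx]
  simp

/-! ### The left and right hand sides of the estimate -/

namespace LevelSetup

variable {N : ℕ} {s q L r ρ' R A a b : ℝ} {x₀ : RN N} {κ : ℝ → ℝ} {ζ : RN N → ℝ}
  {v : RN N → ℝ → ℝ}

/-- The good terms are controlled by the right hand side of the energy estimate. -/
theorem lintegral_goodForm_le (h : LevelSetup s q L r ρ' R A a b x₀ κ ζ v) {M : ℝ}
    {K : RN N → RN N → ℝ → ℝ} {S : Set ℝ} (hw : WeakData s q L ρ' R a b M x₀ v K S)
    {η : ℝ → ℝ} {c₁ c₂ β : ℝ} (hη : TimeCut η c₁ c₂ β) {α : ℝ}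
    (hα : a ≤ α) (hαc : α < c₁) (hc : c₁ ≤ c₂) (hb : c₂ < b) :
    ∫⁻ t in Ioo c₂ b, goodForm s (Metric.ball x₀ r) κ v t
    ≤ ENNReal.ofReal L *
      (ENNReal.ofReal β * (∫⁻ t in Ioo α b, cutEnergy q (Metric.ball x₀ R) κ ζ v t)
        + ENNReal.ofReal L * (∫⁻ t in Ioo α b, badForm s (Metric.ball x₀ R) κ ζ v t)) := by
  have hL : 0 < L := by linarith [h.one_le]
  refine lintegral_Ioo_le_of_forall_sub fun δ hδ => ?_
  -- With `c₀ = 0` nothing is asked of the energy near the final time, so `δ` is arbitrary.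
  have h1 := h.energy_estimate hw hη hα hαc hc hb le_rfl hδ (c₀ := 0) fun t _ _ _ => zero_le
  rw [zero_add] at h1
  calc _ = ENNReal.ofReal L * (ENNReal.ofReal L⁻¹ *
        ∫⁻ t in Ioo c₂ (b - δ), goodForm s (Metric.ball x₀ r) κ v t) := by
        rw [← mul_assoc, ← ENNReal.ofReal_mul hL.le, mul_inv_cancel₀ hL.ne', ENNReal.ofReal_one,
          one_mul]
    _ ≤ _ := by gcongr

/-- The energy at every time is controlled by the right hand side of the energy estimate. -/
theorem lintegral_gPlus_le (h : LevelSetup s q L r ρ' R A a b x₀ κ ζ v) {M : ℝ}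
    {K : RN N → RN N → ℝ → ℝ} {S : Set ℝ} (hw : WeakData s q L ρ' R a b M x₀ v K S)
    {η : ℝ → ℝ} {c₁ c₂ β : ℝ} (hη : TimeCut η c₁ c₂ β) {α τ : ℝ}
    (hα : a ≤ α) (hαc : α < c₁) (hc : c₁ ≤ c₂) (hτ : c₂ < τ) (hb : τ ≤ b)
    {u : RN N → ℝ → ℝ} {kt : ℝ → ℝ} (hkt : ContinuousOn kt (Icc a b)) (hκ : EqOn κ kt (Icc a b))
    (hS : ∀ t ∈ S, t ∈ Icc a b ∧ ∀ᵐ x : RN N, v x t = u x t)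
    (hu : ∀ t ∈ Icc a b,
      AEStronglyMeasurable (fun x => u x t) (volume.restrict (Metric.ball x₀ r)))
    {p : ℝ≥0∞} (hp : p ≠ 0)
    (hlim : Tendsto (fun t => eLpNorm (fun x => u x t - u x τ) p
      (volume.restrict (Metric.ball x₀ r))) (𝓝[Icc a b] τ) (𝓝 0)) :
    ∫⁻ x in Metric.ball x₀ r, ENNReal.ofReal (gPlus q (u x τ) (kt τ))
      ≤ ENNReal.ofReal β * (∫⁻ t in Ioo α b, cutEnergy q (Metric.ball x₀ R) κ ζ v t)
        + ENNReal.ofReal L * (∫⁻ t in Ioo α b, badForm s (Metric.ball x₀ R) κ ζ v t) := by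
  have hτab : τ ∈ Icc a b := ⟨by linarith, hb⟩
  have hpos : ∀ t ∈ Icc a b, 0 < kt t := fun t ht => by rw [← hκ ht]; exact h.level_pos t
  -- The time `τ` need not be good. Every number below the energy of `u` at `τ` is exceeded by the
  -- energy at nearby times, in particular at the good times just before `τ`, and this is the lower
  -- bound that the energy estimate requires.
  refine le_of_forall_lt fun c₀ hc₀ => ?_
  obtain ⟨c₀', hc₀', hc₀''⟩ := exists_between hc₀
  have hev := eventually_lt_lintegral_of_tendsto_eLpNorm hp hτab hu hlim (hkt τ hτab)
    (G := fun _ y => ENNReal.ofReal (gPlus q y.1 y.2))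
    (fun x => ENNReal.continuous_ofReal.continuousAt.comp
      (continuousAt_gPlus h.one_lt (u x τ) (hpos τ hτab)))
    (fun t ht => by
      have h1 : Measurable fun y : ℝ => gPlus q y (kt t) :=
        measurable_gPlus h.one_lt measurable_id measurable_const fun _ => hpos t ht
      exact (h1.comp_aemeasurable (hu t ht).aemeasurable).ennreal_ofReal) hc₀''
  rw [eventually_nhdsWithin_iff, Metric.eventually_nhds_iff] at hev
  obtain ⟨δ, hδ, hev⟩ := hev
  have h1 := h.energy_estimate hw hη hα hαc hc hτ hb hδ (c₀ := c₀') fun t ht ht1 ht2 => by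
    obtain ⟨htab, hae⟩ := hS t ht
    have h2 := hev (by rw [Real.dist_eq, abs_lt]; constructor <;> linarith) htab
    refine le_trans (h2.le.trans (le_of_eq ?_)) (lintegral_ball_le_cutEnergy h.r_le h.cut_one)
    refine lintegral_congr_ae ?_
    filter_upwards [ae_restrict_of_ae hae] with x hx
    rw [hx, hκ htab]
  refine hc₀'.trans_le ((le_add_right le_rfl).trans (h1.trans ?_))
  gcongr

/-- The right hand side of the energy estimate, in terms of the level set truncations. -/
theorem energy_rhs_le (h : LevelSetup s q L r ρ' R A a b x₀ κ ζ v) {ρ C : ℝ} (hr : r < ρ)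
    (hC : ∀ (x₀ x : RN N) (ρ : ℝ), x ∈ Metric.ball x₀ ρ →
      ∫⁻ y in Metric.ball x₀ ρ, ENNReal.ofReal (‖x - y‖ ^ 2 / ‖x - y‖ ^ ((N : ℝ) + 2 * s))
        ≤ ENNReal.ofReal (C * ρ ^ (2 * (1 - s))))
    (hζz : ∀ x, (r + ρ) / 2 < ‖x - x₀‖ → ζ x = 0)
    (hζl : ∀ x y, |ζ x - ζ y| ≤ 2 / (ρ - r) * ‖x - y‖) {β : ℝ} {J : Set ℝ} {m : ℝ≥0∞}
    (hm : ∀ᵐ t ∂(volume.restrict J),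
      ∫⁻ x in Metric.ball x₀ R, ENNReal.ofReal (max (v x t - κ t) 0) ≤ m) :
    ENNReal.ofReal β * (∫⁻ t in J, cutEnergy q (Metric.ball x₀ R) κ ζ v t)
      + ENNReal.ofReal L * (∫⁻ t in J, badForm s (Metric.ball x₀ R) κ ζ v t)
    ≤ ENNReal.ofReal β *
        (∫⁻ t in J, ∫⁻ x in Metric.ball x₀ ρ, ENNReal.ofReal (gPlus q (v x t) (κ t)))
      + ENNReal.ofReal L *
        (2 * (ENNReal.ofReal (2 / (ρ - r) ^ 2) * (ENNReal.ofReal (C * ρ ^ (2 * (1 - s))) *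
          ∫⁻ t in J, ∫⁻ x in Metric.ball x₀ ρ, ENNReal.ofReal (max (v x t - κ t) 0 ^ 2)))
        + 2 * (ENNReal.ofReal ((2 / (ρ - r)) ^ ((N : ℝ) + 2 * s)) *
          (∫⁻ t in J, ∫⁻ x in Metric.ball x₀ ρ, ENNReal.ofReal (max (v x t - κ t) 0)) * m)) := by
  have hw : Measurable fun z : ℝ × RN N => max (v z.2 z.1 - κ z.1) 0 := by
    have h1 : Measurable fun z : ℝ × RN N => v z.2 z.1 :=
      h.meas.comp (f := fun z : ℝ × RN N => (z.2, z.1)) (by fun_prop)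
    exact (h1.sub (h.level_meas.comp measurable_fst)).max measurable_const
  have m1 : Measurable fun t =>
      ∫⁻ x in Metric.ball x₀ ρ, ENNReal.ofReal (max (v x t - κ t) 0 ^ 2) :=
    (hw.pow_const 2).ennreal_ofReal.lintegral_prod_right'
  have m2 : Measurable fun t =>
      ∫⁻ x in Metric.ball x₀ ρ, ENNReal.ofReal (max (v x t - κ t) 0) :=
    hw.ennreal_ofReal.lintegral_prod_right'
  refine add_le_add (mul_le_mul_right (lintegral_mono fun t => ?_) _) (mul_le_mul_right ?_ _)
  · exact cutEnergy_le_lintegral_ball h.one_lt (h.level_pos t) h.cut_nonneg h.cut_le_one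
      fun x hx => hζz x (by linarith)
  · have key : ∀ᵐ t ∂(volume.restrict J), badForm s (Metric.ball x₀ R) κ ζ v t
        ≤ 2 * (ENNReal.ofReal (2 / (ρ - r) ^ 2) * (ENNReal.ofReal (C * ρ ^ (2 * (1 - s))) *
            ∫⁻ x in Metric.ball x₀ ρ, ENNReal.ofReal (max (v x t - κ t) 0 ^ 2)))
          + 2 * (ENNReal.ofReal ((2 / (ρ - r)) ^ ((N : ℝ) + 2 * s)) *
            (∫⁻ x in Metric.ball x₀ ρ, ENNReal.ofReal (max (v x t - κ t) 0)) * m) := by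
      filter_upwards [hm] with t ht
      refine (badForm_le h.s_pos hr hC h.cut_nonneg h.cut_le_one hζz hζl
        (h.measurable_slice t)).trans ?_
      gcongr
    refine (lintegral_mono_ae key).trans (le_of_eq ?_)
    have n1 := ((m1.const_mul (ENNReal.ofReal (C * ρ ^ (2 * (1 - s))))).const_mul
      (ENNReal.ofReal (2 / (ρ - r) ^ 2)))
    have n2 := m2.const_mul (ENNReal.ofReal ((2 / (ρ - r)) ^ ((N : ℝ) + 2 * s)))
    rw [lintegral_add_left (n1.const_mul 2), lintegral_const_mul _ n1,
      lintegral_const_mul _ (m1.const_mul _), lintegral_const_mul _ m1,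
      lintegral_const_mul _ (n2.mul_const m), lintegral_mul_const _ n2, lintegral_const_mul _ m2]

end LevelSetup

/-! ### Constants and conclusion -/

/-- Collects the constants in front of each integral. The factor `b / 2` is written so that `b =
2/(ρ-r)²` yields `1/(ρ-r)²`. -/
theorem ofReal_mul_energy_eq {L β b g e w : ℝ} (hL : 0 ≤ L) (hb : 0 ≤ b)
    (he : 0 ≤ e) (X Y Z W : ℝ≥0∞) :
    ENNReal.ofReal (1 + 2 * L) * (ENNReal.ofReal β * X + ENNReal.ofReal L *
      (2 * (ENNReal.ofReal b * (ENNReal.ofReal g * Y))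
        + 2 * (ENNReal.ofReal e * Z * (ENNReal.ofReal w * W))))
    = ENNReal.ofReal ((1 + 2 * L) * β) * X + ENNReal.ofReal ((1 + 2 * L) * (4 * L * (b / 2) * g)) * Y
      + ENNReal.ofReal ((1 + 2 * L) * (2 * L * e * w)) * W * Z := by
  have h2 : (2 : ℝ≥0∞) = ENNReal.ofReal 2 := by simp
  have e1 : (1 + 2 * L) * (4 * L * (b / 2) * g) = (1 + 2 * L) * (L * (2 * (b * g))) := by ring
  have e2 : (1 + 2 * L) * (2 * L * e * w) = (1 + 2 * L) * (L * (2 * (e * w))) := by ring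
  have hL' : 0 ≤ 1 + 2 * L := by positivity
  rw [e1, e2, h2, ENNReal.ofReal_mul hL', ENNReal.ofReal_mul hL', ENNReal.ofReal_mul hL',
    ENNReal.ofReal_mul hL, ENNReal.ofReal_mul hL, ENNReal.ofReal_mul zero_le_two,
    ENNReal.ofReal_mul zero_le_two, ENNReal.ofReal_mul hb, ENNReal.ofReal_mul he]
  ring

theorem proposition2p5 (N : ℕ) (hN : 2 ≤ N) (s : ℝ) (hs : s ∈ Ioo (0 : ℝ) 1)
    (L : ℝ) (hL : 1 ≤ L) :
    ∃ c : ℝ, 0 < c ∧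
      ∀ (q : ℝ), 1 < q →
      ∀ (T : ℝ) (Ω : Set (RN N)), IsOpen Ω → Bornology.IsBounded Ω →
      ∀ (K : RN N → RN N → ℝ → ℝ), IsKernel s L T K →
      ∀ (u : RN N → ℝ → ℝ), IsLocalWeakSubsolution s q T Ω K u →
      (∀ᵐ z : RN N × ℝ ∂(volume.restrict (univ ×ˢ Ioc 0 T)), 0 ≤ u z.1 z.2) →
      ∀ (x₀ : RN N) (t₀ σ₁ σ₂ θ r ρ ρ' R : ℝ),
      0 < σ₁ → σ₁ < σ₂ → σ₂ < θ → 0 < r → r < ρ → ρ < ρ' → ρ' < R →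
      CompactlyIn (parabolicCylinder R θ x₀ t₀) (Ω ×ˢ Ioc 0 T) →
      ∀ (k : ℝ), 0 < k →
      ∀ (kt : ℝ → ℝ), (∀ t, kt t = k + tailLevel s q L R ρ' θ x₀ t₀ u t) →
      (⨆ t ∈ Ioo (t₀ - σ₁) t₀,
          ∫⁻ x in Metric.ball x₀ r, ENNReal.ofReal (gPlus q (u x t) (kt t)))
        + (∫⁻ t in Ioo (t₀ - σ₁) t₀,
            gagliardoSq s (Metric.ball x₀ r) (fun x => max (u x t - kt t) 0))
        + (∫⁻ z in parabolicCylinder r σ₁ x₀ t₀,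
            ENNReal.ofReal (max (u z.1 z.2 - kt z.2) 0) *
              ∫⁻ y in Metric.ball x₀ r,
                ENNReal.ofReal (max (-(u y z.2 - kt z.2)) 0 / ‖z.1 - y‖ ^ ((N : ℝ) + 2 * s)))
      ≤ ENNReal.ofReal (c / (σ₂ - σ₁)) *
          (∫⁻ z in parabolicCylinder ρ σ₂ x₀ t₀,
            ENNReal.ofReal (gPlus q (u z.1 z.2) (kt z.2)))
        + ENNReal.ofReal (c * (ρ ^ (2 * (1 - s)) / (ρ - r) ^ 2)) *
          (∫⁻ z in parabolicCylinder ρ σ₂ x₀ t₀,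
            ENNReal.ofReal (max (u z.1 z.2 - kt z.2) 0 ^ 2))
        + ENNReal.ofReal (c * R ^ N * (1 / (ρ - r)) ^ ((N : ℝ) + 2 * s)) *
          (⨆ t ∈ Icc (t₀ - θ) t₀,
            ⨍⁻ y in Metric.ball x₀ R, ENNReal.ofReal (max (u y t - kt t) 0) ∂volume) *
          (∫⁻ z in parabolicCylinder ρ σ₂ x₀ t₀,
            ENNReal.ofReal (max (u z.1 z.2 - kt z.2) 0)) := by
  obtain ⟨hs0, hs1⟩ := hs
  obtain ⟨C, hC0, hC⟩ := exists_lintegral_ball_kernel_le hN hs1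
  have hL0 : 0 < L := by linarith
  set V : ℝ := (volume (Metric.ball (0 : RN N) 1)).toReal with hV
  have hV0 : 0 ≤ V := ENNReal.toReal_nonneg
  -- The three summands serve the three terms on the right: `2` is the slope factor of the time
  -- cutoff, `C` the kernel constant near the diagonal, and `2^{N+2s} V` joins the half-width gap of
  -- the spatial cutoff to the volume of the unit ball, which turns averages over `B_R` into
  -- integrals.
  set c : ℝ := (1 + 2 * L) * (2 + 4 * L * C + 2 * L * 2 ^ ((N : ℝ) + 2 * s) * V) with hc
  refine ⟨c, by positivity, ?_⟩
  intro q hq T Ω _ _ K hK u hu hpos x₀ t₀ σ₁ σ₂ θ r ρ ρ' R hσ₁ hσ hσθ hr hrρ hρρ' hρR hQ k hk kt hkt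
  have hθ : 0 < θ := by linarith
  have hR : 0 < R := by linarith
  have hρ'0 : 0 ≤ ρ' := by linarith
  have hρr : 0 < ρ - r := by linarith
  have hσσ : 0 < σ₂ - σ₁ := by linarith
  obtain ⟨hΩ, ha, hT⟩ := closedBall_subset_of_compactlyIn hR hθ hQ
  have hab : t₀ - θ ≤ t₀ := by linarith
  obtain ⟨v, hv, hv0, huv, huv'⟩ :=
    exists_measurable_nonneg_representative measurableSet_Ioc hu.aemeasurable hpos
  have hsub : Icc (t₀ - θ) t₀ ⊆ Ioc 0 T := fun t ht => ⟨ha.trans_le ht.1, ht.2.trans hT⟩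
  have huvI : ∀ᵐ t : ℝ, t ∈ Icc (t₀ - θ) t₀ → ∀ᵐ x : RN N, v x t = u x t := by
    filter_upwards [huv'] with t ht hti using ht (hsub hti)
  obtain ⟨hktc, -, κ, hκ, hκm, hκ0, hκmono, hκtail⟩ := exists_level hs0 hq hL hR hρR hθ hk hv hv0
    huvI (hu.tail _ _ ha hab hT) hkt
  -- The cutoff stops half way between `r` and `ρ`: the inner half of the gap carries its slope
  -- `2/(ρ-r)`, the outer half separates its support from the complement of `B_ρ`.
  obtain ⟨ζ, hζm, hζ0, hζ1, hζr, hζz, hζl⟩ :=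
    exists_spatialCut (show r < (r + ρ) / 2 by linarith) x₀
  have hζl' : ∀ x y, |ζ x - ζ y| ≤ 2 / (ρ - r) * ‖x - y‖ := fun x y => by
    refine (hζl x y).trans (le_of_eq ?_)
    congr 1
    rw [div_eq_div_iff (by linarith) (by linarith)]
    ring
  have hset : LevelSetup s q L r ρ' R (2 / (ρ - r)) (t₀ - θ) t₀ x₀ κ ζ v :=
    { two_le := hN
      s_pos := hs0
      s_lt := hs1
      one_lt := hq
      one_le := hL
      inner_nonneg := hρ'0
      r_le := by linarith
      inner_lt := hρR
      level_meas := hκm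
      level_pos := hκ0
      level_mono := hκmono
      cut_meas := hζm
      cut_nonneg := hζ0
      cut_le_one := hζ1
      cut_one := hζr
      cut_zero := fun x hx => hζz x (by linarith)
      cut_lip := hζl'
      meas := hv
      nonneg := hv0
      sobolev := hu.sobolev_representative hR ha hab hT hΩ hv huvI
      tail := hκtail }
  obtain ⟨K', S, M, hw, hS⟩ :=
    hu.exists_weakData hs0 hq hL hρ'0 hρR ha hT hΩ hK hv hv0 huvI
  -- The ramp starts half way between `t₀ - σ₂` and `t₀ - σ₁`, leaving room before it for the
  -- backward time step.
  obtain ⟨η, hη⟩ := exists_timeCut (show t₀ - (σ₁ + σ₂) / 2 < t₀ - σ₁ by linarith)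
  have hβ : 1 / (t₀ - σ₁ - (t₀ - (σ₁ + σ₂) / 2)) = 2 / (σ₂ - σ₁) := by
    rw [div_eq_div_iff (by linarith) (by linarith)]
    ring
  rw [hβ] at hη
  set X := ENNReal.ofReal (2 / (σ₂ - σ₁))
      * (∫⁻ t in Ioo (t₀ - σ₂) t₀, cutEnergy q (Metric.ball x₀ R) κ ζ v t)
    + ENNReal.ofReal L * (∫⁻ t in Ioo (t₀ - σ₂) t₀, badForm s (Metric.ball x₀ R) κ ζ v t) with hX
  have hgood : ∫⁻ t in Ioo (t₀ - σ₁) t₀, goodForm s (Metric.ball x₀ r) κ v t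
      ≤ ENNReal.ofReal L * X :=
    hset.lintegral_goodForm_le hw hη (by linarith) (by linarith) (by linarith) (by linarith)
  have hJ₁ : Ioo (t₀ - σ₁) t₀ ⊆ Icc (t₀ - θ) t₀ := fun t ht => ⟨by linarith [ht.1], ht.2.le⟩
  have hJ₂ : Ioo (t₀ - σ₂) t₀ ⊆ Icc (t₀ - θ) t₀ := fun t ht => ⟨by linarith [ht.1], ht.2.le⟩
  have hball : Metric.ball x₀ r ⊆ Metric.closedBall x₀ R :=
    Metric.ball_subset_closedBall.trans (Metric.closedBall_subset_closedBall (by linarith))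
  have hμle : (volume : Measure (RN N)).restrict (Metric.ball x₀ r)
      ≤ volume.restrict (Metric.closedBall x₀ R) := Measure.restrict_mono hball le_rfl
  have hsup : (⨆ t ∈ Ioo (t₀ - σ₁) t₀,
      ∫⁻ x in Metric.ball x₀ r, ENNReal.ofReal (gPlus q (u x t) (kt t))) ≤ X := by
    refine iSup₂_le fun τ hτ => ?_
    refine hset.lintegral_gPlus_le hw hη (by linarith) (by linarith) (by linarith) hτ.1 hτ.2.le
      hktc hκ hS (p := ENNReal.ofReal (q + 1)) (fun t ht => ?_) ?_ ?_
    · exact ((hu.memLp _ (isCompact_closedBall x₀ R) hΩ t (hsub ht)).mono_measure hμle).1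
    · rw [Ne, ENNReal.ofReal_eq_zero, not_le]
      linarith
    · exact tendsto_of_tendsto_of_tendsto_of_le_of_le tendsto_const_nhds
        ((hu.continuous _ (isCompact_closedBall x₀ R) hΩ τ (hsub (hJ₁ hτ))).mono_left
          (nhdsWithin_mono τ hsub)) (fun _ => zero_le) fun t => eLpNorm_mono_measure _ hμle
  have hgag : ∫⁻ t in Ioo (t₀ - σ₁) t₀,
      gagliardoSq s (Metric.ball x₀ r) (fun x => max (u x t - kt t) 0) ≤ ENNReal.ofReal L * X := by
    refine le_trans (lintegral_mono_ae ((ae_restrict_iff' measurableSet_Ioo).2 ?_)) hgood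
    filter_upwards [huvI] with t ht hti
    exact gagliardoSq_truncation_le_goodForm s (hκ (hJ₁ hti)) (hset.measurable_slice t)
      (ht (hJ₁ hti))
  have hneg : ∫⁻ z in parabolicCylinder r σ₁ x₀ t₀,
      ENNReal.ofReal (max (u z.1 z.2 - kt z.2) 0) * ∫⁻ y in Metric.ball x₀ r,
        ENNReal.ofReal (max (-(u y z.2 - kt z.2)) 0 / ‖z.1 - y‖ ^ ((N : ℝ) + 2 * s))
      ≤ ENNReal.ofReal L * X :=
    (lintegral_cylinder_posPart_mul_negPart_le s measurableSet_ball measurableSet_Ioo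
      (hJ₁.trans hsub) hv hκm huv huv' (hκ.mono hJ₁)).trans hgood
  set A := ⨆ t ∈ Icc (t₀ - θ) t₀,
    ⨍⁻ y in Metric.ball x₀ R, ENNReal.ofReal (max (u y t - kt t) 0) ∂volume with hA
  have hvol : volume (Metric.ball x₀ R) = ENNReal.ofReal (R ^ N * V) := by
    rw [Measure.addHaar_ball_of_pos _ _ hR, finrank_euclideanSpace_fin,
      ENNReal.ofReal_mul (by positivity), hV, ENNReal.ofReal_toReal measure_ball_lt_top.ne]
  have hm : ∀ᵐ t ∂(volume.restrict (Ioo (t₀ - σ₂) t₀)),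
      ∫⁻ x in Metric.ball x₀ R, ENNReal.ofReal (max (v x t - κ t) 0)
        ≤ ENNReal.ofReal (R ^ N * V) * A := by
    rw [ae_restrict_iff' measurableSet_Ioo]
    filter_upwards [huvI] with t ht hti
    have h1 : ∫⁻ x in Metric.ball x₀ R, ENNReal.ofReal (max (v x t - κ t) 0)
        = ∫⁻ x in Metric.ball x₀ R, ENNReal.ofReal (max (u x t - kt t) 0) := by
      refine lintegral_congr_ae ?_
      filter_upwards [ae_restrict_of_ae (ht (hJ₂ hti))] with x hx
      rw [hx, hκ (hJ₂ hti)]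
    rw [h1, ← measure_mul_setLAverage _ measure_ball_lt_top.ne, hvol]
    gcongr
    exact le_iSup₂ (f := fun t (_ : t ∈ Icc (t₀ - θ) t₀) =>
      ⨍⁻ y in Metric.ball x₀ R, ENNReal.ofReal (max (u y t - kt t) 0) ∂volume) t (hJ₂ hti)
  have hmv : Measurable fun z : RN N × ℝ => max (v z.1 z.2 - κ z.2) 0 :=
    (hv.sub (hκm.comp measurable_snd)).max measurable_const
  have i1 := lintegral_cylinder_eq (B := Metric.ball x₀ ρ) measurableSet_ball measurableSet_Ioo
    (hJ₂.trans hsub) huv (hκ.mono hJ₂) (H := fun y l => ENNReal.ofReal (gPlus q y l))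
    (measurable_gPlus hq hv (hκm.comp measurable_snd) fun z => hκ0 z.2).ennreal_ofReal
  have i2 := lintegral_cylinder_eq (B := Metric.ball x₀ ρ) measurableSet_ball measurableSet_Ioo
    (hJ₂.trans hsub) huv (hκ.mono hJ₂) (H := fun y l => ENNReal.ofReal (max (y - l) 0 ^ 2))
    (hmv.pow_const 2).ennreal_ofReal
  have i3 := lintegral_cylinder_eq (B := Metric.ball x₀ ρ) measurableSet_ball measurableSet_Ioo
    (hJ₂.trans hsub) huv (hκ.mono hJ₂) (H := fun y l => ENNReal.ofReal (max (y - l) 0))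
    hmv.ennreal_ofReal
  have hXle := hset.energy_rhs_le hrρ hC hζz hζl' (β := 2 / (σ₂ - σ₁)) hm
  rw [← hX, ← i1, ← i2, ← i3] at hXle
  -- The supremum is bounded by `X`. Each of the two good terms is bounded separately by the
  -- integral of `goodForm`, hence by `L X`; together this gives `1 + 2L`.
  have hsum : ENNReal.ofReal (1 + 2 * L) * X
      = X + ENNReal.ofReal L * X + ENNReal.ofReal L * X := by
    rw [ENNReal.ofReal_add zero_le_one (by positivity), ENNReal.ofReal_mul zero_le_two,
      ENNReal.ofReal_one, ENNReal.ofReal_ofNat]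
    ring
  refine (add_le_add (add_le_add hsup hgag) hneg).trans ?_
  have hρpow : 0 ≤ ρ ^ (2 * (1 - s)) := Real.rpow_nonneg (by linarith) _
  rw [← hsum]
  refine (mul_le_mul_right hXle _).trans ?_
  rw [ofReal_mul_energy_eq hL0.le (by positivity) (by positivity)]
  have hL2 : 0 < 1 + 2 * L := by positivity
  have h2d : (0 : ℝ) < 2 ^ ((N : ℝ) + 2 * s) := by positivity
  have hLC : 0 ≤ 4 * L * C := by positivity
  have hLV : 0 ≤ 2 * L * 2 ^ ((N : ℝ) + 2 * s) * V := by positivity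
  refine add_le_add (add_le_add (mul_le_mul_left ?_ _) (mul_le_mul_left ?_ _))
    (mul_le_mul_left (mul_le_mul_left ?_ _) _)
  · refine ENNReal.ofReal_le_ofReal ?_
    rw [mul_div_assoc']
    gcongr
    rw [hc]
    gcongr
    linarith
  · refine ENNReal.ofReal_le_ofReal ?_
    calc _ = (1 + 2 * L) * (4 * L * C) * (ρ ^ (2 * (1 - s)) / (ρ - r) ^ 2) := by ring
      _ ≤ _ := by
        rw [hc]
        gcongr
        linarith
  · refine ENNReal.ofReal_le_ofReal ?_
    rw [Real.div_rpow zero_le_two hρr.le, Real.div_rpow zero_le_one hρr.le, Real.one_rpow]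
    calc _ = (1 + 2 * L) * (2 * L * 2 ^ ((N : ℝ) + 2 * s) * V) * R ^ N
          * (1 / (ρ - r) ^ ((N : ℝ) + 2 * s)) := by ring
      _ ≤ _ := by
        rw [hc]
        gcongr
        linarith
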